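/- **Setting.** Let $d\ge 1$, $L>0$, $\Lambda=[-L/2,L/2]^d$, and for $\mathbf q\in\mathbb Z^d$ put $k_{\mathbf q}=\frac{2\pi}{L}\mathbf q$. Let $\phi$ be a bounded, real-valued, even, $L$-periodic function on $\mathbb R^d$ whose Fourier components $\phi_{\mathbf q}=\int_\Lambda\phi(z)e^{-ik_{\mathbf q}\cdot z}dz$ are nonnegative and such that the $\mathbf q\ne 0$ with $\phi_{\mathbf q}\neq 0$ are exactly $\pm\mathbf j_1,\dots,\pm\mathbf j_M$ (nonzero, without repetition). Put $\epsilon_{\mathbf q}=k_{\mathbf q}^2/\phi_{\mathbf q}$. Let $\mathcal F^N$ be the $N$-particle subspace of the bosonic Fock space over $L^2(\Lambda)$, $a_{\mathbf q},a^*_{\mathbf q}$ the annihilation and creation operators of the plane wave modes, $\Omega$ the vacuum, $\eta=\frac1{\sqrt{N!}}(a^*_{\mathbf 0})^N\Omega$, and $$\hat H^0_{\mathbf q}=\sum_{\pm}\Big(k_{\mathbf q}^2+\phi_{\mathbf q}\tfrac{a^*_{\mathbf 0}a_{\mathbf 0}}{N}\Big)a^*_{\pm\mathbf q}a_{\pm\mathbf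 q},\quad W_{\mathbf q}=\tfrac{\phi_{\mathbf q}}{N}a^*_{\mathbf 0}a^*_{\mathbf 0}a_{\mathbf q}a_{-\mathbf q},\quad W^*_{\mathbf q}=\tfrac{\phi_{\mathbf q}}{N}a_{\mathbf 0}a_{\mathbf 0}a^*_{\mathbf q}a^*_{-\mathbf q},$$ $$H_m=\sum_{\mathbf q\notin\{\pm\mathbf j_1,\dots,\pm\mathbf j_m\}}k_{\mathbf q}^2a^*_{\mathbf q}a_{\mathbf q}+\sum_{l=1}^m\big(\hat H^0_{\mathbf j_l}+W_{\mathbf j_l}+W^*_{\mathbf j_l}\big),\qquad E^{Bog}_{\mathbf q}=-\Big[k_{\mathbf q}^2+\phi_{\mathbf q}-\sqrt{(k_{\mathbf q}^2)^2+2\phi_{\mathbf q}k_{\mathbf q}^2}\Big].$$ Let $z_m$ be the ground state energy of $H_m$ on $\mathcal F^N$. **Feshbach–Schur construction** ($N$ even). For even $0\le i\le N-2$ let $Q^{(i,i+1)}_m$ be the projection onto the states in $\mathcal F^N$ with $N-i$ or $N-i-1$ particles in the modes $\pm\mathbf j_m$, and $Q^{(>i+1)}_m$ the projection onto those with fewer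 than $N-i-1$. Write $\mathscr F_{P,Q}(K)=PKP-PKQ(QKQ)^{-1}QKP$, the inverse being taken on the range of $Q$. Put $\mathscr K_m^{(-2)}=H_m-z_m$ and $\mathscr K_m^{(i)}=\mathscr F_{Q_m^{(>i+1)},Q_m^{(i,i+1)}}(\mathscr K_m^{(i-2)})$ for $i=0,2,\dots,N-2$. Starting from $\psi_0=\eta$, let $P$ be the orthogonal projection onto $\mathbb C\psi_{m-1}$, $\overline P=Q_m^{(>N-1)}-P$, $\mathscr K_m^{(N)}=\mathscr F_{P,\overline P}(\mathscr K_m^{(N-2)})$, and $$\psi_m=\Big\{\mathbb 1+\sum_{j=2}^{N/2}\prod_{r=j}^{2}\Big(-\big(Q_m^{(N-2r,N-2r+1)}\mathscr K_m^{(N-2r-2)}Q_m^{(N-2r,N-2r+1)}\big)^{-1}W^*_{\mathbf j_m}Q_m^{(N-2r+2,N-2r+3)}\Big)\Big\}$$ $$\times\Big[Q_m^{(>N-1)}-\big(Q_m^{(N-2,N-1)}\mathscr K_m^{(N-4)}Q_m^{(N-2,N-1)}\big)^{-1}Q_m^{(N-2,N-1)}W^*_{\mathbf j_m}\Big]\Big[P-(\overline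 P\mathscr K_m^{(N-2)}\overline P)^{-1}\overline P\mathscr K_m^{(N-2)}\Big]\psi_{m-1},$$ where in the product the factor $r=j$ is leftmost, and each inverse is taken on the range of the indicated projection, including the projection onto that range on its left. This is $\psi^{Bog}_{\mathbf j_1,\dots,\mathbf j_m}$. **Statement.** There is $\epsilon_0>0$ such that, for all $d,L,\phi,M,\mathbf j_1,\dots,\mathbf j_M$ as above with $\max_{1\le l\le M}\epsilon_{\mathbf j_l}\le\epsilon_0$ and every $\zeta>0$, there are $N_\zeta<\infty$ and, for each $m$, a formal finite sum, with signs and independent of $N$, of finite products of letters $X_l,R_l$ ($1\le l\le m$) with the following property. For every even $N>N_\zeta$ and every $1\le m\le M$: 1. all inverses in the construction of $\mathscr K_m^{(i)}$ ($0\le i\le N$ even) and of $\psi_m$ exist, and $\mathscr K_m^{(N)}=0$; 2. $\psi_m$ is a ground state vector of $H_m$ on $\mathcal F^N$, and the ground state energy $z_m$ is nondegenerate; 3. the resolvents $\frac1{\hat H^0_{\mathbf j_l}-E^{Bog}_{\mathbf j_l}}$, $1\le l\le m$, exist, and the vector $(\psi_m)_\zeta$ obtained by substituting $X_l=W^*_{\mathbf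 j_l}+W_{\mathbf j_l}$ and $R_l=\frac{1}{\hat H^0_{\mathbf j_l}-E^{Bog}_{\mathbf j_l}}$ in the $m$-th formal sum and applying the result to $\eta$ satisfies $$\|\psi_m-(\psi_m)_\zeta\|\le\zeta .$$ -/

import Mathlib

noncomputable section

namespace Bogoliubov

/-! ## Modes, potential -/

/-- Field modes of the `d`-dimensional torus of side `L`: the mode `q` has wave vector `2πq/L`. -/
abbrev Mode (d : ℕ) : Type := Fin d → ℤ

/-- `|k_q|²`, where `k_q = 2πq/L`. -/
def kSq {d : ℕ} (L : ℝ) (q : Mode d) : ℝ := ∑ i, (2 * Real.pi / L * (q i : ℝ)) ^ 2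

/-- The box `[-L/2, L/2]^d`. -/
def box (d : ℕ) (L : ℝ) : Set (Fin d → ℝ) := {x | ∀ i, |x i| ≤ L / 2}

/-- Fourier component `∫_Λ φ(z) exp(-i k_q·z) dz`, so that
`φ(z) = |Λ|⁻¹ ∑_q φ_q exp(i k_q·z)`. -/
def fourierComp {d : ℕ} (L : ℝ) (φ : (Fin d → ℝ) → ℝ) (q : Mode d) : ℂ :=
  ∫ z in box d L,
    (φ z : ℂ) * Complex.exp (-(Complex.I * ((∑ i, 2 * Real.pi / L * (q i : ℝ) * z i : ℝ) : ℂ)))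

/-- The pair potential: bounded, real, periodic, even and of positive type. -/
structure IsPairPotential {d : ℕ} (L : ℝ) (φ : (Fin d → ℝ) → ℝ) : Prop where
  measurable : MeasureTheory.AEStronglyMeasurable φ MeasureTheory.volume
  bounded : ∃ C : ℝ, ∀ z, |φ z| ≤ C
  periodic : ∀ (z : Fin d → ℝ) (q : Mode d), φ (fun i => z i + (q i : ℝ) * L) = φ z
  even : ∀ z, φ (-z) = φ z
  posType : ∀ q : Mode d, ∃ r : ℝ, 0 ≤ r ∧ fourierComp L φ q = (r : ℂ)

/-- The (real) Fourier component `φ_q` of a pair potential. -/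
def phiHat {d : ℕ} (L : ℝ) (φ : (Fin d → ℝ) → ℝ) (q : Mode d) : ℝ := (fourierComp L φ q).re

/-- `±j 1, …, ±j M` enumerates, without repetition, the nonzero modes at which the Fourier
components (given by `c`) do not vanish.  (The values of `j` outside `1, …, M` play no role.) -/
structure IsModeList {d : ℕ} (c : Mode d → ℝ) (M : ℕ) (j : ℕ → Mode d) : Prop where
  ne_zero : ∀ l ∈ Finset.Icc 1 M, j l ≠ 0
  inj : ∀ l ∈ Finset.Icc 1 M, ∀ l' ∈ Finset.Icc 1 M, j l = j l' ∨ j l = -j l' → l = l'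
  cutoff : ∀ q : Mode d, q ≠ 0 →
    (c q ≠ 0 ↔ ∃ l ∈ Finset.Icc 1 M, q = j l ∨ q = -j l)

/-! ## Fock space -/

/-- Occupation numbers of the modes. -/
abbrev Occ (d : ℕ) : Type := Mode d →₀ ℕ

/-- The bosonic Fock space over `L²(Λ)`, in the occupation number representation with respect to
the plane waves. -/
abbrev Fock (d : ℕ) : Type := lp (fun _ : Occ d => ℂ) 2

/-- The dense subspace of finite linear combinations of occupation number states; it is invariant
under all creation and annihilation operators and it contains all vectors occurring below.
Every Hamiltonian below leaves invariant a decomposition of it into mutually orthogonal finite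
dimensional subspaces (spanned by occupation number states), so it is a core of their self-adjoint
realizations, and inverses can be computed on it. -/
abbrev FinFock (d : ℕ) : Type := Occ d →₀ ℂ

/-- The occupation number state `|n⟩`. -/
def ket {d : ℕ} (n : Occ d) : FinFock d := Finsupp.single n 1

/-- The inclusion into the Hilbert space; the kets are orthonormal. -/
def toFock {d : ℕ} : FinFock d →ₗ[ℂ] Fock d :=
  Finsupp.linearCombination ℂ (fun n => lp.single 2 n (1 : ℂ))

/-- Operators on `FinFock d`. -/
abbrev Op (d : ℕ) : Type := Module.End ℂ (FinFock d)

/-- Scalar product of the Fock space (antilinear in the first argument). -/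
def ip {d : ℕ} (u v : FinFock d) : ℂ := inner ℂ (toFock u) (toFock v)

/-- Annihilation operator, `a_q |n⟩ = √(n_q) |n - e_q⟩`. -/
def ann {d : ℕ} (q : Mode d) : Op d :=
  Finsupp.linearCombination ℂ (fun n : Occ d =>
    ((Real.sqrt (n q : ℝ) : ℝ) : ℂ) • ket (n - Finsupp.single q 1))

/-- Creation operator, `a*_q |n⟩ = √(n_q + 1) |n + e_q⟩`. -/
def cre {d : ℕ} (q : Mode d) : Op d :=
  Finsupp.linearCombination ℂ (fun n : Occ d =>
    ((Real.sqrt ((n q : ℝ) + 1) : ℝ) : ℂ) • ket (n + Finsupp.single q 1))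

/-- The state with `N` particles in the zero mode, `(N!)^{-1/2} (a*_0)^N Ω`. -/
def eta (d N : ℕ) : FinFock d :=
  ((Real.sqrt (Nat.factorial N : ℝ) : ℝ) : ℂ)⁻¹ • ((cre (0 : Mode d)) ^ N) (ket 0)

/-- Vectors with `N` particles. -/
def nParticle (d N : ℕ) : Submodule ℂ (FinFock d) :=
  Finsupp.supported ℂ ℂ {n : Occ d | n.degree = N}

/-- Orthogonal projection onto the span of the states `|n⟩` with `p n`. -/
def proj {d : ℕ} (p : Occ d → Prop) : Op d :=
  open Classical in Finsupp.linearCombination ℂ (fun n : Occ d => if p n then ket n else 0)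

/-- Orthogonal projection onto the line spanned by `ψ`. -/
def lineProj {d : ℕ} (ψ : FinFock d) : Op d :=
  (ip ψ ψ)⁻¹ • (((innerSL ℂ (toFock ψ)).toLinearMap ∘ₗ toFock).smulRight ψ)

/-! ## Hamiltonians

`c q` stands for the Fourier component `φ_q` of the potential. -/

/-- Free part `Ĥ⁰_q` of the three-modes Hamiltonian. -/
def H0 {d : ℕ} (L : ℝ) (c : Mode d → ℝ) (N : ℕ) (q : Mode d) : Op d :=
  ((kSq L q : ℂ) • 1 + ((c q / N : ℝ) : ℂ) • (cre 0 * ann 0)) * (cre q * ann q) +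
  ((kSq L q : ℂ) • 1 + ((c q / N : ℝ) : ℂ) • (cre 0 * ann 0)) * (cre (-q) * ann (-q))

/-- `W_q = φ_q a*_0 a*_0 a_q a_{-q} / N`. -/
def W {d : ℕ} (c : Mode d → ℝ) (N : ℕ) (q : Mode d) : Op d :=
  ((c q / N : ℝ) : ℂ) • (cre 0 * cre 0 * ann q * ann (-q))

/-- `W*_q = φ_q a_0 a_0 a*_q a*_{-q} / N`. -/
def Wstar {d : ℕ} (c : Mode d → ℝ) (N : ℕ) (q : Mode d) : Op d :=
  ((c q / N : ℝ) : ℂ) • (ann 0 * ann 0 * cre q * cre (-q))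

/-- `Ĥ^{Bog}_q = Ĥ⁰_q + W_q + W*_q`. -/
def HhatBog {d : ℕ} (L : ℝ) (c : Mode d → ℝ) (N : ℕ) (q : Mode d) : Op d :=
  H0 L c N q + W c N q + Wstar c N q

/-- Kinetic energy `∑ k_q² a*_q a_q` of all modes `q` other than `±j 1, …, ±j m`
(on `|n⟩` only the occupied modes contribute). -/
def freeKin {d : ℕ} (L : ℝ) (j : ℕ → Mode d) (m : ℕ) : Op d :=
  open Classical in Finsupp.linearCombination ℂ (fun n : Occ d =>
    ∑ q ∈ n.support with ¬ ∃ l ∈ Finset.Icc 1 m, q = j l ∨ q = -j l,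
      (kSq L q : ℂ) • (cre q * ann q) (ket n))

/-- Intermediate Bogoliubov Hamiltonian `H^{Bog}_{j_1,…,j_m}`. -/
def HBog {d : ℕ} (L : ℝ) (c : Mode d → ℝ) (N : ℕ) (j : ℕ → Mode d) (m : ℕ) : Op d :=
  freeKin L j m + ∑ l ∈ Finset.Icc 1 m, HhatBog L c N (j l)

/-- `E^{Bog}_q`. -/
def EBog {d : ℕ} (L : ℝ) (c : Mode d → ℝ) (q : Mode d) : ℝ :=
  -(kSq L q + c q - Real.sqrt (kSq L q ^ 2 + 2 * c q * kSq L q))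

/-- Values of the quadratic form of `A` on the unit sphere of the `N`-particle space. -/
def formValues {d : ℕ} (N : ℕ) (A : Op d) : Set ℝ :=
  {x | ∃ v ∈ nParticle d N, ‖toFock v‖ = 1 ∧ x = (ip v (A v)).re}

/-- Ground state energy `z^{Bog}_{j_1,…,j_m}` of `H^{Bog}_{j_1,…,j_m}` on the `N`-particle space. -/
def zBog {d : ℕ} (L : ℝ) (c : Mode d → ℝ) (N : ℕ) (j : ℕ → Mode d) (m : ℕ) : ℝ :=
  sInf (formValues N (HBog L c N j m))

/-- `ψ` is a ground state of `A` on the `N`-particle space, with nondegenerate energy `z`. -/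
structure IsGroundState {d : ℕ} (N : ℕ) (A : Op d) (z : ℝ) (ψ : FinFock d) : Prop where
  mem : ψ ∈ nParticle d N
  ne_zero : ψ ≠ 0
  eigen : A ψ = (z : ℂ) • ψ
  least : IsLeast (formValues N A) z
  nondeg : ∀ v ∈ nParticle d N, A v = (z : ℂ) • v → ∃ t : ℂ, v = t • ψ

/-! ## Feshbach–Schur flow -/

/-- For a projection `Q`, the operator `Q A Q` is invertible on the range of `Q`. -/
def CompInvertible {d : ℕ} (Q A : Op d) : Prop := IsUnit (Q * A * Q + (1 - Q))

/-- `Q (Q A Q)⁻¹ Q`, the inverse being taken on the range of `Q`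
(meaningful if `CompInvertible Q A`). -/
def compInv {d : ℕ} (Q A : Op d) : Op d := Q * Ring.inverse (Q * A * Q + (1 - Q)) * Q

/-- Feshbach–Schur map `P K P - P K Q (Q K Q)⁻¹ Q K P`. -/
def feshbach {d : ℕ} (P Q K : Op d) : Op d := P * K * P - P * K * compInv Q K * K * P

/-- `Q^{(i,i+1)}_q`: projection onto the `N`-particle states with `N-i` or `N-i-1` particles in the
modes `±q`. -/
def Qeq {d : ℕ} (N : ℕ) (q : Mode d) (i : ℕ) : Op d :=
  proj (fun n => n.degree = N ∧ (n q + n (-q) + i = N ∨ n q + n (-q) + i + 1 = N))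

/-- `Q^{(>i+1)}_q`: projection onto the `N`-particle states with fewer than `N-i-1` particles in
the modes `±q`. -/
def Qgt {d : ℕ} (N : ℕ) (q : Mode d) (i : ℕ) : Op d :=
  proj (fun n => n.degree = N ∧ n q + n (-q) + i + 1 < N)

/-- The flow started from `A = H - z`: `kappa N q A s` is `𝒦^{(2s-2)}`, i.e. `𝒦^{(-2)} = A` and
`𝒦^{(i)} = ℱ^{(i)}(𝒦^{(i-2)})`, where `ℱ^{(i)}` is the Feshbach–Schur map of the pair
`Q^{(>i+1)}_q`, `Q^{(i,i+1)}_q`. -/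
def kappa {d : ℕ} (N : ℕ) (q : Mode d) (A : Op d) : ℕ → Op d
  | 0 => A
  | s + 1 => feshbach (Qgt N q (2 * s)) (Qeq N q (2 * s)) (kappa N q A s)

/-- The complementary projection of `|ψ⟩⟨ψ|` in the space `Q^{(>N-1)}_q ℱ^N` of states without
particles in the modes `±q`. -/
def linePerp {d : ℕ} (N : ℕ) (q : Mode d) (ψ : FinFock d) : Op d :=
  Qgt N q (N - 2) - lineProj ψ

/-- All Feshbach–Schur maps `ℱ^{(0)}, ℱ^{(2)}, …, ℱ^{(N-2)}` and the final one, with projection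
onto the line of `ψ`, are well defined on the flow started from `A`. -/
def FlowDefined {d : ℕ} (N : ℕ) (q : Mode d) (A : Op d) (ψ : FinFock d) : Prop :=
  (∀ s < N / 2, CompInvertible (Qeq N q (2 * s)) (kappa N q A s)) ∧
    CompInvertible (linePerp N q ψ) (kappa N q A (N / 2))

/-- The final Feshbach–Schur operator `𝒦^{(N)}`. -/
def kappaFinal {d : ℕ} (N : ℕ) (q : Mode d) (A : Op d) (ψ : FinFock d) : Op d :=
  feshbach (lineProj ψ) (linePerp N q ψ) (kappa N q A (N / 2))

/-- `-(Q^{(N-2r,N-2r+1)} 𝒦^{(N-2r-2)} Q^{(N-2r,N-2r+1)})⁻¹ W*_{N-2r,N-2r+2}`, where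
`W*_{i,i+2} = Q^{(i,i+1)} W* Q^{(i+2,i+3)}`. -/
def gsFactor {d : ℕ} (c : Mode d → ℝ) (N : ℕ) (q : Mode d) (A : Op d) (r : ℕ) : Op d :=
  -(compInv (Qeq N q (N - 2 * r)) (kappa N q A (N / 2 - r)) *
    (Qeq N q (N - 2 * r) * Wstar c N q * Qeq N q (N - 2 * r + 2)))

/-- The ordered product `gsFactor r ⋯ gsFactor 3 * gsFactor 2` (equal to `1` for `r ≤ 1`). -/
def gsProd {d : ℕ} (c : Mode d → ℝ) (N : ℕ) (q : Mode d) (A : Op d) : ℕ → Op d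
  | 0 => 1
  | 1 => 1
  | r + 2 => gsFactor c N q A (r + 2) * gsProd c N q A (r + 1)

/-- The operator `T_m` reconstructing the ground state after a flow in the modes `±q` which started
from `A` and ended with the projection onto the line of `ψ`. -/
def gsT {d : ℕ} (c : Mode d → ℝ) (N : ℕ) (q : Mode d) (A : Op d) (ψ : FinFock d) : Op d :=
  ((∑ r ∈ Finset.Icc 2 (N / 2), gsProd c N q A r) + 1) *
  (Qgt N q (N - 2) -
    compInv (Qeq N q (N - 2)) (kappa N q A (N / 2 - 1)) * Qeq N q (N - 2) * Wstar c N q) *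
  (lineProj ψ -
    compInv (linePerp N q ψ) (kappa N q A (N / 2)) * linePerp N q ψ * kappa N q A (N / 2))

/-- `H^{Bog}_{j_1,…,j_m} - z^{Bog}_{j_1,…,j_m}`. -/
def shifted {d : ℕ} (L : ℝ) (c : Mode d → ℝ) (N : ℕ) (j : ℕ → Mode d) (m : ℕ) : Op d :=
  HBog L c N j m - (zBog L c N j m : ℂ) • 1

/-- The vectors `ψ^{Bog}_{j_1,…,j_m} = T_m ψ^{Bog}_{j_1,…,j_{m-1}}`, starting from `η`. -/
def psiBog {d : ℕ} (L : ℝ) (c : Mode d → ℝ) (N : ℕ) (j : ℕ → Mode d) : ℕ → FinFock d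
  | 0 => eta d N
  | m + 1 =>
    gsT c N (j (m + 1)) (shifted L c N j (m + 1)) (psiBog L c N j m) (psiBog L c N j m)

/-! ## Bare expressions -/

/-- The letters: `inl l` is `W*_{j_{l+1}} + W_{j_{l+1}}`, and `inr l` is the resolvent
`(Ĥ⁰_{j_{l+1}} - E^{Bog}_{j_{l+1}})⁻¹`. -/
def letter {d : ℕ} (L : ℝ) (c : Mode d → ℝ) (N : ℕ) (j : ℕ → Mode d) (m : ℕ) :
    Fin m ⊕ Fin m → Op d
  | Sum.inl l => Wstar c N (j (l + 1)) + W c N (j (l + 1))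
  | Sum.inr l => Ring.inverse (H0 L c N (j (l + 1)) - (EBog L c (j (l + 1)) : ℂ) • 1)

/-- Value, for `N` particles, of a formal finite sum of finite products (with signs) of letters.
The formal expression itself does not involve `N`. -/
def evalBare {d : ℕ} (L : ℝ) (c : Mode d → ℝ) (N : ℕ) (j : ℕ → Mode d) (m : ℕ)
    (p : FreeAlgebra ℤ (Fin m ⊕ Fin m)) : Op d :=
  FreeAlgebra.lift ℤ (letter L c N j m) p

end Bogoliubov

end

open Bogoliubov

noncomputable section

namespace Bogoliubov

variable {d : ℕ}

/-! ## Coordinates in the occupation number representation -/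

/-! For large `N` every vector of `N` particles whose energy does not exceed the ground state energy
is nearly a multiple of one explicit product state. Invertibility of all Feshbach–Schur
compressions, nondegeneracy and the approximation by bare expressions all follow from this rigidity.

Rigidity. The Hamiltonian of a pair `±q` equals `(1/N)(S_q* S_q + S_{-q}* S_{-q})` plus a diagonal
operator, where `S_q = α a*₀ a_q + β a*_{-q} a₀` and `2αβ = φ_q` (`HhatBog_eq`). If `α², β²` have
sum `φ_q + k_q²`, the diagonal part is at least `E^Bog_q - O(1/N)` (`sqRest_ge`); with sum `φ_q +
k_q²/2` it controls the number of excitations (`sqRest_ge_number`). For states of energy close to `∑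
E^Bog` the squares divided by `N` are therefore small. In the limit this is a recursion forcing the
amplitudes to be products of powers of `-β/α`, up to the vacuum component
(`Admissible.tendsto_amplitude`, `Admissible.stability`). The truncated product state `trial` has
energy `∑ E^Bog + o(1)`, since the squares act on it only near the cutoff, where amplitudes are
exponentially small (`Admissible.trial_energy`). Hence low-energy vectors are close to multiples of
`trial` and are dominated by their vacuum component (`Admissible.low_energy_close`,
`Admissible.low_energy_vac`).

Flow. A kernel vector of a compressed operator lifts to a vector `Φ` with `⟨Φ, (H - z)Φ⟩ = 0` and no
vacuum component, so it vanishes (`FlowData.compInvertible_Qeq`). In the last step `Φ` is orthogonal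
to `ψ_{m-1}` instead, which is excluded because `ψ_{m-1}` is close to `trial` for `m-1` pairs
(`BogLimit.pos_orth`). Injectivity gives invertibility on invariant finite dimensional sectors. A
true ground state vector forces the final operator to be zero, so the reconstruction is a ground
state (`FlowData.gsT_spec`). It satisfies `⟨ψ_{m-1}, ψ_m⟩ = ⟨ψ_{m-1}, ψ_{m-1}⟩`, which makes its
vacuum component tend to `1`; thus `ψ_m` is asymptotically `trial` for `m` pairs and the induction
on `m` proceeds (`BogLimit.succ`).

Bare expressions. Since `ψ_m` is close to the fixed finite combination `trial`, it is enough to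
approximate that combination. As `N → ∞` the letters converge to operators on finitely supported
real functions of the occupation numbers (`Admissible.conv_evalBare`). Only integer coefficients are
available, so the orbit of the vacuum is merely an additive group. A resolvent eigenvalue which is
not an integer supplies powers of its fractional part, and integer multiples of these approximate
every real number (`mem_lineHull_of_pow`). Distinct eigenvalues of the resolvent separate the two
states produced by `W* + W`, so every balanced configuration is reached
(`Admissible.single_mem_lineHull`, `Admissible.exists_bare`). -/

theorem ket_apply (n m : Occ d) : ket n m = if n = m then 1 else 0 := by
  classical
  simp only [ket, Finsupp.single_apply]

theorem single_eq_smul_ket (n : Occ d) (a : ℂ) : Finsupp.single n a = a • ket n := by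
  simp [ket]

/-- Two linear maps which agree on the kets are equal. -/
theorem ket_ext {V : Type*} [AddCommMonoid V] [Module ℂ V] {A B : FinFock d →ₗ[ℂ] V}
    (h : ∀ n, A (ket n) = B (ket n)) : A = B := by
  apply Finsupp.lhom_ext
  intro n a
  rw [single_eq_smul_ket, map_smul, map_smul, h]

theorem ann_ket (q : Mode d) (n : Occ d) :
    ann q (ket n) = ((Real.sqrt (n q : ℝ) : ℝ) : ℂ) • ket (n - Finsupp.single q 1) := by
  simp [ann, ket]

theorem cre_ket (q : Mode d) (n : Occ d) :
    cre q (ket n) = ((Real.sqrt ((n q : ℝ) + 1) : ℝ) : ℂ) • ket (n + Finsupp.single q 1) := by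
  simp [cre, ket]

theorem proj_ket (p : Occ d → Prop) [Decidable (p n)] :
    proj p (ket n) = if p n then ket n else 0 := by
  classical
  simp [proj, ket]

/-- The operator which is diagonal on the kets, with eigenvalues `g`. -/
def diag (g : Occ d → ℂ) : Op d := Finsupp.linearCombination ℂ (fun n => g n • ket n)

theorem diag_ket (g : Occ d → ℂ) (n : Occ d) : diag g (ket n) = g n • ket n := by
  simp [diag, ket]

theorem diag_apply (g : Occ d → ℂ) (v : FinFock d) (n : Occ d) : diag g v n = g n * v n := by
  classical
  induction v using Finsupp.induction_linear with
  | zero => simp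
  | add u v hu hv => simp [hu, hv, mul_add]
  | single m a =>
    rw [single_eq_smul_ket, map_smul, diag_ket]
    simp only [Finsupp.smul_apply, ket_apply, smul_eq_mul]
    by_cases h : m = n
    · subst h; simp [mul_comm]
    · simp [h]

theorem proj_apply (p : Occ d → Prop) (v : FinFock d) (n : Occ d) [Decidable (p n)] :
    proj p v n = if p n then v n else 0 := by
  classical
  induction v using Finsupp.induction_linear with
  | zero => simp
  | add u v hu hv => simp only [map_add, Finsupp.add_apply, hu, hv]; split_ifs <;> simp
  | single m a =>
    rw [single_eq_smul_ket, map_smul, proj_ket]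
    by_cases h : m = n
    · subst h; split_ifs <;> simp
    · split_ifs <;> simp [ket_apply, h]

theorem ann_apply (q : Mode d) (v : FinFock d) (n : Occ d) :
    ann q v n = ((Real.sqrt ((n q : ℝ) + 1) : ℝ) : ℂ) * v (n + Finsupp.single q 1) := by
  classical
  induction v using Finsupp.induction_linear with
  | zero => simp
  | add u v hu hv => simp [hu, hv, mul_add]
  | single m a =>
    rw [single_eq_smul_ket, map_smul, ann_ket]
    simp only [Finsupp.smul_apply, ket_apply, smul_eq_mul]
    by_cases h : m = n + Finsupp.single q 1
    · subst h; simp [mul_comm]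
    -- Truncated subtraction would send `m` to itself here, but the factor `√(m q)` vanishes.
    · by_cases hq : m q = 0
      · simp [hq, h]
      · have : m - Finsupp.single q 1 ≠ n := by
          rintro rfl
          apply h
          rw [tsub_add_cancel_of_le]
          rw [Finsupp.single_le_iff]; omega
        simp [h, this]

/-- When `n q = 0` the truncated subtraction is meaningless, but its coefficient `√(n q)` is then
zero. -/
theorem cre_apply (q : Mode d) (v : FinFock d) (n : Occ d) :
    cre q v n = ((Real.sqrt (n q : ℝ) : ℝ) : ℂ) * v (n - Finsupp.single q 1) := by
  classical
  induction v using Finsupp.induction_linear with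
  | zero => simp
  | add u v hu hv => simp [hu, hv, mul_add]
  | single m a =>
    rw [single_eq_smul_ket, map_smul, cre_ket]
    simp only [Finsupp.smul_apply, ket_apply, smul_eq_mul]
    by_cases h : m + Finsupp.single q 1 = n
    · subst h; simp [mul_comm]
    · by_cases hq : n q = 0
      · simp [hq, h]
      · have : m ≠ n - Finsupp.single q 1 := by
          rintro rfl
          apply h
          rw [tsub_add_cancel_of_le]
          rw [Finsupp.single_le_iff]; omega
        simp [h, this]

/-! ## Scalar product -/

theorem toFock_apply (v : FinFock d) (n : Occ d) : (toFock v : Occ d → ℂ) n = v n := by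
  classical
  induction v using Finsupp.induction_linear with
  | zero => simp
  | add u v hu hv => simp [hu, hv]
  | single m a =>
    simp only [toFock, Finsupp.linearCombination_single, lp.coeFn_smul, Pi.smul_apply, smul_eq_mul,
      lp.single_apply, Finsupp.single_apply]
    by_cases h : m = n
    · subst h; simp
    · simp [h, Ne.symm h]

theorem toFock_injective : Function.Injective (toFock (d := d)) := by
  intro u v h
  ext n
  rw [← toFock_apply u, ← toFock_apply v, h]

theorem ip_eq_tsum (u v : FinFock d) : ip u v = ∑' n, (starRingEnd ℂ) (u n) * v n := by
  simp only [ip, lp.inner_eq_tsum, toFock_apply, RCLike.inner_apply, mul_comm]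

theorem ip_eq_sum (u v : FinFock d) (s : Finset (Occ d)) (h : v.support ⊆ s) :
    ip u v = ∑ n ∈ s, (starRingEnd ℂ) (u n) * v n := by
  rw [ip_eq_tsum, tsum_eq_sum]
  intro n hn
  have : v n = 0 := Finsupp.notMem_support_iff.1 (fun h' => hn (h h'))
  simp [this]

theorem ip_ket_left (n : Occ d) (v : FinFock d) : ip (ket n) v = v n := by
  rw [ip_eq_tsum, tsum_eq_single n]
  · simp [ket_apply]
  · intro m hm
    simp [ket_apply, Ne.symm hm]

theorem ip_add_left (u v w : FinFock d) : ip (u + v) w = ip u w + ip v w := by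
  simp [ip]

theorem ip_add_right (u v w : FinFock d) : ip u (v + w) = ip u v + ip u w := by
  simp [ip]

theorem ip_sub_left (u v w : FinFock d) : ip (u - v) w = ip u w - ip v w := by
  simp [ip]

theorem ip_sub_right (u v w : FinFock d) : ip u (v - w) = ip u v - ip u w := by
  simp [ip]

theorem ip_smul_left (a : ℂ) (u v : FinFock d) : ip (a • u) v = (starRingEnd ℂ) a * ip u v := by
  simp [ip, mul_comm]

theorem ip_smul_right (a : ℂ) (u v : FinFock d) : ip u (a • v) = a * ip u v := by
  simp [ip]

theorem ip_zero_left (v : FinFock d) : ip 0 v = 0 := by simp [ip]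

theorem ip_zero_right (v : FinFock d) : ip v 0 = 0 := by simp [ip]

theorem ip_conj (u v : FinFock d) : (starRingEnd ℂ) (ip u v) = ip v u := by
  simp [ip]

theorem ip_self (v : FinFock d) : ip v v = ((‖toFock v‖ ^ 2 : ℝ) : ℂ) := by
  simp [ip]

theorem norm_toFock_eq_zero {v : FinFock d} : ‖toFock v‖ = 0 ↔ v = 0 := by
  rw [norm_eq_zero, ← map_zero (toFock (d := d)), toFock_injective.eq_iff]

theorem norm_ip_le (u v : FinFock d) : ‖ip u v‖ ≤ ‖toFock u‖ * ‖toFock v‖ := norm_inner_le_norm _ _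

theorem norm_apply_le (v : FinFock d) (n : Occ d) : ‖v n‖ ≤ ‖toFock v‖ := by
  rw [← toFock_apply]; exact lp.norm_apply_le_norm (by norm_num) _ _

/-- `∑ₙ g n |vₙ|²`. -/
def wsum (g : Occ d → ℝ) (v : FinFock d) : ℝ := ∑ n ∈ v.support, g n * ‖v n‖ ^ 2

theorem wsum_eq_sum (g : Occ d → ℝ) (v : FinFock d) (s : Finset (Occ d)) (h : v.support ⊆ s) :
    wsum g v = ∑ n ∈ s, g n * ‖v n‖ ^ 2 := by
  apply Finset.sum_subset h
  intro n _ hn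
  simp [Finsupp.notMem_support_iff.1 hn]

theorem ip_diag (g : Occ d → ℝ) (v : FinFock d) :
    ip v (diag (fun n => (g n : ℂ)) v) = (wsum g v : ℂ) := by
  rw [ip_eq_sum v _ v.support, wsum]
  · push_cast
    refine Finset.sum_congr rfl fun n _ => ?_
    rw [diag_apply, ← Complex.conj_mul']
    ring
  · intro n
    simp only [Finsupp.mem_support_iff, diag_apply]
    exact fun h h' => h (by simp [h'])

theorem norm_sq_eq_wsum (v : FinFock d) : ‖toFock v‖ ^ 2 = wsum (fun _ => 1) v := by
  have h := ip_diag (fun _ => 1) v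
  have : diag (fun _ => ((1 : ℝ) : ℂ)) v = v := by
    ext n; simp [diag_apply]
  rw [this, ip_self] at h
  exact_mod_cast h

/-- The weights need only be compared where `v` is nonzero, so bounds valid for `N`-particle
occupation numbers suffice. -/
theorem wsum_mono {g h : Occ d → ℝ} {v : FinFock d} (H : ∀ n, v n ≠ 0 → g n ≤ h n) :
    wsum g v ≤ wsum h v := by
  apply Finset.sum_le_sum
  intro n hn
  exact mul_le_mul_of_nonneg_right (H n (Finsupp.mem_support_iff.1 hn)) (by positivity)

theorem wsum_add (g h : Occ d → ℝ) (v : FinFock d) :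
    wsum (fun n => g n + h n) v = wsum g v + wsum h v := by
  simp [wsum, add_mul, Finset.sum_add_distrib]

theorem wsum_const_mul (a : ℝ) (g : Occ d → ℝ) (v : FinFock d) :
    wsum (fun n => a * g n) v = a * wsum g v := by
  simp [wsum, Finset.mul_sum, mul_assoc]

theorem wsum_const (a : ℝ) (v : FinFock d) : wsum (fun _ => a) v = a * ‖toFock v‖ ^ 2 := by
  rw [norm_sq_eq_wsum, ← wsum_const_mul]; simp

theorem wsum_sum {ι : Type*} (s : Finset ι) (g : ι → Occ d → ℝ) (v : FinFock d) :
    wsum (fun n => ∑ i ∈ s, g i n) v = ∑ i ∈ s, wsum (g i) v := by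
  simp only [wsum, Finset.sum_mul]
  rw [Finset.sum_comm]

theorem wsum_nonneg {g : Occ d → ℝ} {v : FinFock d} (H : ∀ n, v n ≠ 0 → 0 ≤ g n) :
    0 ≤ wsum g v := by
  apply Finset.sum_nonneg
  intro n hn
  exact mul_nonneg (H n (Finsupp.mem_support_iff.1 hn)) (by positivity)

/-- `B` is a formal adjoint of `A`. -/
def IsAdj (A B : Op d) : Prop := ∀ u v, ip (A u) v = ip u (B v)

theorem IsAdj.symm {A B : Op d} (h : IsAdj A B) : IsAdj B A := by
  intro u v
  rw [← ip_conj, ← h, ip_conj]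

theorem IsAdj.add {A B A' B' : Op d} (h : IsAdj A B) (h' : IsAdj A' B') :
    IsAdj (A + A') (B + B') := by
  intro u v
  simp [ip_add_left, ip_add_right, h u v, h' u v]

theorem IsAdj.sub {A B A' B' : Op d} (h : IsAdj A B) (h' : IsAdj A' B') :
    IsAdj (A - A') (B - B') := by
  intro u v
  simp [ip_sub_left, ip_sub_right, h u v, h' u v]

theorem IsAdj.mul {A B A' B' : Op d} (h : IsAdj A B) (h' : IsAdj A' B') :
    IsAdj (A * A') (B' * B) := by
  intro u v
  simp [h _ v, h' u]

theorem IsAdj.real_smul {A B : Op d} (h : IsAdj A B) (a : ℝ) :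
    IsAdj ((a : ℂ) • A) ((a : ℂ) • B) := by
  intro u v
  rw [LinearMap.smul_apply, LinearMap.smul_apply, ip_smul_left, ip_smul_right, h u v,
    Complex.conj_ofReal]

theorem IsAdj.one : IsAdj (1 : Op d) 1 := fun _ _ => rfl

theorem IsAdj.zero : IsAdj (0 : Op d) 0 := fun u v => by simp [ip_zero_left, ip_zero_right]

theorem IsAdj.sum {ι : Type*} {s : Finset ι} {A B : ι → Op d} (h : ∀ i ∈ s, IsAdj (A i) (B i)) :
    IsAdj (∑ i ∈ s, A i) (∑ i ∈ s, B i) := by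
  classical
  induction s using Finset.induction_on with
  | empty => simpa using IsAdj.zero
  | insert i s hi ih =>
    rw [Finset.sum_insert hi, Finset.sum_insert hi]
    exact (h i (by simp)).add (ih fun k hk => h k (by simp [hk]))

theorem IsAdj.norm_sq {A B : Op d} (h : IsAdj A B) (v : FinFock d) :
    ip v ((B * A) v) = ((‖toFock (A v)‖ ^ 2 : ℝ) : ℂ) := by
  rw [← ip_self, h]; rfl

theorem isAdj_of_ket {A B : Op d} (h : ∀ n v, ip (A (ket n)) v = ip (ket n) (B v)) :
    IsAdj A B := by
  intro u v
  induction u using Finsupp.induction_linear with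
  | zero => simp [ip_zero_left]
  | add u w hu hw => simp [ip_add_left, hu, hw]
  | single m a => rw [single_eq_smul_ket, map_smul, ip_smul_left, ip_smul_left, h]

theorem isAdj_cre_ann (q : Mode d) : IsAdj (cre q) (ann q) := by
  apply isAdj_of_ket
  intro n v
  rw [cre_ket, ip_smul_left, ip_ket_left, ip_ket_left, ann_apply, Complex.conj_ofReal]

theorem isAdj_ann_cre (q : Mode d) : IsAdj (ann q) (cre q) := (isAdj_cre_ann q).symm

theorem isAdj_diag (g : Occ d → ℝ) :
    IsAdj (diag (fun n => (g n : ℂ))) (diag (fun n => (g n : ℂ))) := by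
  apply isAdj_of_ket
  intro n v
  rw [diag_ket, ip_smul_left, ip_ket_left, ip_ket_left, diag_apply, Complex.conj_ofReal]

theorem isAdj_proj (p : Occ d → Prop) : IsAdj (proj p) (proj p) := by
  classical
  apply isAdj_of_ket
  intro n v
  rw [proj_ket, ip_ket_left, proj_apply]
  split_ifs
  · rw [ip_ket_left]
  · rw [ip_zero_left]

/-! ## Commutation relations -/

theorem diag_mul (f g : Occ d → ℂ) : diag f * diag g = diag (fun n => f n * g n) := by
  apply ket_ext; intro n
  simp only [Module.End.mul_apply, diag_ket, map_smul, smul_smul, mul_comm]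

theorem diag_add (f g : Occ d → ℂ) : diag f + diag g = diag (fun n => f n + g n) := by
  apply ket_ext; intro n
  simp only [LinearMap.add_apply, diag_ket, add_smul]

theorem diag_sub (f g : Occ d → ℂ) : diag f - diag g = diag (fun n => f n - g n) := by
  apply ket_ext; intro n
  simp only [LinearMap.sub_apply, diag_ket, sub_smul]

theorem smul_diag (a : ℂ) (g : Occ d → ℂ) : a • diag g = diag (fun n => a * g n) := by
  apply ket_ext; intro n
  simp only [LinearMap.smul_apply, diag_ket, smul_smul]

theorem one_eq_diag : (1 : Op d) = diag (fun _ => 1) := by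
  apply ket_ext; intro n
  simp only [Module.End.one_apply, diag_ket, one_smul]

theorem cre_mul_ann_self (q : Mode d) : cre q * ann q = diag (fun n => (n q : ℂ)) := by
  refine LinearMap.ext fun v => Finsupp.ext fun n => ?_
  rw [Module.End.mul_apply, cre_apply, ann_apply, diag_apply]
  by_cases h : n q = 0
  · simp [h]
  · have h1 : n - Finsupp.single q 1 + Finsupp.single q 1 = n := by
      rw [tsub_add_cancel_of_le]; rw [Finsupp.single_le_iff]; omega
    have h2 : (((n - Finsupp.single q 1 : Occ d) q : ℕ) : ℝ) + 1 = n q := by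
      simp only [Finsupp.tsub_apply, Finsupp.single_eq_same]
      rw [Nat.cast_sub (by omega)]; simp
    rw [h1, h2, ← mul_assoc, ← Complex.ofReal_mul, Real.mul_self_sqrt (by positivity)]
    simp

theorem ann_mul_cre_self (q : Mode d) : ann q * cre q = diag (fun n => (n q : ℂ) + 1) := by
  refine LinearMap.ext fun v => Finsupp.ext fun n => ?_
  rw [Module.End.mul_apply, ann_apply, cre_apply, diag_apply]
  have h2 : (((n + Finsupp.single q 1 : Occ d) q : ℕ) : ℝ) = n q + 1 := by simp
  rw [add_tsub_cancel_right, h2, ← mul_assoc, ← Complex.ofReal_mul,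
    Real.mul_self_sqrt (by positivity)]
  simp

theorem commute_ann_ann (p q : Mode d) : Commute (ann p) (ann q) := by
  classical
  by_cases hpq : p = q
  · subst hpq; exact Commute.refl _
  refine LinearMap.ext fun v => Finsupp.ext fun n => ?_
  simp only [Module.End.mul_apply, ann_apply, Finsupp.add_apply, Finsupp.single_apply, hpq,
    Ne.symm hpq, if_false, add_zero, add_right_comm n (Finsupp.single p 1)]
  ring

theorem commute_cre_cre (p q : Mode d) : Commute (cre p) (cre q) := by
  classical
  by_cases hpq : p = q
  · subst hpq; exact Commute.refl _
  refine LinearMap.ext fun v => Finsupp.ext fun n => ?_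
  simp only [Module.End.mul_apply, cre_apply, Finsupp.tsub_apply, Finsupp.single_apply, hpq,
    Ne.symm hpq, if_false, tsub_zero, tsub_right_comm (a := n) (b := Finsupp.single p 1)]
  ring

theorem commute_ann_cre {p q : Mode d} (hpq : p ≠ q) : Commute (ann p) (cre q) := by
  classical
  refine LinearMap.ext fun v => Finsupp.ext fun n => ?_
  simp only [Module.End.mul_apply, cre_apply, ann_apply, Finsupp.tsub_apply, Finsupp.add_apply,
    Finsupp.single_apply, hpq, Ne.symm hpq, if_false, tsub_zero, add_zero]
  by_cases h : n q = 0
  · simp [h]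
  · have : n + Finsupp.single p 1 - Finsupp.single q 1
        = n - Finsupp.single q 1 + Finsupp.single p 1 := by
      rw [tsub_add_eq_add_tsub]; rw [Finsupp.single_le_iff]; omega
    rw [this]; ring

/-! ## The Hamiltonian as a sum of squares -/

/-- `α a*₀ a_q + β a*_{-q} a₀`. -/
def sqOp (α β : ℝ) (q : Mode d) : Op d :=
  (α : ℂ) • (cre 0 * ann q) + (β : ℂ) • (cre (-q) * ann 0)

/-- The adjoint of `sqOp`. -/
def sqOpAdj (α β : ℝ) (q : Mode d) : Op d :=
  (α : ℂ) • (cre q * ann 0) + (β : ℂ) • (cre 0 * ann (-q))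

theorem isAdj_sqOp (α β : ℝ) (q : Mode d) : IsAdj (sqOp α β q) (sqOpAdj α β q) :=
  (((isAdj_cre_ann 0).mul (isAdj_ann_cre q)).real_smul α).add
    (((isAdj_cre_ann (-q)).mul (isAdj_ann_cre 0)).real_smul β)

theorem ne_neg_of_ne_zero {q : Mode d} (hq : q ≠ 0) : q ≠ -q := by
  intro h
  apply hq
  funext i
  have := congrFun h i
  simp only [Pi.neg_apply, Pi.zero_apply] at this ⊢
  omega

/-- The cross terms are exactly the two pairing operators. Normal ordering of the remaining terms
produces the summands `+ 1`, which only matter at order `1/N` or in the constant energy. -/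
theorem sqOpAdj_mul_sqOp (α β : ℝ) {q : Mode d} (hq : q ≠ 0) :
    sqOpAdj α β q * sqOp α β q =
      diag (fun n => (α ^ 2 * (n q * (n 0 + 1)) + β ^ 2 * ((n (-q) + 1) * n 0) : ℂ)) +
      ((α * β : ℝ) : ℂ) • (ann 0 * ann 0 * cre q * cre (-q) + cre 0 * cre 0 * ann q * ann (-q)) := by
  have hq' : -q ≠ 0 := neg_ne_zero.2 hq
  have c1 := (commute_ann_cre hq.symm).eq
  have c2 := (commute_ann_cre hq'.symm).eq
  have c3 := (commute_ann_cre hq).eq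
  have c4 := (commute_ann_cre hq').eq
  have e1 : (cre q * ann 0) * (cre 0 * ann q) = diag (fun n : Occ d => (n q * (n 0 + 1) : ℂ)) := by
    have : (cre q * ann 0) * (cre 0 * ann q) = (cre q * ann q) * (ann 0 * cre 0) := by
      calc (cre q * ann 0) * (cre 0 * ann q) = cre q * (ann 0 * (cre 0 * ann q)) := by
            simp only [mul_assoc]
        _ = cre q * (ann 0 * (ann q * cre 0)) := by rw [c3]
        _ = cre q * ((ann 0 * ann q) * cre 0) := by simp only [mul_assoc]
        _ = cre q * ((ann q * ann 0) * cre 0) := by rw [(commute_ann_ann 0 q).eq]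
        _ = _ := by simp only [mul_assoc]
    rw [this, cre_mul_ann_self, ann_mul_cre_self, diag_mul]
  have e2 : (cre 0 * ann (-q)) * (cre (-q) * ann 0)
      = diag (fun n : Occ d => ((n (-q) + 1) * n 0 : ℂ)) := by
    have : (cre 0 * ann (-q)) * (cre (-q) * ann 0) = (ann (-q) * cre (-q)) * (cre 0 * ann 0) := by
      calc (cre 0 * ann (-q)) * (cre (-q) * ann 0) = (cre 0 * ann (-q)) * cre (-q) * ann 0 := by
            simp only [mul_assoc]
        _ = ann (-q) * (cre 0 * cre (-q)) * ann 0 := by rw [← c4]; simp only [mul_assoc]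
        _ = ann (-q) * (cre (-q) * cre 0) * ann 0 := by rw [(commute_cre_cre 0 (-q)).eq]
        _ = _ := by simp only [mul_assoc]
    rw [this, cre_mul_ann_self, ann_mul_cre_self, diag_mul]
  have e3 : (cre q * ann 0) * (cre (-q) * ann 0) = ann 0 * ann 0 * cre q * cre (-q) := by
    calc (cre q * ann 0) * (cre (-q) * ann 0) = (ann 0 * cre q) * (cre (-q) * ann 0) := by rw [c1]
      _ = (ann 0 * cre q) * (ann 0 * cre (-q)) := by rw [c2]
      _ = ann 0 * (cre q * ann 0) * cre (-q) := by simp only [mul_assoc]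
      _ = ann 0 * (ann 0 * cre q) * cre (-q) := by rw [c1]
      _ = _ := by simp only [mul_assoc]
  have e4 : (cre 0 * ann (-q)) * (cre 0 * ann q) = cre 0 * cre 0 * ann q * ann (-q) := by
    calc (cre 0 * ann (-q)) * (cre 0 * ann q) = cre 0 * (ann (-q) * cre 0) * ann q := by
          simp only [mul_assoc]
      _ = cre 0 * (cre 0 * ann (-q)) * ann q := by rw [c4]
      _ = cre 0 * cre 0 * (ann (-q) * ann q) := by simp only [mul_assoc]
      _ = cre 0 * cre 0 * (ann q * ann (-q)) := by rw [(commute_ann_ann (-q) q).eq]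
      _ = _ := by simp only [mul_assoc]
  rw [sqOpAdj, sqOp, add_mul, mul_add, mul_add]
  simp only [smul_mul_assoc, mul_smul_comm, smul_smul]
  rw [e1, e2, e3, e4, smul_diag, smul_diag]
  have : (diag fun n : Occ d => (α ^ 2 * (n q * (n 0 + 1)) + β ^ 2 * ((n (-q) + 1) * n 0) : ℂ))
     = diag (fun n => (α * α * (n q * (n 0 + 1)) : ℂ))
      + diag (fun n => (β * β * ((n (-q) + 1) * n 0) : ℂ)) := by
    rw [diag_add]; congr 1; funext n; ring
  rw [this, smul_add, Complex.ofReal_mul, mul_comm (β : ℂ) α]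
  abel

theorem H0_eq_diag (L : ℝ) (c : Mode d → ℝ) (N : ℕ) (q : Mode d) :
    H0 L c N q = diag (fun n =>
      (((kSq L q + c q / N * n 0) * (n q + n (-q)) : ℝ) : ℂ)) := by
  rw [H0, cre_mul_ann_self, cre_mul_ann_self, cre_mul_ann_self, one_eq_diag, smul_diag, smul_diag,
    diag_add, diag_mul, diag_mul, diag_add]
  congr 1; funext n; push_cast; ring

/-- Energy of the modes outside `±j 1, …, ±j m` in the state `|n⟩`. -/
def kinRest (L : ℝ) (j : ℕ → Mode d) (m : ℕ) (n : Occ d) : ℝ :=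
  open Classical in
  ∑ q ∈ n.support with ¬ ∃ l ∈ Finset.Icc 1 m, q = j l ∨ q = -j l, kSq L q * n q

theorem freeKin_eq_diag (L : ℝ) (j : ℕ → Mode d) (m : ℕ) :
    freeKin L j m = diag (fun n => (kinRest L j m n : ℂ)) := by
  classical
  apply ket_ext; intro n
  rw [diag_ket, kinRest, freeKin]
  simp only [ket, Finsupp.linearCombination_single, one_smul]
  rw [Complex.ofReal_sum, Finset.sum_smul]
  refine Finset.sum_congr (by congr) fun q _ => ?_
  have := diag_ket (fun n => (n q : ℂ)) n
  rw [← cre_mul_ann_self, ket] at this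
  rw [this, smul_smul]; push_cast; rfl

/-- The diagonal part left over when the Hamiltonian of the pair of modes `±q` is written as a
sum of squares. -/
def sqRest (k φ A B : ℝ) (N : ℕ) (q : Mode d) (n : Occ d) : ℝ :=
  k * (n q + n (-q)) + (φ - A - B) * n 0 * (n q + n (-q)) / N - A * (n q + n (-q)) / N
    - 2 * B * n 0 / N

/-- The squares for `q` and `-q` contribute `αβ` each to the pairing terms, whence the condition
`2αβ = φ_q`. The individual values of `α²` and `β²` remain free, and only the diagonal remainder
depends on that choice. -/
theorem HhatBog_eq (L : ℝ) (c : Mode d → ℝ) {N : ℕ} {q : Mode d} (hq : q ≠ 0)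
    {α β : ℝ} (h : 2 * (α * β) = c q) :
    HhatBog L c N q = ((1 / N : ℝ) : ℂ) • (sqOpAdj α β q * sqOp α β q) +
      ((1 / N : ℝ) : ℂ) • (sqOpAdj α β (-q) * sqOp α β (-q)) +
      diag (fun n => (sqRest (kSq L q) (c q) (α ^ 2) (β ^ 2) N q n : ℂ)) := by
  rw [sqOpAdj_mul_sqOp α β hq, sqOpAdj_mul_sqOp α β (neg_ne_zero.2 hq), neg_neg, HhatBog, H0_eq_diag,
    W, Wstar]
  have a1 : ann 0 * ann 0 * cre (-q) * cre q = ann 0 * ann 0 * cre q * cre (-q) := by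
    rw [mul_assoc, (commute_cre_cre (-q) q).eq, ← mul_assoc]
  have a2 : cre 0 * cre 0 * ann (-q) * ann q = cre 0 * cre 0 * ann q * ann (-q) := by
    rw [mul_assoc, (commute_ann_ann (-q) q).eq, ← mul_assoc]
  rw [a1, a2]
  set X := cre 0 * cre 0 * ann q * ann (-q)
  set Y := ann 0 * ann 0 * cre q * cre (-q)
  have hc : ((c q / N : ℝ) : ℂ) = ((1 / N : ℝ) : ℂ) * ((α * β : ℝ) : ℂ)
      + ((1 / N : ℝ) : ℂ) * ((α * β : ℝ) : ℂ) := by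
    rw [← h]; push_cast; ring
  have hd : (diag (fun n : Occ d =>
      (((kSq L q + c q / N * n 0) * (n q + n (-q)) : ℝ) : ℂ)))
      = ((1 / N : ℝ) : ℂ) • diag (fun n =>
          (α ^ 2 * (n q * (n 0 + 1)) + β ^ 2 * ((n (-q) + 1) * n 0) : ℂ))
      + ((1 / N : ℝ) : ℂ) • diag (fun n =>
          (α ^ 2 * (n (-q) * (n 0 + 1)) + β ^ 2 * ((n q + 1) * n 0) : ℂ))
      + diag (fun n => (sqRest (kSq L q) (c q) (α ^ 2) (β ^ 2) N q n : ℂ)) := by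
    rw [smul_diag, smul_diag, diag_add, diag_add]
    congr 1; funext n
    simp only [sqRest]; push_cast; ring
  rw [hd, hc]
  simp only [smul_add, add_smul, smul_smul]
  abel

theorem isAdj_W_Wstar (c : Mode d → ℝ) (N : ℕ) {q : Mode d} (hq : q ≠ 0) :
    IsAdj (W c N q) (Wstar c N q) := by
  rw [W, Wstar]
  have hq' : -q ≠ 0 := neg_ne_zero.2 hq
  have h := ((((isAdj_cre_ann (0 : Mode d)).mul (isAdj_cre_ann 0)).mul (isAdj_ann_cre q)).mul
    (isAdj_ann_cre (-q))).real_smul (c q / N)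
  have e : cre (-q) * (cre q * (ann (0 : Mode d) * ann 0)) = ann 0 * ann 0 * cre q * cre (-q) := by
    have h1 : Commute (cre (-q) * cre q) (ann (0 : Mode d) * ann 0) :=
      Commute.mul_left
        (Commute.mul_right (commute_ann_cre hq'.symm).symm (commute_ann_cre hq'.symm).symm)
        (Commute.mul_right (commute_ann_cre hq.symm).symm (commute_ann_cre hq.symm).symm)
    rw [← mul_assoc, h1.eq, (commute_cre_cre (-q) q).eq, ← mul_assoc]
  rwa [e] at h

theorem isAdj_HBog (L : ℝ) (c : Mode d → ℝ) (N : ℕ) (j : ℕ → Mode d) (m : ℕ)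
    (hj : ∀ l ∈ Finset.Icc 1 m, j l ≠ 0) : IsAdj (HBog L c N j m) (HBog L c N j m) := by
  rw [HBog, freeKin_eq_diag]
  refine (isAdj_diag _).add (IsAdj.sum fun l hl => ?_)
  have h := isAdj_W_Wstar c N (hj l hl)
  have h2 := ((isAdj_diag (fun n : Occ d => (kSq L (j l) + c (j l) / N * n 0)
    * (n (j l) + n (-j l)))).add h).add h.symm
  rw [← H0_eq_diag] at h2
  rw [HhatBog]
  convert h2 using 1
  abel

/-- The form of the Hamiltonian as a sum of squares and a diagonal part. -/
theorem form_HBog (L : ℝ) (c : Mode d → ℝ) (N : ℕ) (j : ℕ → Mode d) (m : ℕ)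
    (hj : ∀ l ∈ Finset.Icc 1 m, j l ≠ 0) (α β : ℕ → ℝ)
    (h : ∀ l ∈ Finset.Icc 1 m, 2 * (α l * β l) = c (j l)) (v : FinFock d) :
    (ip v (HBog L c N j m v)).re =
      ∑ l ∈ Finset.Icc 1 m, (1 / N : ℝ) * (‖toFock (sqOp (α l) (β l) (j l) v)‖ ^ 2
        + ‖toFock (sqOp (α l) (β l) (-j l) v)‖ ^ 2)
      + wsum (fun n => kinRest L j m n +
        ∑ l ∈ Finset.Icc 1 m, sqRest (kSq L (j l)) (c (j l)) (α l ^ 2) (β l ^ 2) N (j l) n) v := by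
  have key : ∀ l ∈ Finset.Icc 1 m, ip v (HhatBog L c N (j l) v) =
      (((1 / N : ℝ) * (‖toFock (sqOp (α l) (β l) (j l) v)‖ ^ 2
        + ‖toFock (sqOp (α l) (β l) (-j l) v)‖ ^ 2) +
       wsum (sqRest (kSq L (j l)) (c (j l)) (α l ^ 2) (β l ^ 2) N (j l)) v : ℝ) : ℂ) := by
    intro l hl
    rw [HhatBog_eq L c (hj l hl) (h l hl)]
    simp only [LinearMap.add_apply, LinearMap.smul_apply, ip_add_right, ip_smul_right,
      (isAdj_sqOp _ _ _).norm_sq, ip_diag]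
    push_cast; ring
  rw [HBog, freeKin_eq_diag, LinearMap.add_apply, ip_add_right, ip_diag, wsum_add, wsum_sum,
    LinearMap.sum_apply]
  have : ip v (∑ l ∈ Finset.Icc 1 m, HhatBog L c N (j l) v)
      = ∑ l ∈ Finset.Icc 1 m, ip v (HhatBog L c N (j l) v) := by
    simp only [ip, map_sum, inner_sum]
  rw [this, Finset.sum_congr rfl key, ← Complex.ofReal_sum, ← Complex.ofReal_add, Complex.ofReal_re,
    Finset.sum_add_distrib]
  ring

end Bogoliubov

end

noncomputable section

namespace Bogoliubov

variable {d : ℕ}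

/-! ## Lower bounds -/

/-- The hypotheses on the potential which concern the pairs of modes `±j 1, …, ±j m`. -/
structure Admissible (L : ℝ) (c : Mode d → ℝ) (j : ℕ → Mode d) (m : ℕ) : Prop where
  L_pos : 0 < L
  ne_zero : ∀ l ∈ Finset.Icc 1 m, j l ≠ 0
  inj : ∀ l ∈ Finset.Icc 1 m, ∀ l' ∈ Finset.Icc 1 m, j l = j l' ∨ j l = -j l' → l = l'
  pos : ∀ l ∈ Finset.Icc 1 m, 0 < c (j l)

theorem Admissible.mono {L : ℝ} {c : Mode d → ℝ} {j : ℕ → Mode d} {m m' : ℕ}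
    (h : Admissible L c j m) (hm : m' ≤ m) : Admissible L c j m' where
  L_pos := h.L_pos
  ne_zero l hl := h.ne_zero l (Finset.Icc_subset_Icc_right hm hl)
  inj l hl l' hl' := h.inj l (Finset.Icc_subset_Icc_right hm hl) l'
    (Finset.Icc_subset_Icc_right hm hl')
  pos l hl := h.pos l (Finset.Icc_subset_Icc_right hm hl)

/-- Kinetic energy of the lowest nonzero modes. -/
def kMin (L : ℝ) : ℝ := (2 * Real.pi / L) ^ 2

theorem kMin_pos {L : ℝ} (hL : 0 < L) : 0 < kMin L := by
  unfold kMin; positivity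

theorem kMin_le_kSq (L : ℝ) {q : Mode d} (hq : q ≠ 0) : kMin L ≤ kSq L q := by
  obtain ⟨i, hi⟩ : ∃ i, q i ≠ 0 := by
    by_contra! h
    exact hq (funext h)
  have h1 : (2 * Real.pi / L * (q i : ℝ)) ^ 2 ≤ kSq L q :=
    Finset.single_le_sum (f := fun i => (2 * Real.pi / L * (q i : ℝ)) ^ 2)
      (fun i _ => sq_nonneg _) (Finset.mem_univ i)
  have h2 : (1 : ℝ) ≤ (q i : ℝ) ^ 2 := by
    have : (1 : ℤ) ≤ (q i) ^ 2 := by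
      have := pow_pos (abs_pos.2 hi) 2
      rw [sq_abs] at this
      omega
    exact_mod_cast this
  refine le_trans ?_ h1
  rw [mul_pow, kMin]
  exact le_mul_of_one_le_right (sq_nonneg _) h2

theorem Admissible.kSq_pos {L : ℝ} {c : Mode d → ℝ} {j : ℕ → Mode d} {m : ℕ}
    (h : Admissible L c j m) {l : ℕ} (hl : l ∈ Finset.Icc 1 m) : 0 < kSq L (j l) :=
  (kMin_pos h.L_pos).trans_le (kMin_le_kSq L (h.ne_zero l hl))

/-- The modes `±j 1, …, ±j m`. -/
def pairModes (j : ℕ → Mode d) (m : ℕ) : Finset (Mode d) :=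
  (Finset.Icc 1 m).biUnion fun l => {j l, -j l}

theorem mem_pairModes {j : ℕ → Mode d} {m : ℕ} {q : Mode d} :
    q ∈ pairModes j m ↔ ∃ l ∈ Finset.Icc 1 m, q = j l ∨ q = -j l := by
  simp [pairModes]

theorem Admissible.zero_notMem {L : ℝ} {c : Mode d → ℝ} {j : ℕ → Mode d} {m : ℕ}
    (h : Admissible L c j m) : (0 : Mode d) ∉ pairModes j m := by
  rw [mem_pairModes]
  rintro ⟨l, hl, h0 | h0⟩
  · exact h.ne_zero l hl h0.symm
  · exact h.ne_zero l hl (by simpa using h0.symm)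

theorem Admissible.sum_pairModes {L : ℝ} {c : Mode d → ℝ} {j : ℕ → Mode d} {m : ℕ}
    (h : Admissible L c j m) {R : Type*} [AddCommMonoid R] (f : Mode d → R) :
    ∑ q ∈ pairModes j m, f q = ∑ l ∈ Finset.Icc 1 m, (f (j l) + f (-j l)) := by
  rw [pairModes, Finset.sum_biUnion]
  · refine Finset.sum_congr rfl fun l hl => ?_
    rw [Finset.sum_pair (ne_neg_of_ne_zero (h.ne_zero l hl))]
  · intro l hl l' hl' hne
    rw [Function.onFun, Finset.disjoint_left]
    intro q hq hq'
    apply hne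
    simp only [Finset.mem_insert, Finset.mem_singleton] at hq hq'
    apply h.inj l hl l' hl'
    rcases hq with rfl | rfl <;> rcases hq' with h1 | h1
    · exact Or.inl h1
    · exact Or.inr h1
    · right; rw [← h1, neg_neg]
    · left; exact neg_injective h1

/-- Number of particles in the modes `±q`. -/
def pairNum (q : Mode d) (n : Occ d) : ℝ := n q + n (-q)

/-- Number of particles outside the zero mode. -/
def exc (n : Occ d) : ℝ := n.degree - n 0

/-- Number of particles outside the modes `0, ±j 1, …, ±j m`. -/
def restNum (j : ℕ → Mode d) (m : ℕ) (n : Occ d) : ℝ :=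
  n.degree - n 0 - ∑ l ∈ Finset.Icc 1 m, pairNum (j l) n

theorem degree_eq_sum_support (n : Occ d) : n.degree = ∑ q ∈ n.support, n q := rfl

theorem Admissible.restNum_eq {L : ℝ} {c : Mode d → ℝ} {j : ℕ → Mode d} {m : ℕ}
    (h : Admissible L c j m) (n : Occ d) :
    restNum j m n = ∑ q ∈ n.support \ insert 0 (pairModes j m), (n q : ℝ) := by
  classical
  have h1 : ∑ q ∈ insert 0 (pairModes j m), (n q : ℝ) =
      n 0 + ∑ l ∈ Finset.Icc 1 m, pairNum (j l) n := by
    rw [Finset.sum_insert h.zero_notMem, h.sum_pairModes]; rfl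
  have h2 : (n.degree : ℝ) = ∑ q ∈ n.support ∪ insert 0 (pairModes j m), (n q : ℝ) := by
    rw [degree_eq_sum_support, Nat.cast_sum]
    apply Finset.sum_subset Finset.subset_union_left
    intro q _ hq
    simp [Finsupp.notMem_support_iff.1 hq]
  rw [restNum, sub_sub, ← h1, h2, ← Finset.sum_sdiff_eq_sub Finset.subset_union_right,
    Finset.union_sdiff_right]

theorem Admissible.restNum_nonneg {L : ℝ} {c : Mode d → ℝ} {j : ℕ → Mode d} {m : ℕ}
    (h : Admissible L c j m) (n : Occ d) : 0 ≤ restNum j m n := by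
  rw [h.restNum_eq]; positivity

/-- This is the spectral gap towards states with particles outside the selected modes; the zero mode
costs no energy and is not counted by `restNum`. -/
theorem Admissible.kinRest_ge {L : ℝ} {c : Mode d → ℝ} {j : ℕ → Mode d} {m : ℕ}
    (h : Admissible L c j m) (n : Occ d) : kMin L * restNum j m n ≤ kinRest L j m n := by
  classical
  rw [h.restNum_eq, kinRest, Finset.mul_sum]
  refine (Finset.sum_le_sum (g := fun q => kSq L q * n q) ?_).trans
    (Finset.sum_le_sum_of_subset_of_nonneg ?_ ?_)
  · intro q hq
    refine mul_le_mul_of_nonneg_right (kMin_le_kSq L ?_) (by positivity)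
    rintro rfl
    simp at hq
  · intro q hq
    simp only [Finset.mem_sdiff, Finset.mem_insert, not_or, Finset.mem_filter] at hq ⊢
    exact ⟨hq.1, fun h' => hq.2.2 (mem_pairModes.2 h')⟩
  · intro q _ _
    have : 0 ≤ kSq L q := Finset.sum_nonneg fun i _ => sq_nonneg _
    positivity

/-- The larger root of `X² - (φ + x) X + φ²/4`. -/
def rootA (φ x : ℝ) : ℝ := (φ + x + Real.sqrt (x ^ 2 + 2 * φ * x)) / 2

/-- The smaller root of `X² - (φ + x) X + φ²/4`. -/
def rootB (φ x : ℝ) : ℝ := (φ + x - Real.sqrt (x ^ 2 + 2 * φ * x)) / 2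

theorem rootA_add_rootB (φ x : ℝ) : rootA φ x + rootB φ x = φ + x := by
  unfold rootA rootB; ring

theorem rootA_mul_rootB {φ x : ℝ} (hφ : 0 < φ) (hx : 0 < x) :
    rootA φ x * rootB φ x = φ ^ 2 / 4 := by
  have := Real.sq_sqrt (show 0 ≤ x ^ 2 + 2 * φ * x by positivity)
  unfold rootA rootB; linear_combination (-1 / 4 : ℝ) * this

theorem rootA_pos {φ x : ℝ} (hφ : 0 < φ) (hx : 0 < x) : 0 < rootA φ x := by
  unfold rootA; positivity

theorem rootB_pos {φ x : ℝ} (hφ : 0 < φ) (hx : 0 < x) : 0 < rootB φ x := by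
  have h := rootA_mul_rootB hφ hx
  have h1 : 0 < rootA φ x * rootB φ x := by rw [h]; positivity
  exact (pos_iff_pos_of_mul_pos h1).1 (rootA_pos hφ hx)

theorem rootB_lt_rootA {φ x : ℝ} (hφ : 0 < φ) (hx : 0 < x) : rootB φ x < rootA φ x := by
  have : 0 < Real.sqrt (x ^ 2 + 2 * φ * x) := Real.sqrt_pos.2 (by positivity)
  unfold rootA rootB; linarith

/-- The product of the roots is chosen so that their square roots are admissible `α, β` in
`HhatBog_eq`, for every value of the parameter `x`. -/
theorem two_mul_sqrt_roots {φ x : ℝ} (hφ : 0 < φ) (hx : 0 < x) :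
    2 * (Real.sqrt (rootA φ x) * Real.sqrt (rootB φ x)) = φ := by
  rw [← Real.sqrt_mul (rootA_pos hφ hx).le, rootA_mul_rootB hφ hx,
    show φ ^ 2 / 4 = (φ / 2) ^ 2 by ring, Real.sqrt_sq (by positivity)]
  ring

theorem EBog_eq (L : ℝ) (c : Mode d → ℝ) (q : Mode d) :
    EBog L c q = -(2 * rootB (c q) (kSq L q)) := by
  unfold EBog rootB; ring

/-- Sum of the energies `E^{Bog}` of the first `m` pairs of modes. -/
def eBogSum (L : ℝ) (c : Mode d → ℝ) (j : ℕ → Mode d) (m : ℕ) : ℝ :=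
  ∑ l ∈ Finset.Icc 1 m, EBog L c (j l)

/-- With root sum `φ + k` the coefficient of `n₀ x / N` is `-k`, which cancels the kinetic energy `k
x` when `n₀ + x = N`. The term `-A x / N` is absorbed by completing a square in `x`, at the price
`A² / (4kN)`. -/
theorem sqRest_ge {k φ : ℝ} (hk : 0 < k) (hφ : 0 < φ) {N : ℕ} (hN : 0 < N) (q : Mode d)
    {n : Occ d} (hn : n 0 + pairNum q n ≤ N) :
    -(2 * rootB φ k) - rootA φ k ^ 2 / (4 * k) / N ≤
      sqRest k φ (rootA φ k) (rootB φ k) N q n := by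
  have hN' : (0 : ℝ) < N := by exact_mod_cast hN
  have hA := rootA_pos hφ hk
  have hB := rootB_pos hφ hk
  have hs := rootA_add_rootB φ k
  set A := rootA φ k
  set B := rootB φ k
  unfold pairNum at hn
  have h0 : (0 : ℝ) ≤ n 0 := by positivity
  have hx0 : (0 : ℝ) ≤ (n q : ℝ) + n (-q) := by positivity
  unfold sqRest
  set x : ℝ := (n q : ℝ) + n (-q)
  have e1 : φ - A - B = -k := by linarith
  rw [e1]
  have key : k * x + -k * n 0 * x / N - A * x / N - 2 * B * n 0 / N
      - (-(2 * B) - A ^ 2 / (4 * k) / N)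
      = (k * x * (N - n 0 - x) + 2 * B * (N - n 0) + k * (x - A / (2 * k)) ^ 2) / N := by
    field_simp; ring
  have : 0 ≤ (k * x * (N - n 0 - x) + 2 * B * (N - n 0) + k * (x - A / (2 * k)) ^ 2) / N := by
    have a1 : 0 ≤ N - n 0 - x := by linarith
    have a2 : (0 : ℝ) ≤ N - n 0 := by linarith
    positivity
  linarith

/-- Using the roots at `k/2` weakens the constant but keeps part of the kinetic energy: `k/2`
survives in any case, and the assumption on `N` lets `k/4` of it absorb `A x / N`. -/
theorem sqRest_ge_number {k φ : ℝ} (hk : 0 < k) (hφ : 0 < φ) {N : ℕ} (hN : 0 < N)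
    (hN2 : 4 * rootA φ (k / 2) / k ≤ N) (q : Mode d)
    {n : Occ d} (hn : n 0 + pairNum q n ≤ N) :
    k / 4 * pairNum q n - 2 * rootB φ (k / 2) ≤
      sqRest k φ (rootA φ (k / 2)) (rootB φ (k / 2)) N q n := by
  have hN' : (0 : ℝ) < N := by exact_mod_cast hN
  have hk2 : 0 < k / 2 := by positivity
  have hA := rootA_pos hφ hk2
  have hB := rootB_pos hφ hk2
  have hs := rootA_add_rootB φ (k / 2)
  set A := rootA φ (k / 2)
  set B := rootB φ (k / 2)
  unfold pairNum at hn ⊢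
  have h0 : (0 : ℝ) ≤ n 0 := by positivity
  have hx0 : (0 : ℝ) ≤ (n q : ℝ) + n (-q) := by positivity
  unfold sqRest
  set x : ℝ := (n q : ℝ) + n (-q)
  have e1 : φ - A - B = -(k / 2) := by linarith
  rw [e1]
  have key : k * x + -(k / 2) * n 0 * x / N - A * x / N - 2 * B * n 0 / N
      - (k / 4 * x - 2 * B)
      = (k / 2 * x * (N - n 0) + 2 * B * (N - n 0) + x * (k / 4 * N - A)) / N := by
    field_simp; ring
  have : 0 ≤ (k / 2 * x * (N - n 0) + 2 * B * (N - n 0) + x * (k / 4 * N - A)) / N := by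
    have a2 : (0 : ℝ) ≤ N - n 0 := by linarith
    have a3 : (0 : ℝ) ≤ k / 4 * N - A := by
      rw [div_le_iff₀ hk] at hN2; linarith
    positivity
  linarith

theorem Admissible.zero_add_pairNum_le {L : ℝ} {c : Mode d → ℝ} {j : ℕ → Mode d} {m : ℕ}
    (h : Admissible L c j m) {l : ℕ} (hl : l ∈ Finset.Icc 1 m) (n : Occ d) :
    n 0 + pairNum (j l) n ≤ n.degree := by
  have h1 := h.restNum_nonneg n
  have h2 : pairNum (j l) n ≤ ∑ l ∈ Finset.Icc 1 m, pairNum (j l) n :=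
    Finset.single_le_sum (f := fun l => pairNum (j l) n)
      (fun i _ => by unfold pairNum; positivity) hl
  unfold restNum at h1
  linarith

theorem mem_nParticle {N : ℕ} {v : FinFock d} :
    v ∈ nParticle d N ↔ ∀ n, v n ≠ 0 → n.degree = N := by
  rw [nParticle, Finsupp.mem_supported]
  simp [Set.subset_def]

/-- `√A`, `√B` for the pair of modes `±q`. -/
def bogA (L : ℝ) (c : Mode d → ℝ) (q : Mode d) : ℝ := Real.sqrt (rootA (c q) (kSq L q))

/-- See `bogA`. -/
def bogB (L : ℝ) (c : Mode d → ℝ) (q : Mode d) : ℝ := Real.sqrt (rootB (c q) (kSq L q))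

/-- The lower bound which is sharp for `N → ∞`. -/
theorem Admissible.form_ge {L : ℝ} {c : Mode d → ℝ} {j : ℕ → Mode d} {m : ℕ}
    (h : Admissible L c j m) : ∃ C : ℝ, ∀ N : ℕ, 0 < N → ∀ v ∈ nParticle d N,
      ∑ l ∈ Finset.Icc 1 m, (1 / N : ℝ) * (‖toFock (sqOp (bogA L c (j l)) (bogB L c (j l)) (j l) v)‖ ^ 2
        + ‖toFock (sqOp (bogA L c (j l)) (bogB L c (j l)) (-j l) v)‖ ^ 2)
      + kMin L * wsum (restNum j m) v + (eBogSum L c j m - C / N) * ‖toFock v‖ ^ 2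
      ≤ (ip v (HBog L c N j m v)).re := by
  refine ⟨∑ l ∈ Finset.Icc 1 m, rootA (c (j l)) (kSq L (j l)) ^ 2 / (4 * kSq L (j l)), ?_⟩
  intro N hN v hv
  rw [form_HBog L c N j m h.ne_zero (fun l => bogA L c (j l)) (fun l => bogB L c (j l))
    (fun l hl => two_mul_sqrt_roots (h.pos l hl) (h.kSq_pos hl)), ← wsum_const, ← wsum_const_mul,
    add_assoc, ← wsum_add]
  refine add_le_add_right (wsum_mono fun n hn => ?_) _
  have hd : n.degree = N := mem_nParticle.1 hv n hn
  refine add_le_add (h.kinRest_ge n) ?_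
  rw [eBogSum, Finset.sum_div, ← Finset.sum_sub_distrib]
  refine Finset.sum_le_sum fun l hl => ?_
  have hk := h.kSq_pos hl
  have hφ := h.pos l hl
  rw [EBog_eq, bogA, bogB, Real.sq_sqrt (rootA_pos hφ hk).le, Real.sq_sqrt (rootB_pos hφ hk).le]
  refine sqRest_ge hk hφ hN _ ?_
  rw [← hd]
  exact h.zero_add_pairNum_le hl n

/-- The lower bound which controls the number of excitations. -/
theorem Admissible.form_ge_exc {L : ℝ} {c : Mode d → ℝ} {j : ℕ → Mode d} {m : ℕ}
    (h : Admissible L c j m) : ∃ C : ℝ, ∀ᶠ N : ℕ in Filter.atTop, ∀ v ∈ nParticle d N,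
      kMin L / 4 * wsum exc v - C * ‖toFock v‖ ^ 2 ≤ (ip v (HBog L c N j m v)).re := by
  refine ⟨∑ l ∈ Finset.Icc 1 m, 2 * rootB (c (j l)) (kSq L (j l) / 2), ?_⟩
  have hev : ∀ᶠ N : ℕ in Filter.atTop, ∀ l ∈ Finset.Icc 1 m,
      4 * rootA (c (j l)) (kSq L (j l) / 2) / kSq L (j l) ≤ N := by
    rw [Filter.eventually_all_finset]
    intro l _
    exact tendsto_natCast_atTop_atTop.eventually_ge_atTop _
  filter_upwards [hev, Filter.eventually_gt_atTop 0] with N hN2 hN v hv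
  rw [form_HBog L c N j m h.ne_zero
    (fun l => Real.sqrt (rootA (c (j l)) (kSq L (j l) / 2)))
    (fun l => Real.sqrt (rootB (c (j l)) (kSq L (j l) / 2)))
    (fun l hl => two_mul_sqrt_roots (h.pos l hl) (half_pos (h.kSq_pos hl)))]
  have h0 : (0 : ℝ) ≤ ∑ l ∈ Finset.Icc 1 m, (1 / N : ℝ) *
      (‖toFock (sqOp √(rootA (c (j l)) (kSq L (j l) / 2)) √(rootB (c (j l)) (kSq L (j l) / 2))
          (j l) v)‖ ^ 2 +
        ‖toFock (sqOp √(rootA (c (j l)) (kSq L (j l) / 2)) √(rootB (c (j l)) (kSq L (j l) / 2))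
          (-j l) v)‖ ^ 2) := by
    positivity
  refine le_trans ?_ (le_add_of_nonneg_left h0)
  rw [sub_eq_add_neg, ← neg_mul, ← wsum_const, ← wsum_const_mul, ← wsum_add]
  refine wsum_mono fun n hn => ?_
  have hd : n.degree = N := mem_nParticle.1 hv n hn
  have e : exc n = restNum j m n + ∑ l ∈ Finset.Icc 1 m, pairNum (j l) n := by
    unfold exc restNum; ring
  have a1 := h.kinRest_ge n
  have a2 := h.restNum_nonneg n
  have a3 := kMin_pos h.L_pos
  have a4 : ∑ l ∈ Finset.Icc 1 m, (kMin L / 4 * pairNum (j l) n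
        - 2 * rootB (c (j l)) (kSq L (j l) / 2)) ≤
      ∑ l ∈ Finset.Icc 1 m, sqRest (kSq L (j l)) (c (j l))
        (√(rootA (c (j l)) (kSq L (j l) / 2)) ^ 2)
        (√(rootB (c (j l)) (kSq L (j l) / 2)) ^ 2) N (j l) n := by
    refine Finset.sum_le_sum fun l hl => ?_
    have hk := h.kSq_pos hl
    have hφ := h.pos l hl
    rw [Real.sq_sqrt (rootA_pos hφ (half_pos hk)).le, Real.sq_sqrt (rootB_pos hφ (half_pos hk)).le]
    refine le_trans ?_ (sqRest_ge_number hk hφ hN (hN2 l hl) (j l) (n := n) ?_)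
    · have : 0 ≤ pairNum (j l) n := by unfold pairNum; positivity
      have := kMin_le_kSq L (h.ne_zero l hl)
      gcongr
    · rw [← hd]
      exact h.zero_add_pairNum_le hl n
  rw [Finset.sum_sub_distrib, ← Finset.mul_sum] at a4
  rw [e]
  nlinarith

end Bogoliubov

end

noncomputable section

namespace Bogoliubov

open Filter Topology

variable {d : ℕ}

/-! ## Configurations of excitations -/

/-- The `N`-particle occupation numbers with excitations `μ`. -/
def fillZero (N : ℕ) (μ : Occ d) : Occ d := μ + Finsupp.single 0 (N - μ.degree)

theorem degree_single (q : Mode d) (k : ℕ) : (Finsupp.single q k : Occ d).degree = k := by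
  simp

theorem degree_fillZero {N : ℕ} {μ : Occ d} (h : μ.degree ≤ N) : (fillZero N μ).degree = N := by
  rw [fillZero, map_add, degree_single]; omega

theorem fillZero_apply_ne (N : ℕ) (μ : Occ d) {q : Mode d} (hq : q ≠ 0) :
    fillZero N μ q = μ q := by
  simp [fillZero, hq.symm]

theorem fillZero_apply_zero (N : ℕ) {μ : Occ d} (h : μ 0 = 0) :
    fillZero N μ 0 = N - μ.degree := by
  simp [fillZero, h]

theorem fillZero_injective {N : ℕ} {μ ν : Occ d} (hμ : μ 0 = 0) (hν : ν 0 = 0)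
    (h : fillZero N μ = fillZero N ν) : μ = ν := by
  ext q
  by_cases hq : q = 0
  · rw [hq, hμ, hν]
  · rw [← fillZero_apply_ne N μ hq, h, fillZero_apply_ne N ν hq]

theorem fillZero_sub_add {N : ℕ} {μ : Occ d} {q : Mode d} (hq : q ≠ 0) (hμ : μ 0 = 0)
    (_ : μ.degree < N) :
    fillZero N μ - Finsupp.single 0 1 + Finsupp.single q 1 =
      fillZero N (μ + Finsupp.single q 1) := by
  classical
  have e : (μ + Finsupp.single q 1).degree = μ.degree + 1 := by rw [map_add, degree_single]
  ext p
  simp only [fillZero, Finsupp.add_apply, Finsupp.tsub_apply, Finsupp.single_apply, e]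
  by_cases hp : (0 : Mode d) = p
  · subst hp; simp [hμ, hq]; omega
  · simp [hp]

theorem fillZero_sub_add' {N : ℕ} {μ : Occ d} {q : Mode d} (hq : q ≠ 0) (hμ : μ 0 = 0)
    (_ : μ.degree ≤ N) (hμq : 0 < μ q) :
    fillZero N μ - Finsupp.single q 1 + Finsupp.single 0 1 =
      fillZero N (μ - Finsupp.single q 1) := by
  classical
  have e : (μ - Finsupp.single q 1).degree + 1 = μ.degree := by
    conv_rhs => rw [← tsub_add_cancel_of_le (show Finsupp.single q 1 ≤ μ by
      rw [Finsupp.single_le_iff]; exact hμq), map_add, degree_single]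
  ext p
  simp only [fillZero, Finsupp.add_apply, Finsupp.tsub_apply, Finsupp.single_apply]
  by_cases hp : (0 : Mode d) = p
  · subst hp; simp [hμ, hq]; omega
  · simp [hp]

/-- Configurations of at most `K` excitations in the modes `±j 1, …, ±j m`. -/
def configs (j : ℕ → Mode d) (m K : ℕ) : Finset (Occ d) :=
  (Finset.range (K + 1)).biUnion fun k => Finset.finsuppAntidiag (pairModes j m) k

theorem degree_eq_sum {μ : Occ d} {s : Finset (Mode d)} (h : μ.support ⊆ s) :
    μ.degree = ∑ q ∈ s, μ q := by
  rw [degree_eq_sum_support]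
  exact Finset.sum_subset h fun q _ hq => Finsupp.notMem_support_iff.1 hq

theorem mem_configs {j : ℕ → Mode d} {m K : ℕ} {μ : Occ d} :
    μ ∈ configs j m K ↔ μ.support ⊆ pairModes j m ∧ μ.degree ≤ K := by
  simp only [configs, Finset.mem_biUnion, Finset.mem_range, Finset.mem_finsuppAntidiag]
  constructor
  · rintro ⟨k, hk, h1, h2⟩
    refine ⟨h2, ?_⟩
    rw [degree_eq_sum h2, h1]; omega
  · rintro ⟨h1, h2⟩
    exact ⟨μ.degree, by omega, (degree_eq_sum h1).symm, h1⟩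

variable {L : ℝ} {c : Mode d → ℝ} {j : ℕ → Mode d} {m : ℕ}

theorem Admissible.apply_zero (h : Admissible L c j m) {μ : Occ d}
    (hμ : μ.support ⊆ pairModes j m) : μ 0 = 0 :=
  Finsupp.notMem_support_iff.1 fun h' => h.zero_notMem (hμ h')

theorem Admissible.bogA_pos (h : Admissible L c j m) {l : ℕ} (hl : l ∈ Finset.Icc 1 m) :
    0 < bogA L c (j l) := Real.sqrt_pos.2 (rootA_pos (h.pos l hl) (h.kSq_pos hl))

theorem Admissible.bogB_pos (h : Admissible L c j m) {l : ℕ} (hl : l ∈ Finset.Icc 1 m) :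
    0 < bogB L c (j l) := Real.sqrt_pos.2 (rootB_pos (h.pos l hl) (h.kSq_pos hl))

theorem Admissible.bogB_lt_bogA (h : Admissible L c j m) {l : ℕ} (hl : l ∈ Finset.Icc 1 m) :
    bogB L c (j l) < bogA L c (j l) :=
  Real.sqrt_lt_sqrt (rootB_pos (h.pos l hl) (h.kSq_pos hl)).le
    (rootB_lt_rootA (h.pos l hl) (h.kSq_pos hl))

/-- Ratio of the amplitudes of successive numbers of pairs in the Bogoliubov ground state. -/
def bogT (L : ℝ) (c : Mode d → ℝ) (q : Mode d) : ℝ := bogB L c q / bogA L c q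

theorem Admissible.bogT_pos (h : Admissible L c j m) {l : ℕ} (hl : l ∈ Finset.Icc 1 m) :
    0 < bogT L c (j l) := div_pos (h.bogB_pos hl) (h.bogA_pos hl)

theorem Admissible.bogT_lt_one (h : Admissible L c j m) {l : ℕ} (hl : l ∈ Finset.Icc 1 m) :
    bogT L c (j l) < 1 := (div_lt_one (h.bogA_pos hl)).2 (h.bogB_lt_bogA hl)

/-- Amplitudes of the Bogoliubov ground state in the limit `N → ∞`. -/
def amplitude (L : ℝ) (c : Mode d → ℝ) (j : ℕ → Mode d) (m : ℕ) (μ : Occ d) : ℝ :=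
  open Classical in
  if ∀ l ∈ Finset.Icc 1 m, μ (j l) = μ (-j l) then
    ∏ l ∈ Finset.Icc 1 m, (-bogT L c (j l)) ^ μ (j l) else 0

theorem amplitude_zero : amplitude L c j m 0 = 1 := by simp [amplitude]

theorem Admissible.pair_apply (h : Admissible L c j m) {l l' : ℕ} (hl : l ∈ Finset.Icc 1 m)
    (hl' : l' ∈ Finset.Icc 1 m) (hne : l' ≠ l) :
    j l ≠ j l' ∧ j l ≠ -j l' ∧ -j l ≠ j l' ∧ -j l ≠ -j l' := by
  refine ⟨?_, ?_, ?_, ?_⟩ <;> intro h' <;> apply hne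
  · exact (h.inj l hl l' hl' (Or.inl h')).symm
  · exact (h.inj l hl l' hl' (Or.inr h')).symm
  · exact (h.inj l hl l' hl' (Or.inr (by rw [← h', neg_neg]))).symm
  · exact (h.inj l hl l' hl' (Or.inl (neg_injective h'))).symm

/-- Removing a pair `±j l` preserves balance in every pair of modes and changes only one exponent of
the product. -/
theorem Admissible.amplitude_sub_pair (h : Admissible L c j m) {l : ℕ} (hl : l ∈ Finset.Icc 1 m)
    {μ : Occ d} (h1 : 0 < μ (j l)) (h2 : 0 < μ (-j l)) :
    amplitude L c j m μ = -bogT L c (j l) * amplitude L c j m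
      (μ - Finsupp.single (j l) 1 - Finsupp.single (-j l) 1) := by
  classical
  have hne := ne_neg_of_ne_zero (h.ne_zero l hl)
  have ha : ∀ l' ∈ Finset.Icc 1 m, l' ≠ l →
      (μ - Finsupp.single (j l) 1 - Finsupp.single (-j l) 1 : Occ d) (j l') = μ (j l') ∧
      (μ - Finsupp.single (j l) 1 - Finsupp.single (-j l) 1 : Occ d) (-j l') = μ (-j l') := by
    intro l' hl' hll
    obtain ⟨a1, a2, a3, a4⟩ := h.pair_apply hl hl' hll
    simp only [Finsupp.tsub_apply, Finsupp.single_apply, a1, a2, a3, a4, if_false, tsub_zero,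
      and_self]
  have hb : (μ - Finsupp.single (j l) 1 - Finsupp.single (-j l) 1 : Occ d) (j l) = μ (j l) - 1 ∧
      (μ - Finsupp.single (j l) 1 - Finsupp.single (-j l) 1 : Occ d) (-j l) = μ (-j l) - 1 := by
    simp [Finsupp.tsub_apply, hne.symm, hne]
  set ν := μ - Finsupp.single (j l) 1 - Finsupp.single (-j l) 1
  have hiff : (∀ l ∈ Finset.Icc 1 m, μ (j l) = μ (-j l)) ↔
      (∀ l ∈ Finset.Icc 1 m, ν (j l) = ν (-j l)) := by
    refine forall₂_congr fun l' hl' => ?_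
    by_cases hll : l' = l
    · subst hll; rw [hb.1, hb.2]; omega
    · rw [(ha l' hl' hll).1, (ha l' hl' hll).2]
  unfold amplitude
  by_cases hbal : ∀ l ∈ Finset.Icc 1 m, ν (j l) = ν (-j l)
  · rw [if_pos (hiff.2 hbal), if_pos hbal, ← Finset.mul_prod_erase _ _ hl,
      ← Finset.mul_prod_erase (Finset.Icc 1 m) (fun l => (-bogT L c (j l)) ^ ν (j l)) hl,
      ← mul_assoc, hb.1, ← pow_succ', Nat.sub_add_cancel h1]
    congr 1
    refine Finset.prod_congr rfl fun l' hl' => ?_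
    rw [(ha l' (Finset.mem_of_mem_erase hl') (Finset.ne_of_mem_erase hl')).1]
  · rw [if_neg (fun h' => hbal (hiff.1 h')), if_neg hbal, mul_zero]

/-- The recursion which characterizes the amplitudes. -/
theorem Admissible.amplitude_rec (h : Admissible L c j m) {l : ℕ} (hl : l ∈ Finset.Icc 1 m)
    {q : Mode d} (hq : q = j l ∨ q = -j l) {μ : Occ d} (hμ : 0 < μ q) :
    bogA L c (j l) * Real.sqrt (μ q) * amplitude L c j m μ + bogB L c (j l) * Real.sqrt (μ (-q)) *
      amplitude L c j m (μ - Finsupp.single q 1 - Finsupp.single (-q) 1) = 0 := by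
  classical
  by_cases hμ' : μ (-q) = 0
  -- The configuration is unbalanced, so its amplitude is zero, while the other term carries the
  -- factor `√0`.
  · have : amplitude L c j m μ = 0 := by
      rw [amplitude, if_neg]
      intro h'
      have := h' l hl
      rcases hq with rfl | rfl
      · omega
      · rw [neg_neg] at hμ'; omega
    simp [hμ', this]
  · have hA := (h.bogA_pos hl).ne'
    have hstep : amplitude L c j m μ = -bogT L c (j l) * amplitude L c j m
        (μ - Finsupp.single q 1 - Finsupp.single (-q) 1) := by
      rcases hq with rfl | rfl
      · exact h.amplitude_sub_pair hl hμ (by omega)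
      · rw [neg_neg] at hμ' ⊢
        rw [tsub_right_comm]
        exact h.amplitude_sub_pair hl (by omega) hμ
    by_cases h0 : amplitude L c j m μ = 0
    · have h1 : amplitude L c j m (μ - Finsupp.single q 1 - Finsupp.single (-q) 1) = 0 := by
        rw [h0] at hstep
        exact (mul_eq_zero.1 hstep.symm).resolve_left (neg_ne_zero.2 (h.bogT_pos hl).ne')
      rw [h0, h1]; simp
    · have hbal : μ q = μ (-q) := by
        have : ∀ l ∈ Finset.Icc 1 m, μ (j l) = μ (-j l) := by
          by_contra hc
          exact h0 (by rw [amplitude, if_neg hc])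
        rcases hq with rfl | rfl
        · exact this l hl
        · rw [neg_neg]; exact (this l hl).symm
      rw [hstep, hbal, bogT]
      field_simp
      ring

/-- The two components involved differ by exactly one pair `±q`. Both zero mode factors are of size
`√N`, which fixes the scaling `N^{-1/2}` of `sqOp` under which a recursion survives in the limit. -/
theorem sqOp_fillZero (α β : ℝ) {q : Mode d} (hq : q ≠ 0) {N : ℕ} {μ : Occ d} (hμ : μ 0 = 0)
    (h : μ.degree < N) (v : FinFock d) :
    sqOp α β q v (fillZero N μ) =
      ((α * Real.sqrt (N - μ.degree : ℕ) * Real.sqrt (μ q + 1) : ℝ) : ℂ) *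
        v (fillZero N (μ + Finsupp.single q 1)) +
      ((β * Real.sqrt ((N - μ.degree : ℕ) + 1) * Real.sqrt (μ (-q)) : ℝ) : ℂ) *
        v (fillZero N (μ - Finsupp.single (-q) 1)) := by
  classical
  have hq' : -q ≠ 0 := neg_ne_zero.2 hq
  rw [sqOp, LinearMap.add_apply, LinearMap.smul_apply, LinearMap.smul_apply, Module.End.mul_apply,
    Module.End.mul_apply, Finsupp.add_apply, Finsupp.smul_apply, Finsupp.smul_apply, cre_apply,
    cre_apply, ann_apply, ann_apply, fillZero_sub_add hq hμ h]
  have e1 : (fillZero N μ - Finsupp.single 0 1 : Occ d) q = μ q := by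
    rw [Finsupp.tsub_apply, fillZero_apply_ne N μ hq]; simp [hq.symm]
  have e2 : (fillZero N μ - Finsupp.single (-q) 1 : Occ d) 0 = N - μ.degree := by
    rw [Finsupp.tsub_apply, fillZero_apply_zero N hμ, Finsupp.single_apply, if_neg hq', tsub_zero]
  rw [e1, e2, fillZero_apply_zero N hμ, fillZero_apply_ne N μ hq']
  by_cases h0 : μ (-q) = 0
  · simp [h0]; ring
  · rw [fillZero_sub_add' hq' hμ h.le (by omega)]
    push_cast
    simp only [smul_eq_mul]
    ring

/-! ### Limits of the components of low-energy sequences -/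

theorem tendsto_sqrt_sub_div (k : ℕ) :
    Tendsto (fun N : ℕ => Real.sqrt ((N - k : ℕ) : ℝ) / Real.sqrt N) atTop (𝓝 1) := by
  have h1 : Tendsto (fun N : ℕ => 1 - (k : ℝ) / N) atTop (𝓝 (1 - 0)) :=
    tendsto_const_nhds.sub (tendsto_const_div_atTop_nhds_zero_nat _)
  rw [sub_zero] at h1
  have h2 := (Real.continuous_sqrt.tendsto 1).comp h1
  rw [Real.sqrt_one] at h2
  refine h2.congr' ?_
  filter_upwards [eventually_gt_atTop k] with N hN
  have : (0 : ℝ) < N := by exact_mod_cast (by omega : 0 < N)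
  rw [Function.comp, Nat.cast_sub hN.le, ← Real.sqrt_div (by
    rw [sub_nonneg]; exact_mod_cast hN.le)]
  congr 1; field_simp

theorem tendsto_sqrt_sub_add_div (k r : ℕ) :
    Tendsto (fun N : ℕ => Real.sqrt (((N - k : ℕ) : ℝ) + r) / Real.sqrt N) atTop (𝓝 1) := by
  have h1 : Tendsto (fun N : ℕ => 1 + ((r : ℝ) - k) / N) atTop (𝓝 (1 + 0)) :=
    tendsto_const_nhds.add (tendsto_const_div_atTop_nhds_zero_nat _)
  rw [add_zero] at h1
  have h2 := (Real.continuous_sqrt.tendsto 1).comp h1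
  rw [Real.sqrt_one] at h2
  refine h2.congr' ?_
  filter_upwards [eventually_gt_atTop k] with N hN
  have : (0 : ℝ) < N := by exact_mod_cast (by omega : 0 < N)
  have h3 : (0 : ℝ) ≤ N - k := by rw [sub_nonneg]; exact_mod_cast hN.le
  rw [Function.comp, Nat.cast_sub hN.le, ← Real.sqrt_div (by positivity)]
  congr 1; field_simp; ring

/-- A bounded sequence on which the operators `sqOp` are small satisfies asymptotically the
recursion for the amplitudes. -/
theorem tendsto_sqOp_rec {l : Filter ℕ} (hl : l ≤ atTop) {v : ℕ → FinFock d}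
    (hv : ∀ᶠ N in l, ‖toFock (v N)‖ ≤ 1) {α β : ℝ} {q : Mode d} (hq : q ≠ 0)
    (hs : Tendsto (fun N : ℕ => (1 / N : ℝ) * ‖toFock (sqOp α β q (v N))‖ ^ 2) l (𝓝 0))
    {μ : Occ d} (hμ : μ 0 = 0) :
    Tendsto (fun N : ℕ => ((α * Real.sqrt (μ q + 1) : ℝ) : ℂ) *
        v N (fillZero N (μ + Finsupp.single q 1)) +
      ((β * Real.sqrt (μ (-q)) : ℝ) : ℂ) * v N (fillZero N (μ - Finsupp.single (-q) 1)))
      l (𝓝 0) := by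
  have hs' : Tendsto (fun N : ℕ => ((1 / Real.sqrt N : ℝ) : ℂ) * sqOp α β q (v N) (fillZero N μ))
      l (𝓝 0) := by
    have h1 := (Real.continuous_sqrt.tendsto 0).comp hs
    rw [Real.sqrt_zero] at h1
    refine squeeze_zero_norm (fun N => ?_) h1
    rw [norm_mul, Complex.norm_real, Real.norm_eq_abs, abs_of_nonneg (by positivity),
      Function.comp, Real.sqrt_mul (by positivity), Real.sqrt_sq (norm_nonneg _),
      Real.sqrt_div zero_le_one, Real.sqrt_one]
    exact mul_le_mul_of_nonneg_left (norm_apply_le _ _) (by positivity)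
  -- The components of `v N` are at most `1`, so replacing the normalized zero mode factors by their
  -- limit `1` costs nothing asymptotically.
  have bdd : ∀ (ρ : ℕ → Occ d) (f : ℕ → ℝ) (a : ℝ), Tendsto f atTop (𝓝 1) →
      Tendsto (fun N : ℕ => ((a * (1 - f N) : ℝ) : ℂ) * v N (ρ N)) l (𝓝 0) := by
    intro ρ f a hf
    have h1 : Tendsto (fun N => |a * (1 - f N)|) l (𝓝 0) := by
      have := ((tendsto_const_nhds (x := a)).mul
        ((tendsto_const_nhds (x := (1 : ℝ))).sub (hf.mono_left hl))).abs
      simpa using this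
    refine squeeze_zero_norm' ?_ h1
    filter_upwards [hv] with N hN
    rw [norm_mul, Complex.norm_real, Real.norm_eq_abs]
    exact mul_le_of_le_one_right (abs_nonneg _) ((norm_apply_le _ _).trans hN)
  have b1 := bdd (fun N => fillZero N (μ + Finsupp.single q 1)) _ (α * Real.sqrt (μ q + 1))
    (tendsto_sqrt_sub_div μ.degree)
  have b2 := bdd (fun N => fillZero N (μ - Finsupp.single (-q) 1)) _ (β * Real.sqrt (μ (-q)))
    (tendsto_sqrt_sub_add_div μ.degree 1)
  have h3 := (hs'.add b1).add b2
  rw [add_zero, add_zero] at h3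
  refine h3.congr' ?_
  filter_upwards [hl (eventually_gt_atTop μ.degree)] with N hN
  rw [sqOp_fillZero α β hq hμ hN]
  push_cast
  ring

/-- Induction on the number of excitations. For an occupied mode `q`, the asymptotic recursion at `μ
- e_q` ties the component at `μ` to the one with a pair `±q` fewer, and `Admissible.amplitude_rec`
is the same relation for the amplitudes. The filter is arbitrary so that subsequences are covered.
-/
theorem Admissible.tendsto_amplitude (h : Admissible L c j m) {f : Filter ℕ} (hf : f ≤ atTop)
    {v : ℕ → FinFock d} (hv : ∀ᶠ N in f, ‖toFock (v N)‖ ≤ 1)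
    (hs : ∀ l ∈ Finset.Icc 1 m, ∀ q, q = j l ∨ q = -j l →
      Tendsto (fun N : ℕ => (1 / N : ℝ) *
        ‖toFock (sqOp (bogA L c (j l)) (bogB L c (j l)) q (v N))‖ ^ 2) f (𝓝 0))
    (k : ℕ) (μ : Occ d) (hμ : μ.support ⊆ pairModes j m) (hk : μ.degree = k) :
    Tendsto (fun N => v N (fillZero N μ) - (amplitude L c j m μ : ℂ) * v N (fillZero N 0))
      f (𝓝 0) := by
  classical
  induction k using Nat.strong_induction_on generalizing μ with
  | _ k ih =>
  by_cases h0 : μ = 0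
  · subst h0; simpa [amplitude_zero] using tendsto_const_nhds
  obtain ⟨q, hq⟩ : ∃ q, q ∈ μ.support := by
    exact Finsupp.support_nonempty_iff.2 h0
  obtain ⟨l, hl, hql⟩ := mem_pairModes.1 (hμ hq)
  have hμq : 0 < μ q := Nat.pos_of_ne_zero (Finsupp.mem_support_iff.1 hq)
  have hq0 : q ≠ 0 := by
    rintro rfl; exact h.zero_notMem (hμ hq)
  have hqq := ne_neg_of_ne_zero hq0
  have hsub : ∀ {ν : Occ d}, ν ≤ μ → ν.support ⊆ pairModes j m := fun hν =>
    (Finsupp.support_mono hν).trans hμ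
  have hle : Finsupp.single q 1 ≤ μ := by rw [Finsupp.single_le_iff]; exact hμq
  set μ' := μ - Finsupp.single q 1 with hμ'
  have hμ'le : μ' ≤ μ := tsub_le_self
  have e1 : μ' + Finsupp.single q 1 = μ := tsub_add_cancel_of_le hle
  have e2 : μ' (-q) = μ (-q) := by simp [hμ', hqq]
  have e3 : ((μ' q : ℕ) : ℝ) + 1 = μ q := by rw [← e1]; simp
  have hrec := tendsto_sqOp_rec hf hv hq0 (hs l hl q hql) (h.apply_zero (hsub hμ'le))
  rw [e1, e2, e3] at hrec
  have ham := h.amplitude_rec hl hql hμq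
  rw [← hμ'] at ham
  have hA := (h.bogA_pos hl).ne'
  have hsq : Real.sqrt (μ q) ≠ 0 := (Real.sqrt_pos.2 (by exact_mod_cast hμq)).ne'
  -- If `-q` is empty the truncated subtraction does not lower the degree, but then the coefficient
  -- is zero; otherwise the degree drops by two and the induction hypothesis applies.
  have ihν : Tendsto (fun N => ((bogB L c (j l) * Real.sqrt (μ (-q)) : ℝ) : ℂ) *
      (v N (fillZero N (μ' - Finsupp.single (-q) 1)) -
      (amplitude L c j m (μ' - Finsupp.single (-q) 1) : ℂ) * v N (fillZero N 0))) f (𝓝 0) := by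
    by_cases hz : μ (-q) = 0
    · simpa [hz] using tendsto_const_nhds
    · have hd : (μ' - Finsupp.single (-q) 1).degree < k := by
        have h1 : Finsupp.single (-q) 1 ≤ μ' := by rw [Finsupp.single_le_iff, e2]; omega
        have h2 := congrArg Finsupp.degree (tsub_add_cancel_of_le h1)
        have h3 := congrArg Finsupp.degree e1
        rw [map_add, degree_single] at h2 h3
        omega
      have := (ih _ hd (μ' - Finsupp.single (-q) 1) (hsub (tsub_le_self.trans hμ'le)) rfl).const_mul
        ((bogB L c (j l) * Real.sqrt (μ (-q)) : ℝ) : ℂ)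
      rwa [mul_zero] at this
  have hfin := (hrec.sub ihν).const_mul (((bogA L c (j l) * Real.sqrt (μ q) : ℝ) : ℂ)⁻¹)
  rw [sub_zero, mul_zero] at hfin
  refine hfin.congr fun N => ?_
  have hne : ((bogA L c (j l) * Real.sqrt (μ q) : ℝ) : ℂ) ≠ 0 := by
    exact_mod_cast mul_ne_zero hA hsq
  rw [inv_mul_eq_iff_eq_mul₀ hne]
  have hamC : ((bogA L c (j l) * Real.sqrt (μ q) * amplitude L c j m μ : ℝ) : ℂ) =
      -((bogB L c (j l) * Real.sqrt (μ (-q)) *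
      amplitude L c j m (μ' - Finsupp.single (-q) 1) : ℝ) : ℂ) := by
    rw [← Complex.ofReal_neg]; congr 1; linarith
  push_cast at hamC ⊢
  linear_combination (v N (fillZero N 0)) * hamC

/-- The truncated Bogoliubov ground state with `N` particles. -/
def trial (L : ℝ) (c : Mode d → ℝ) (N : ℕ) (j : ℕ → Mode d) (m K : ℕ) : FinFock d :=
  ∑ μ ∈ configs j m K, (amplitude L c j m μ : ℂ) • ket (fillZero N μ)

theorem Admissible.sum_smul_ket_apply (h : Admissible L c j m) {K N : ℕ} (a : Occ d → ℂ)
    {μ : Occ d} (hμ : μ ∈ configs j m K) :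
    (∑ ν ∈ configs j m K, a ν • ket (fillZero N ν)) (fillZero N μ) = a μ := by
  rw [Finsupp.finsetSum_apply, Finset.sum_eq_single μ]
  · simp [ket_apply]
  · intro ν hν hne
    rw [Finsupp.smul_apply, ket_apply, if_neg, smul_zero]
    intro h'
    exact hne (fillZero_injective (h.apply_zero (mem_configs.1 hν).1)
      (h.apply_zero (mem_configs.1 hμ).1) h')
  · intro h'; exact absurd hμ h'

theorem sum_smul_ket_apply_of_notMem {K N : ℕ} (a : Occ d → ℂ) {n : Occ d}
    (hn : ∀ μ ∈ configs j m K, fillZero N μ ≠ n) :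
    (∑ ν ∈ configs j m K, a ν • ket (fillZero N ν)) n = 0 := by
  rw [Finsupp.finsetSum_apply]
  apply Finset.sum_eq_zero
  intro ν hν
  rw [Finsupp.smul_apply, ket_apply, if_neg (hn ν hν), smul_zero]

theorem Admissible.trial_apply (h : Admissible L c j m) {K N : ℕ} {μ : Occ d}
    (hμ : μ ∈ configs j m K) : trial L c N j m K (fillZero N μ) = amplitude L c j m μ :=
  h.sum_smul_ket_apply _ hμ

theorem trial_apply_of_notMem {K N : ℕ} {n : Occ d}
    (hn : ∀ μ ∈ configs j m K, fillZero N μ ≠ n) : trial L c N j m K n = 0 :=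
  sum_smul_ket_apply_of_notMem _ hn

/-- The weights count particles and are integers, so the strict bounds mean that no particle lies
outside the selected modes and at most `K` are excited. -/
theorem Admissible.exists_config (h : Admissible L c j m) {n : Occ d} {K N : ℕ}
    (hn : n.degree = N) (h1 : restNum j m n < 1) (h2 : exc n < K + 1) :
    ∃ μ ∈ configs j m K, fillZero N μ = n := by
  classical
  have hsupp : n.support ⊆ insert 0 (pairModes j m) := by
    intro q hq
    by_contra hq'
    rw [h.restNum_eq] at h1
    have : (n q : ℝ) ≤ ∑ q ∈ n.support \ insert 0 (pairModes j m), (n q : ℝ) :=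
      Finset.single_le_sum (f := fun q => (n q : ℝ)) (fun _ _ => by positivity)
        (Finset.mem_sdiff.2 ⟨hq, hq'⟩)
    have h3 : (1 : ℝ) ≤ n q := by
      exact_mod_cast Nat.one_le_iff_ne_zero.2 (Finsupp.mem_support_iff.1 hq)
    linarith
  have hd : (n.erase 0).degree + n 0 = N := by
    have := congrArg Finsupp.degree (Finsupp.erase_add_single 0 n)
    rw [map_add, degree_single] at this
    omega
  refine ⟨n.erase 0, mem_configs.2 ⟨?_, ?_⟩, ?_⟩
  · intro q hq
    rw [Finsupp.support_erase, Finset.mem_erase] at hq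
    exact (Finset.mem_insert.1 (hsupp hq.2)).resolve_left hq.1
  · unfold exc at h2
    have h3 : ((n.erase 0).degree : ℝ) + n 0 = n.degree := by rw [hn]; exact_mod_cast hd
    have h4 : ((n.erase 0).degree : ℝ) < (K + 1 : ℕ) := by push_cast; linarith
    have : (n.erase 0).degree < K + 1 := by exact_mod_cast h4
    omega
  · rw [fillZero, show N - (n.erase 0).degree = n 0 by omega, Finsupp.erase_add_single]

theorem exc_nonneg (n : Occ d) : 0 ≤ exc n := by
  rw [exc, sub_nonneg]
  exact_mod_cast Finsupp.le_degree 0 n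

/-- A Markov inequality: a coordinate of `v` missed by the configurations has `restNum ≥ 1` or `exc
≥ K + 1`, so `restNum + exc/(K+1)` is at least `1` there. -/
theorem Admissible.norm_sub_sum_le (h : Admissible L c j m) {N K : ℕ} {v : FinFock d}
    (hv : v ∈ nParticle d N) (a : Occ d → ℂ) :
    ‖toFock (v - ∑ μ ∈ configs j m K, a μ • ket (fillZero N μ))‖ ^ 2 ≤
      ∑ μ ∈ configs j m K, ‖v (fillZero N μ) - a μ‖ ^ 2 + wsum (restNum j m) v
        + wsum exc v / (K + 1) := by
  classical
  set u := ∑ μ ∈ configs j m K, a μ • ket (fillZero N μ) with hu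
  set T := (configs j m K).image (fillZero N) with hT
  set U := (v - u).support ∪ v.support ∪ T
  have h1 : ‖toFock (v - u)‖ ^ 2 = ∑ n ∈ U, ‖(v - u) n‖ ^ 2 := by
    rw [norm_sq_eq_wsum, wsum_eq_sum _ _ U]
    · simp
    · exact Finset.subset_union_left.trans Finset.subset_union_left
  have h2 : wsum (fun n => restNum j m n + exc n / (K + 1)) v
      = wsum (restNum j m) v + wsum exc v / (K + 1) := by
    rw [wsum_add]
    simp only [div_eq_inv_mul]
    rw [wsum_const_mul]
  rw [add_assoc, ← h2, wsum_eq_sum _ _ U (Finset.subset_union_right.trans Finset.subset_union_left),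
    h1, ← Finset.sum_sdiff (show T ⊆ U from Finset.subset_union_right), add_comm]
  have hT' : ∑ n ∈ T, ‖(v - u) n‖ ^ 2 = ∑ μ ∈ configs j m K, ‖v (fillZero N μ) - a μ‖ ^ 2 := by
    rw [hT, Finset.sum_image]
    · refine Finset.sum_congr rfl fun μ hμ => ?_
      rw [Finsupp.sub_apply, hu, h.sum_smul_ket_apply a hμ]
    · intro μ hμ ν hν
      exact fillZero_injective (h.apply_zero (mem_configs.1 hμ).1)
        (h.apply_zero (mem_configs.1 hν).1)
  rw [hT']
  refine add_le_add_right ?_ _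
  have hnn : ∀ n ∈ U, 0 ≤ (restNum j m n + exc n / (K + 1)) * ‖v n‖ ^ 2 := by
    intro n _
    have := h.restNum_nonneg n
    have := exc_nonneg n
    positivity
  refine le_trans (Finset.sum_le_sum fun n hn => ?_)
    (Finset.sum_le_sum_of_subset_of_nonneg Finset.sdiff_subset fun n hn _ => hnn n hn)
  rw [Finset.mem_sdiff] at hn
  have hn' : ∀ μ ∈ configs j m K, fillZero N μ ≠ n := by
    intro μ hμ h'
    exact hn.2 (Finset.mem_image.2 ⟨μ, hμ, h'⟩)
  rw [Finsupp.sub_apply, hu, sum_smul_ket_apply_of_notMem a hn', sub_zero]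
  by_cases hvn : v n = 0
  · simp [hvn]
  · have hd := mem_nParticle.1 hv n hvn
    refine le_mul_of_one_le_left (by positivity) ?_
    have g1 := h.restNum_nonneg n
    have g2 := exc_nonneg n
    have hK : (0 : ℝ) < K + 1 := by positivity
    by_contra hlt
    push Not at hlt
    have g3 : 0 ≤ exc n / (K + 1) := by positivity
    obtain ⟨μ, hμ, he⟩ := h.exists_config (K := K) hd (by linarith) (by
      have : exc n / (K + 1) < 1 := by linarith
      rwa [div_lt_one hK] at this)
    exact hn' μ hμ he

/-- `N`-particle states of low energy are close to multiples of the Bogoliubov ground state. -/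
theorem Admissible.stability (h : Admissible L c j m) {δ : ℝ} (hδ : 0 < δ) :
    ∃ K₀, ∀ K ≥ K₀, ∀ f : Filter ℕ, f ≤ atTop → ∀ (v : ℕ → FinFock d) (err : ℕ → ℝ),
      (∀ᶠ N in f, v N ∈ nParticle d N) → (∀ᶠ N in f, ‖toFock (v N)‖ ≤ 1) →
      Tendsto err f (𝓝 0) →
      (∀ᶠ N in f, (ip (v N) (HBog L c N j m (v N))).re ≤
        eBogSum L c j m * ‖toFock (v N)‖ ^ 2 + err N) →
      ∀ᶠ N in f, ‖toFock (v N - v N (fillZero N 0) • trial L c N j m K)‖ ≤ δ := by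
  obtain ⟨C₁, hC₁⟩ := h.form_ge
  obtain ⟨C₂, hC₂⟩ := h.form_ge_exc
  have hk := kMin_pos h.L_pos
  -- A bound on the expected number of excitations from `form_ge_exc`; the summand `1` accounts for
  -- the energy error once it has become at most `1`.
  set D : ℝ := 4 / kMin L * (|eBogSum L c j m| + 1 + |C₂|) with hD
  have hD0 : 0 ≤ D := by positivity
  -- The tail beyond `K` excitations is at most `D / (K + 1) ≤ δ² / 2`. The cutoff is fixed before
  -- the filter and the sequence, which makes the result uniform.
  obtain ⟨K₀, hK₀⟩ := exists_nat_gt (D / (δ ^ 2 / 2))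
  refine ⟨K₀, fun K hK f hf v err hmem hv herr hform => ?_⟩
  have hpos : ∀ᶠ N : ℕ in f, 0 < N := hf (eventually_gt_atTop 0)
  set err' : ℕ → ℝ := fun N => err N + |C₁| / N with herr'
  have herr'0 : Tendsto err' f (𝓝 0) := by
    have := herr.add ((tendsto_const_div_atTop_nhds_zero_nat |C₁|).mono_left hf)
    simpa using this
  -- The sharp lower bound leaves only `err'` for all squares and for the energy outside the
  -- selected modes together; each is nonnegative, hence each tends to zero.
  have main : ∀ᶠ N : ℕ in f, ∑ l ∈ Finset.Icc 1 m, (1 / N : ℝ) *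
      (‖toFock (sqOp (bogA L c (j l)) (bogB L c (j l)) (j l) (v N))‖ ^ 2
        + ‖toFock (sqOp (bogA L c (j l)) (bogB L c (j l)) (-j l) (v N))‖ ^ 2)
      + kMin L * wsum (restNum j m) (v N) ≤ err' N := by
    filter_upwards [hmem, hv, hform, hpos] with N h1 h2 h3 h4
    have h5 := hC₁ N h4 (v N) h1
    have h6 : C₁ / N * ‖toFock (v N)‖ ^ 2 ≤ |C₁| / N := by
      have a1 : C₁ / N ≤ |C₁| / N := by gcongr; exact le_abs_self _
      have a2 : ‖toFock (v N)‖ ^ 2 ≤ 1 := pow_le_one₀ (norm_nonneg _) h2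
      have a3 : 0 ≤ |C₁| / N := by positivity
      calc C₁ / N * ‖toFock (v N)‖ ^ 2 ≤ |C₁| / N * ‖toFock (v N)‖ ^ 2 := by gcongr
        _ ≤ |C₁| / N := mul_le_of_le_one_right a3 a2
    simp only [herr']
    linarith
  have hrest0 : ∀ N, 0 ≤ wsum (restNum j m) (v N) := fun N =>
    wsum_nonneg fun n _ => h.restNum_nonneg n
  have hrest : Tendsto (fun N => wsum (restNum j m) (v N)) f (𝓝 0) := by
    have h1 := herr'0.div_const (kMin L)
    rw [zero_div] at h1
    refine squeeze_zero' (Eventually.of_forall hrest0) ?_ h1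
    filter_upwards [main] with N hN
    rw [le_div_iff₀ hk]
    refine le_trans ?_ hN
    rw [mul_comm]
    exact le_add_of_nonneg_left (by positivity)
  have hsq : ∀ l ∈ Finset.Icc 1 m, ∀ q, q = j l ∨ q = -j l →
      Tendsto (fun N : ℕ => (1 / N : ℝ) *
        ‖toFock (sqOp (bogA L c (j l)) (bogB L c (j l)) q (v N))‖ ^ 2) f (𝓝 0) := by
    intro l hl q hq
    refine squeeze_zero' (Eventually.of_forall fun N => by positivity) ?_ herr'0
    filter_upwards [main] with N hN
    have h1 : (1 / N : ℝ) *
      (‖toFock (sqOp (bogA L c (j l)) (bogB L c (j l)) (j l) (v N))‖ ^ 2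
        + ‖toFock (sqOp (bogA L c (j l)) (bogB L c (j l)) (-j l) (v N))‖ ^ 2) ≤
      ∑ l ∈ Finset.Icc 1 m, (1 / N : ℝ) *
      (‖toFock (sqOp (bogA L c (j l)) (bogB L c (j l)) (j l) (v N))‖ ^ 2
        + ‖toFock (sqOp (bogA L c (j l)) (bogB L c (j l)) (-j l) (v N))‖ ^ 2) :=
      Finset.single_le_sum (f := fun l => (1 / N : ℝ) *
      (‖toFock (sqOp (bogA L c (j l)) (bogB L c (j l)) (j l) (v N))‖ ^ 2
        + ‖toFock (sqOp (bogA L c (j l)) (bogB L c (j l)) (-j l) (v N))‖ ^ 2))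
        (fun _ _ => by positivity) hl
    have h2 := mul_nonneg hk.le (hrest0 N)
    rcases hq with rfl | rfl
    · refine le_trans ?_ (h1.trans (by linarith))
      gcongr
      exact le_add_of_nonneg_right (by positivity)
    · refine le_trans ?_ (h1.trans (by linarith))
      gcongr
      exact le_add_of_nonneg_left (by positivity)
  have hexc : ∀ᶠ N in f, wsum exc (v N) ≤ D := by
    filter_upwards [hmem, hv, hform, hf hC₂, herr.eventually_le_const (zero_lt_one)]
      with N h1 h2 h3 h4 h5
    have h6 := h4 _ h1
    have a2 : ‖toFock (v N)‖ ^ 2 ≤ 1 := pow_le_one₀ (norm_nonneg _) h2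
    have a3 : eBogSum L c j m * ‖toFock (v N)‖ ^ 2 ≤ |eBogSum L c j m| :=
      (mul_le_mul_of_nonneg_right (le_abs_self _) (by positivity)).trans
        (mul_le_of_le_one_right (abs_nonneg _) a2)
    have a4 : C₂ * ‖toFock (v N)‖ ^ 2 ≤ |C₂| :=
      (mul_le_mul_of_nonneg_right (le_abs_self _) (by positivity)).trans
        (mul_le_of_le_one_right (abs_nonneg _) a2)
    have a5 : kMin L / 4 * wsum exc (v N) ≤ |eBogSum L c j m| + 1 + |C₂| := by linarith
    rw [hD]
    calc wsum exc (v N) = 4 / kMin L * (kMin L / 4 * wsum exc (v N)) := by field_simp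
      _ ≤ _ := by gcongr
  have hconf : Tendsto (fun N => ∑ μ ∈ configs j m K,
      ‖v N (fillZero N μ) - (amplitude L c j m μ : ℂ) * v N (fillZero N 0)‖ ^ 2
      + wsum (restNum j m) (v N)) f (𝓝 0) := by
    have : Tendsto (fun N => ∑ μ ∈ configs j m K,
      ‖v N (fillZero N μ) - (amplitude L c j m μ : ℂ) * v N (fillZero N 0)‖ ^ 2) f
      (𝓝 (∑ μ ∈ configs j m K, (0 : ℝ))) := by
      refine tendsto_finsetSum _ fun μ hμ => ?_
      have := ((h.tendsto_amplitude hf hv hsq _ μ (mem_configs.1 hμ).1 rfl).norm).pow 2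
      simpa using this
    rw [Finset.sum_const_zero] at this
    simpa using this.add hrest
  filter_upwards [hmem, hexc, hconf.eventually_le_const (show 0 < δ ^ 2 / 2 by positivity)]
    with N h1 h2 h3
  have h4 := h.norm_sub_sum_le (K := K) h1
    (fun μ => v N (fillZero N 0) * (amplitude L c j m μ : ℂ))
  have e : ∑ μ ∈ configs j m K, (v N (fillZero N 0) * (amplitude L c j m μ : ℂ)) •
      ket (fillZero N μ) = v N (fillZero N 0) • trial L c N j m K := by
    simp only [trial, Finset.smul_sum, smul_smul]
  rw [e] at h4
  refine le_of_sq_le_sq ?_ hδ.le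
  refine h4.trans ?_
  have h5 : wsum exc (v N) / (K + 1) ≤ δ ^ 2 / 2 := by
    rw [div_lt_iff₀ (by positivity)] at hK₀
    rw [div_le_iff₀ (by positivity)]
    have : (K₀ : ℝ) ≤ K := by exact_mod_cast hK
    nlinarith [sq_nonneg δ]
  simp only [mul_comm (v N (fillZero N 0))]
  linarith

end Bogoliubov

end

noncomputable section

namespace Bogoliubov

open Filter Topology

variable {d : ℕ} {L : ℝ} {c : Mode d → ℝ} {j : ℕ → Mode d} {m : ℕ}

/-! ## Energy of the trial state -/

theorem card_configs_le (j : ℕ → Mode d) (m K : ℕ) :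
    (configs j m K).card ≤ (K + 1) ^ (pairModes j m).card := by
  classical
  have : (Fintype.piFinset fun _ : pairModes j m => Finset.range (K + 1)).card =
      (K + 1) ^ (pairModes j m).card := by
    simp
  rw [← this]
  refine Finset.card_le_card_of_injOn (fun μ q => μ q) ?_ ?_
  · intro μ hμ
    rw [Finset.mem_coe, Fintype.mem_piFinset]
    intro q
    have := (Finsupp.le_degree (q : Mode d) μ).trans (mem_configs.1 hμ).2
    exact Finset.mem_range.2 (Nat.lt_succ_of_le this)
  · intro μ hμ ν hν h
    ext q
    by_cases hq : q ∈ pairModes j m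
    · exact congrFun h ⟨q, hq⟩
    · rw [Finsupp.notMem_support_iff.1 fun h' => hq ((mem_configs.1 hμ).1 h'),
        Finsupp.notMem_support_iff.1 fun h' => hq ((mem_configs.1 hν).1 h')]

/-- `T` is a decay rate per particle: a pair contributes one factor `bogT` but two particles, hence
the square. Finitely many ratios below `1` leave room for a common `T < 1`. -/
theorem Admissible.exists_rate (h : Admissible L c j m) :
    ∃ T : ℝ, 0 < T ∧ T < 1 ∧ ∀ l ∈ Finset.Icc 1 m, bogT L c (j l) ≤ T ^ 2 := by
  have h1 : ∀ᶠ T : ℝ in 𝓝[<] 1, 0 < T :=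
    (lt_mem_nhds (zero_lt_one' ℝ)).filter_mono nhdsWithin_le_nhds
  have h2 : ∀ᶠ T : ℝ in 𝓝[<] 1, T < 1 := self_mem_nhdsWithin
  have h3 : ∀ᶠ T : ℝ in 𝓝[<] 1, ∀ l ∈ Finset.Icc 1 m, bogT L c (j l) ≤ T ^ 2 := by
    rw [Filter.eventually_all_finset]
    intro l hl
    have : Tendsto (fun T : ℝ => T ^ 2) (𝓝[<] 1) (𝓝 (1 ^ 2)) :=
      ((continuous_pow 2).tendsto 1).mono_left nhdsWithin_le_nhds
    rw [one_pow] at this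
    exact this.eventually_const_le (h.bogT_lt_one hl)
  exact (h1.and (h2.and h3)).exists

theorem Admissible.abs_amplitude_le (h : Admissible L c j m) {T : ℝ} (hT0 : 0 < T)
    (hT : ∀ l ∈ Finset.Icc 1 m, bogT L c (j l) ≤ T ^ 2) {μ : Occ d}
    (hμ : μ.support ⊆ pairModes j m) : |amplitude L c j m μ| ≤ T ^ μ.degree := by
  unfold amplitude
  split_ifs with hb
  · rw [Finset.abs_prod, degree_eq_sum hμ, h.sum_pairModes, ← Finset.prod_pow_eq_pow_sum]
    refine Finset.prod_le_prod (fun _ _ => abs_nonneg _) fun l hl => ?_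
    rw [abs_pow, abs_neg, abs_of_pos (h.bogT_pos hl), ← hb l hl, ← two_mul, pow_mul]
    exact pow_le_pow_left₀ (h.bogT_pos hl).le (hT l hl) _
  · rw [abs_zero]; positivity

theorem Admissible.trial_fillZero (h : Admissible L c j m) {K N : ℕ} {μ : Occ d} (hμ : μ 0 = 0)
    [Decidable (μ ∈ configs j m K)] : trial L c N j m K (fillZero N μ) =
      ((if μ ∈ configs j m K then amplitude L c j m μ else 0 : ℝ) : ℂ) := by
  split_ifs with hm
  · exact h.trial_apply hm
  · rw [trial_apply_of_notMem, Complex.ofReal_zero]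
    intro ν hν h'
    apply hm
    rwa [← fillZero_injective (h.apply_zero (mem_configs.1 hν).1) hμ h']

theorem degree_sub_single {μ : Occ d} {q : Mode d} (h : 0 < μ q) :
    (μ - Finsupp.single q 1).degree + 1 = μ.degree := by
  conv_rhs => rw [← tsub_add_cancel_of_le (show Finsupp.single q 1 ≤ μ by
    rw [Finsupp.single_le_iff]; exact h), map_add, degree_single]

theorem support_add_single_subset {s : Finset (Mode d)} {μ : Occ d} {q : Mode d}
    (hμ : μ.support ⊆ s) (hq : q ∈ s) : (μ + Finsupp.single q 1).support ⊆ s := by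
  classical
  refine Finsupp.support_add.trans (Finset.union_subset hμ ?_)
  exact Finsupp.support_single_subset.trans (by simpa using hq)

theorem neg_mem_pairModes {q : Mode d} (hq : q ∈ pairModes j m) : -q ∈ pairModes j m := by
  obtain ⟨l, hl, rfl | rfl⟩ := mem_pairModes.1 hq
  · exact mem_pairModes.2 ⟨l, hl, Or.inr rfl⟩
  · exact mem_pairModes.2 ⟨l, hl, Or.inl (neg_neg _)⟩

/-- Each of the two terms of `sqOp` transfers one particle between the zero mode and a mode `±q`, so
the cutoff is exceeded by at most one. The support is then indexed by a finite set which does not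
depend on `N`. -/
theorem Admissible.sqOp_trial_support (h : Admissible L c j m) (α β : ℝ) {q : Mode d}
    (hq : q ∈ pairModes j m) {K N : ℕ} (hN : K < N) {n : Occ d}
    (hn : sqOp α β q (trial L c N j m K) n ≠ 0) :
    ∃ μ ∈ configs j m (K + 1), fillZero N μ = n := by
  classical
  have hq0 : q ≠ 0 := by rintro rfl; exact h.zero_notMem hq
  have hq0' : -q ≠ 0 := neg_ne_zero.2 hq0
  rw [sqOp, LinearMap.add_apply, LinearMap.smul_apply, LinearMap.smul_apply, Module.End.mul_apply,
    Module.End.mul_apply, Finsupp.add_apply, Finsupp.smul_apply, Finsupp.smul_apply, cre_apply,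
    cre_apply, ann_apply, ann_apply] at hn
  by_cases h1 : n 0 ≠ 0 ∧
      trial L c N j m K (n - Finsupp.single 0 1 + Finsupp.single q 1) ≠ 0
  · obtain ⟨h1, h2⟩ := h1
    have : ∃ ν ∈ configs j m K, fillZero N ν = n - Finsupp.single 0 1 + Finsupp.single q 1 := by
      by_contra! hc
      exact h2 (trial_apply_of_notMem hc)
    obtain ⟨ν, hν, he⟩ := this
    obtain ⟨hν1, hν2⟩ := mem_configs.1 hν
    have hνq : 0 < ν q := by
      rw [← fillZero_apply_ne N ν hq0, he]; simp
    refine ⟨ν - Finsupp.single q 1, mem_configs.2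
      ⟨(Finsupp.support_mono tsub_le_self).trans hν1, ?_⟩, ?_⟩
    · have := degree_sub_single hνq; omega
    · rw [← fillZero_sub_add' hq0 (h.apply_zero hν1) (by omega) hνq, he, add_tsub_cancel_right,
        tsub_add_cancel_of_le]
      rw [Finsupp.single_le_iff]; omega
  · have h2 : n (-q) ≠ 0 ∧
        trial L c N j m K (n - Finsupp.single (-q) 1 + Finsupp.single 0 1) ≠ 0 := by
      rw [not_and_or, not_not, not_not] at h1
      constructor
      · intro h3; apply hn
        rcases h1 with h1 | h1 <;> simp [h1, h3]
      · intro h3; apply hn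
        rcases h1 with h1 | h1 <;> simp [h1, h3]
    obtain ⟨h1, h2⟩ := h2
    have : ∃ ν ∈ configs j m K, fillZero N ν = n - Finsupp.single (-q) 1 + Finsupp.single 0 1 := by
      by_contra! hc
      exact h2 (trial_apply_of_notMem hc)
    obtain ⟨ν, hν, he⟩ := this
    obtain ⟨hν1, hν2⟩ := mem_configs.1 hν
    refine ⟨ν + Finsupp.single (-q) 1, mem_configs.2
      ⟨support_add_single_subset hν1 (neg_mem_pairModes hq), ?_⟩, ?_⟩
    · rw [map_add, degree_single]; omega
    · rw [← fillZero_sub_add hq0' (h.apply_zero hν1) (by omega), he, add_tsub_cancel_right,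
        tsub_add_cancel_of_le]
      rw [Finsupp.single_le_iff]; omega

/-- Limit `N → ∞` of the components of `N^{-1/2} sqOp` applied to the trial state. -/
def sqTrialLim (L : ℝ) (c : Mode d → ℝ) (j : ℕ → Mode d) (m K : ℕ) (α β : ℝ) (q : Mode d)
    (μ : Occ d) : ℝ :=
  open Classical in
  α * Real.sqrt (μ q + 1) * (if μ + Finsupp.single q 1 ∈ configs j m K then
      amplitude L c j m (μ + Finsupp.single q 1) else 0)
  + β * Real.sqrt (μ (-q)) * (if μ - Finsupp.single (-q) 1 ∈ configs j m K then
      amplitude L c j m (μ - Finsupp.single (-q) 1) else 0)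

theorem Admissible.tendsto_sqOp_trial (h : Admissible L c j m) (α β : ℝ) {q : Mode d}
    (hq : q ∈ pairModes j m) (K : ℕ) :
    Tendsto (fun N : ℕ => (1 / N : ℝ) * ‖toFock (sqOp α β q (trial L c N j m K))‖ ^ 2) atTop
      (𝓝 (∑ μ ∈ configs j m (K + 1), sqTrialLim L c j m K α β q μ ^ 2)) := by
  classical
  have hq0 : q ≠ 0 := by rintro rfl; exact h.zero_notMem hq
  have hlim : Tendsto (fun N : ℕ => ∑ μ ∈ configs j m (K + 1),
      ‖((1 / Real.sqrt N : ℝ) : ℂ) * sqOp α β q (trial L c N j m K) (fillZero N μ)‖ ^ 2) atTop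
      (𝓝 (∑ μ ∈ configs j m (K + 1), sqTrialLim L c j m K α β q μ ^ 2)) := by
    refine tendsto_finsetSum _ fun μ hμ => ?_
    have hμ0 := h.apply_zero (mem_configs.1 hμ).1
    have e1 : (μ + Finsupp.single q 1 : Occ d) 0 = 0 := by simp [hμ0, hq0]
    have e2 : (μ - Finsupp.single (-q) 1 : Occ d) 0 = 0 := by simp [hμ0]
    set a : ℝ := if μ + Finsupp.single q 1 ∈ configs j m K then
      amplitude L c j m (μ + Finsupp.single q 1) else 0 with ha
    set b : ℝ := if μ - Finsupp.single (-q) 1 ∈ configs j m K then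
      amplitude L c j m (μ - Finsupp.single (-q) 1) else 0 with hb
    have h1 : Tendsto (fun N : ℕ => α * Real.sqrt (μ q + 1) * a *
        (Real.sqrt ((N - μ.degree : ℕ) : ℝ) / Real.sqrt N) +
        β * Real.sqrt (μ (-q)) * b * (Real.sqrt (((N - μ.degree : ℕ) : ℝ) + (1 : ℕ)) / Real.sqrt N))
        atTop (𝓝 (α * Real.sqrt (μ q + 1) * a * 1 + β * Real.sqrt (μ (-q)) * b * 1)) :=
      ((tendsto_sqrt_sub_div μ.degree).const_mul _).add
        ((tendsto_sqrt_sub_add_div μ.degree 1).const_mul _)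
    have h2 := (h1.abs).pow 2
    rw [sq_abs, mul_one, mul_one] at h2
    have e3 : sqTrialLim L c j m K α β q μ =
        α * Real.sqrt (μ q + 1) * a + β * Real.sqrt (μ (-q)) * b := by
      rw [sqTrialLim, ha, hb]
    rw [e3]
    refine h2.congr' ?_
    filter_upwards [eventually_gt_atTop μ.degree] with N hN
    rw [sqOp_fillZero α β hq0 hμ0 hN, h.trial_fillZero e1, h.trial_fillZero e2, ← ha, ← hb,
      ← Real.norm_eq_abs, ← Complex.norm_real]
    congr 2
    push_cast
    ring
  refine hlim.congr' ?_
  filter_upwards [eventually_gt_atTop K] with N hN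
  have hT : (sqOp α β q (trial L c N j m K)).support ⊆
      (configs j m (K + 1)).image (fillZero N) := by
    intro n hn
    obtain ⟨μ, hμ, he⟩ := h.sqOp_trial_support α β hq hN (Finsupp.mem_support_iff.1 hn)
    exact Finset.mem_image.2 ⟨μ, hμ, he⟩
  rw [norm_sq_eq_wsum, wsum_eq_sum _ _ _ hT, Finset.sum_image, Finset.mul_sum]
  · refine Finset.sum_congr rfl fun μ _ => ?_
    rw [norm_mul, Complex.norm_real, Real.norm_eq_abs, abs_of_nonneg (by positivity), mul_pow,
      div_pow, Real.sq_sqrt (by positivity)]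
    ring
  · intro μ hμ ν hν
    exact fillZero_injective (h.apply_zero (mem_configs.1 hμ).1)
      (h.apply_zero (mem_configs.1 hν).1)

/-- Away from the cutoff both neighbours are kept and the amplitude recursion gives exactly zero.
Above degree `K` the upper neighbour is cut off, and the lower one has degree at least `K`, so its
amplitude is at most `T ^ K`. -/
theorem Admissible.abs_sqTrialLim_le (h : Admissible L c j m) {T : ℝ} (hT0 : 0 < T) (hT1 : T < 1)
    (hT : ∀ l ∈ Finset.Icc 1 m, bogT L c (j l) ≤ T ^ 2) {l : ℕ} (hl : l ∈ Finset.Icc 1 m)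
    {q : Mode d} (hq : q = j l ∨ q = -j l) (K : ℕ) {μ : Occ d}
    (hμ : μ ∈ configs j m (K + 2)) :
    |sqTrialLim L c j m (K + 1) (bogA L c (j l)) (bogB L c (j l)) q μ| ≤
      bogB L c (j l) * Real.sqrt (K + 2) * T ^ K := by
  classical
  have hqm : q ∈ pairModes j m := mem_pairModes.2 ⟨l, hl, hq⟩
  have hB := h.bogB_pos hl
  obtain ⟨hμ1, hμ2⟩ := mem_configs.1 hμ
  have hqq : q ≠ -q := ne_neg_of_ne_zero (by rintro rfl; exact h.zero_notMem hqm)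
  by_cases hK : μ.degree ≤ K
  · have hs : μ + Finsupp.single q 1 ∈ configs j m (K + 1) :=
      mem_configs.2 ⟨support_add_single_subset hμ1 hqm, by rw [map_add, degree_single]; omega⟩
    have hs' : μ - Finsupp.single (-q) 1 ∈ configs j m (K + 1) :=
      mem_configs.2 ⟨(Finsupp.support_mono tsub_le_self).trans hμ1,
        (Finsupp.degree_mono tsub_le_self).trans (by omega)⟩
    have hr := h.amplitude_rec hl hq (μ := μ + Finsupp.single q 1) (by simp)
    have e1 : (((μ + Finsupp.single q 1 : Occ d) q : ℕ) : ℝ) = μ q + 1 := by simp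
    have e2 : (μ + Finsupp.single q 1 : Occ d) (-q) = μ (-q) := by
      simp [hqq]
    rw [e1, e2, add_tsub_cancel_right] at hr
    rw [sqTrialLim, if_pos hs, if_pos hs', hr, abs_zero]
    positivity
  · have hs : μ + Finsupp.single q 1 ∉ configs j m (K + 1) := by
      intro hc
      have := (mem_configs.1 hc).2
      rw [map_add, degree_single] at this
      omega
    rw [sqTrialLim, if_neg hs, mul_zero, zero_add]
    by_cases h0 : μ (-q) = 0
    · rw [h0, Nat.cast_zero, Real.sqrt_zero, mul_zero, zero_mul, abs_zero]; positivity
    have hd := degree_sub_single (Nat.pos_of_ne_zero h0)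
    rw [abs_mul, abs_mul, abs_of_pos hB, abs_of_nonneg (Real.sqrt_nonneg _)]
    have a1 : Real.sqrt (μ (-q)) ≤ Real.sqrt (K + 2) := by
      apply Real.sqrt_le_sqrt
      have := (Finsupp.le_degree (-q) μ).trans hμ2
      exact_mod_cast this
    have a2 : |if μ - Finsupp.single (-q) 1 ∈ configs j m (K + 1) then
        amplitude L c j m (μ - Finsupp.single (-q) 1) else 0| ≤ T ^ K := by
      split_ifs
      · refine (h.abs_amplitude_le hT0 hT
          ((Finsupp.support_mono tsub_le_self).trans hμ1)).trans ?_
        exact pow_le_pow_of_le_one hT0.le hT1.le (by omega)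
      · rw [abs_zero]; positivity
    gcongr

/-- The number of configurations grows polynomially in the cutoff, while the squared boundary
amplitudes decay like `T ^ (2K)`. -/
theorem Admissible.sqOp_trial_small (h : Admissible L c j m) {l : ℕ} (hl : l ∈ Finset.Icc 1 m)
    {q : Mode d} (hq : q = j l ∨ q = -j l) {δ : ℝ} (hδ : 0 < δ) :
    ∀ᶠ K : ℕ in atTop, ∀ᶠ N : ℕ in atTop,
      (1 / N : ℝ) * ‖toFock (sqOp (bogA L c (j l)) (bogB L c (j l)) q
        (trial L c N j m (K + 1)))‖ ^ 2 ≤ δ := by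
  obtain ⟨T, hT0, hT1, hT⟩ := h.exists_rate
  have hB := h.bogB_pos hl
  set P := (pairModes j m).card
  have hlim : Tendsto (fun K : ℕ => bogB L c (j l) ^ 2 / (T ^ 2) ^ 3 *
      (((K + 3 : ℕ) : ℝ) ^ (P + 1) * (T ^ 2) ^ (K + 3))) atTop (𝓝 0) := by
    have h1 := tendsto_pow_const_mul_const_pow_of_abs_lt_one (P + 1) (r := T ^ 2) (by
      rw [abs_of_pos (by positivity)]; exact pow_lt_one₀ hT0.le hT1 two_ne_zero)
    have h2 := ((h1.comp (tendsto_add_atTop_nat 3)).const_mul (bogB L c (j l) ^ 2 / (T ^ 2) ^ 3))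
    rw [mul_zero] at h2
    exact h2
  filter_upwards [hlim.eventually_lt_const hδ] with K hK
  refine ((h.tendsto_sqOp_trial (bogA L c (j l)) (bogB L c (j l))
    (mem_pairModes.2 ⟨l, hl, hq⟩) (K + 1)).eventually_lt_const
    (lt_of_le_of_lt ?_ hK)).mono fun N hN => hN.le
  calc ∑ μ ∈ configs j m (K + 1 + 1),
        sqTrialLim L c j m (K + 1) (bogA L c (j l)) (bogB L c (j l)) q μ ^ 2
      ≤ ∑ μ ∈ configs j m (K + 1 + 1), (bogB L c (j l) * Real.sqrt (K + 2) * T ^ K) ^ 2 := by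
        refine Finset.sum_le_sum fun μ hμ => ?_
        rw [← sq_abs]
        exact pow_le_pow_left₀ (abs_nonneg _) (h.abs_sqTrialLim_le hT0 hT1 hT hl hq K hμ) 2
    _ = (configs j m (K + 1 + 1)).card * (bogB L c (j l) ^ 2 * (K + 2) * (T ^ 2) ^ K) := by
        rw [Finset.sum_const, nsmul_eq_mul, mul_pow, mul_pow, Real.sq_sqrt (by positivity),
          ← pow_mul, ← pow_mul, mul_comm K 2]
    _ ≤ ((K + 3 : ℕ) : ℝ) ^ P * (bogB L c (j l) ^ 2 * ((K + 3 : ℕ) : ℝ) * (T ^ 2) ^ K) := by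
        have a1 : ((configs j m (K + 1 + 1)).card : ℝ) ≤ ((K + 3 : ℕ) : ℝ) ^ P := by
          exact_mod_cast card_configs_le j m (K + 1 + 1)
        have a2 : (K : ℝ) + 2 ≤ ((K + 3 : ℕ) : ℝ) := by push_cast; linarith
        gcongr
    _ = _ := by
        rw [pow_succ _ P, pow_add (T ^ 2) K 3]
        field_simp

theorem kSq_zero (L : ℝ) : kSq L (0 : Mode d) = 0 := by simp [kSq]

theorem trial_mem {K N : ℕ} (hN : K ≤ N) :
    trial L c N j m K ∈ nParticle d N := by
  rw [mem_nParticle]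
  intro n hn
  have : ∃ ν ∈ configs j m K, fillZero N ν = n := by
    by_contra! hc
    exact hn (trial_apply_of_notMem hc)
  obtain ⟨ν, hν, rfl⟩ := this
  exact degree_fillZero ((mem_configs.1 hν).2.trans hN)

theorem zero_mem_configs (j : ℕ → Mode d) (m K : ℕ) : 0 ∈ configs j m K := by
  simp [mem_configs]

theorem Admissible.trial_apply_vac (h : Admissible L c j m) (K N : ℕ) :
    trial L c N j m K (fillZero N 0) = 1 := by
  rw [h.trial_apply (zero_mem_configs j m K), amplitude_zero, Complex.ofReal_one]

theorem Admissible.one_le_norm_trial (h : Admissible L c j m) (K N : ℕ) :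
    1 ≤ ‖toFock (trial L c N j m K)‖ := by
  have := norm_apply_le (trial L c N j m K) (fillZero N 0)
  rwa [h.trial_apply_vac, norm_one] at this

/-- At most `K` particles are excited and none lies outside the selected modes, so the diagonal
remainder deviates from `∑ E^Bog` by `O(1/N)` only, with a constant depending on `K`. -/
theorem Admissible.rest_trial_le (h : Admissible L c j m) (K : ℕ) : ∃ C : ℝ, ∀ N : ℕ, 0 < N →
    K ≤ N → wsum (fun n => kinRest L j m n +
        ∑ l ∈ Finset.Icc 1 m, sqRest (kSq L (j l)) (c (j l)) (bogA L c (j l) ^ 2)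
          (bogB L c (j l) ^ 2) N (j l) n) (trial L c N j m K)
      ≤ (eBogSum L c j m + C / N) * ‖toFock (trial L c N j m K)‖ ^ 2 := by
  refine ⟨∑ l ∈ Finset.Icc 1 m, (kSq L (j l) * K * K + 2 * rootB (c (j l)) (kSq L (j l)) * K), ?_⟩
  intro N hN hKN
  have hN' : (0 : ℝ) < N := by exact_mod_cast hN
  rw [← wsum_const]
  refine wsum_mono fun n hn => ?_
  have : ∃ ν ∈ configs j m K, fillZero N ν = n := by
    by_contra! hc
    exact hn (trial_apply_of_notMem hc)
  obtain ⟨μ, hμ, rfl⟩ := this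
  obtain ⟨hμ1, hμ2⟩ := mem_configs.1 hμ
  have hk0 : kinRest L j m (fillZero N μ) = 0 := by
    classical
    unfold kinRest
    apply Finset.sum_eq_zero
    intro q hq
    simp only [Finset.mem_filter] at hq
    by_cases h0 : q = 0
    · rw [h0, kSq_zero, zero_mul]
    · rw [fillZero_apply_ne N μ h0, Finsupp.notMem_support_iff.1, Nat.cast_zero, mul_zero]
      exact fun h' => hq.2 (mem_pairModes.1 (hμ1 h'))
  rw [hk0, zero_add, eBogSum, Finset.sum_div, ← Finset.sum_add_distrib]
  refine Finset.sum_le_sum fun l hl => ?_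
  have hk := h.kSq_pos hl
  have hφ := h.pos l hl
  have hB := rootB_pos hφ hk
  have hA := rootA_pos hφ hk
  have hs := rootA_add_rootB (c (j l)) (kSq L (j l))
  have h0 := h.zero_add_pairNum_le hl (fillZero N μ)
  rw [degree_fillZero (hμ2.trans hKN), fillZero_apply_zero N (h.apply_zero hμ1),
    Nat.cast_sub (hμ2.trans hKN)] at h0
  have hd : (μ.degree : ℝ) ≤ K := by exact_mod_cast hμ2
  rw [EBog_eq, bogA, bogB, Real.sq_sqrt hA.le, Real.sq_sqrt hB.le, sqRest,
    fillZero_apply_zero N (h.apply_zero hμ1), Nat.cast_sub (hμ2.trans hKN)]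
  unfold pairNum at h0
  have hx0 : (0 : ℝ) ≤ (fillZero N μ (j l) : ℝ) + fillZero N μ (-j l) := by positivity
  set x : ℝ := (fillZero N μ (j l) : ℝ) + fillZero N μ (-j l)
  set A := rootA (c (j l)) (kSq L (j l))
  set B := rootB (c (j l)) (kSq L (j l))
  set k := kSq L (j l)
  rw [show c (j l) - A - B = -k by linarith]
  set D : ℝ := (μ.degree : ℝ)
  have hD0 : 0 ≤ D := by positivity
  have hxK : x ≤ K := by linarith
  have key : -(2 * B) + (k * K * K + 2 * B * K) / N
      - (k * x + -k * (N - D) * x / N - A * x / N - 2 * B * (N - D) / N)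
      = (k * (K * K - D * x) + 2 * B * (K - D) + A * x) / N := by
    field_simp; ring
  have : 0 ≤ (k * (K * K - D * x) + 2 * B * (K - D) + A * x) / N := by
    have : 0 ≤ K * K - D * x := by
      have := mul_le_mul hd hxK hx0 (by positivity)
      linarith
    have : 0 ≤ (K : ℝ) - D := by linarith
    positivity
  linarith

/-- The energy of the trial state. -/
theorem Admissible.trial_energy (h : Admissible L c j m) {δ : ℝ} (hδ : 0 < δ) :
    ∃ K, ∀ᶠ N : ℕ in atTop,
      (ip (trial L c N j m K) (HBog L c N j m (trial L c N j m K))).re ≤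
        (eBogSum L c j m + δ) * ‖toFock (trial L c N j m K)‖ ^ 2 := by
  -- There are `2m` squares, so together they cost at most `δ/2`; the other half pays for `C/N`. The
  -- `+ 1` keeps the denominator positive for `m = 0`.
  set δ' := δ / (2 * (2 * m + 1)) with hδ'
  have hδ'0 : 0 < δ' := by positivity
  have h1 : ∀ᶠ K : ℕ in atTop, ∀ l ∈ Finset.Icc 1 m, (∀ᶠ N : ℕ in atTop,
      (1 / N : ℝ) * ‖toFock (sqOp (bogA L c (j l)) (bogB L c (j l)) (j l)
        (trial L c N j m (K + 1)))‖ ^ 2 ≤ δ') ∧ (∀ᶠ N : ℕ in atTop,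
      (1 / N : ℝ) * ‖toFock (sqOp (bogA L c (j l)) (bogB L c (j l)) (-j l)
        (trial L c N j m (K + 1)))‖ ^ 2 ≤ δ') := by
    rw [Filter.eventually_all_finset]
    intro l hl
    exact (h.sqOp_trial_small hl (Or.inl rfl) hδ'0).and (h.sqOp_trial_small hl (Or.inr rfl) hδ'0)
  obtain ⟨K, hK⟩ := h1.exists
  obtain ⟨C, hC⟩ := h.rest_trial_le (K + 1)
  refine ⟨K + 1, ?_⟩
  have h2 : ∀ᶠ N : ℕ in atTop, ∀ l ∈ Finset.Icc 1 m,
      (1 / N : ℝ) * ‖toFock (sqOp (bogA L c (j l)) (bogB L c (j l)) (j l)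
        (trial L c N j m (K + 1)))‖ ^ 2 ≤ δ' ∧
      (1 / N : ℝ) * ‖toFock (sqOp (bogA L c (j l)) (bogB L c (j l)) (-j l)
        (trial L c N j m (K + 1)))‖ ^ 2 ≤ δ' := by
    rw [Filter.eventually_all_finset]
    intro l hl
    exact (hK l hl).1.and (hK l hl).2
  have h3 : ∀ᶠ N : ℕ in atTop, C / N ≤ δ / 2 :=
    (tendsto_const_div_atTop_nhds_zero_nat C).eventually_le_const (by positivity)
  filter_upwards [h2, h3, eventually_gt_atTop 0, eventually_ge_atTop (K + 1)] with N e2 e3 e4 e5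
  rw [form_HBog L c N j m h.ne_zero (fun l => bogA L c (j l)) (fun l => bogB L c (j l))
    (fun l hl => two_mul_sqrt_roots (h.pos l hl) (h.kSq_pos hl))]
  have g1 := hC N e4 e5
  have g2 : ∑ l ∈ Finset.Icc 1 m, (1 / N : ℝ) *
      (‖toFock (sqOp (bogA L c (j l)) (bogB L c (j l)) (j l) (trial L c N j m (K + 1)))‖ ^ 2
        + ‖toFock (sqOp (bogA L c (j l)) (bogB L c (j l)) (-j l) (trial L c N j m (K + 1)))‖ ^ 2)
      ≤ δ / 2 := by
    refine (Finset.sum_le_sum (g := fun _ => 2 * δ') fun l hl => ?_).trans ?_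
    · have := e2 l hl
      rw [mul_add]; linarith
    · rw [Finset.sum_const, Nat.card_Icc, Nat.add_sub_cancel, nsmul_eq_mul, hδ']
      rw [show (m : ℝ) * (2 * (δ / (2 * (2 * m + 1)))) = δ / 2 * (2 * m / (2 * m + 1)) by
        field_simp]
      refine mul_le_of_le_one_right (by positivity) ?_
      rw [div_le_one (by positivity)]; linarith
  have g3 : (1 : ℝ) ≤ ‖toFock (trial L c N j m (K + 1))‖ ^ 2 :=
    one_le_pow₀ (h.one_le_norm_trial (K + 1) N)
  have g4 : (eBogSum L c j m + C / N) * ‖toFock (trial L c N j m (K + 1))‖ ^ 2 ≤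
      (eBogSum L c j m + δ / 2) * ‖toFock (trial L c N j m (K + 1))‖ ^ 2 := by gcongr
  have g5 : δ / 2 ≤ δ / 2 * ‖toFock (trial L c N j m (K + 1))‖ ^ 2 :=
    le_mul_of_one_le_right (by positivity) g3
  nlinarith

/-! ### Variational principle for the ground state energy -/

theorem Admissible.bddBelow_formValues (h : Admissible L c j m) {N : ℕ} (hN : 0 < N) :
    BddBelow (formValues N (HBog L c N j m)) := by
  obtain ⟨C, hC⟩ := h.form_ge
  refine ⟨eBogSum L c j m - C / N, ?_⟩
  rintro x ⟨v, hv, hv1, rfl⟩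
  have h1 := hC N hN v hv
  rw [hv1, one_pow, mul_one] at h1
  have h2 : 0 ≤ kMin L * wsum (restNum j m) v :=
    mul_nonneg (kMin_pos h.L_pos).le (wsum_nonneg fun n _ => h.restNum_nonneg n)
  have h3 : 0 ≤ ∑ l ∈ Finset.Icc 1 m, (1 / N : ℝ) *
      (‖toFock (sqOp (bogA L c (j l)) (bogB L c (j l)) (j l) v)‖ ^ 2
        + ‖toFock (sqOp (bogA L c (j l)) (bogB L c (j l)) (-j l) v)‖ ^ 2) :=
    Finset.sum_nonneg fun l _ => by positivity
  linarith

theorem formValue_mem {N : ℕ} {A : Op d} {v : FinFock d} (hv : v ∈ nParticle d N) (h0 : v ≠ 0) :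
    (ip v (A v)).re / ‖toFock v‖ ^ 2 ∈ formValues N A := by
  have hn : ‖toFock v‖ ≠ 0 := fun h' => h0 (norm_toFock_eq_zero.1 h')
  refine ⟨((‖toFock v‖⁻¹ : ℝ) : ℂ) • v, Submodule.smul_mem _ _ hv, ?_, ?_⟩
  · rw [map_smul, norm_smul, Complex.norm_real, norm_inv, norm_norm, inv_mul_cancel₀ hn]
  · rw [map_smul, ip_smul_left, ip_smul_right, Complex.conj_ofReal, ← mul_assoc,
      ← Complex.ofReal_mul, Complex.re_ofReal_mul]
    field_simp

theorem Admissible.zBog_le (h : Admissible L c j m) {δ : ℝ} (hδ : 0 < δ) :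
    ∀ᶠ N : ℕ in atTop, zBog L c N j m ≤ eBogSum L c j m + δ := by
  obtain ⟨K, hK⟩ := h.trial_energy hδ
  filter_upwards [hK, eventually_gt_atTop 0, eventually_ge_atTop K] with N h1 h2 h3
  have hn := h.one_le_norm_trial K N
  have h0 : trial L c N j m K ≠ 0 := by
    intro h'
    rw [h', map_zero, norm_zero] at hn
    linarith
  refine (csInf_le (h.bddBelow_formValues h2) (formValue_mem (trial_mem h3) h0)).trans ?_
  rwa [div_le_iff₀ (by positivity)]

theorem Admissible.zBog_mul_le (h : Admissible L c j m) {N : ℕ} (hN : 0 < N) {v : FinFock d}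
    (hv : v ∈ nParticle d N) :
    zBog L c N j m * ‖toFock v‖ ^ 2 ≤ (ip v (HBog L c N j m v)).re := by
  by_cases h0 : v = 0
  · subst h0; simp [ip_zero_left]
  have hn : 0 < ‖toFock v‖ := lt_of_le_of_ne (norm_nonneg _)
    fun h' => h0 (norm_toFock_eq_zero.1 h'.symm)
  rw [← le_div_iff₀ (by positivity)]
  exact csInf_le (h.bddBelow_formValues hN) (formValue_mem hv h0)

end Bogoliubov

end

noncomputable section

namespace Bogoliubov

open Filter Topology

variable {d : ℕ} {L : ℝ} {c : Mode d → ℝ} {j : ℕ → Mode d} {m : ℕ}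

/-! ## States of low energy -/

/-- Uniformity in `v` comes from compactness of the argument rather than explicit constants: if it
failed for infinitely many `N`, normalized counterexamples would form a sequence contradicting
`Admissible.stability`. The energy error there is the excess of `zBog` over `∑ E^Bog`, which
vanishes in the limit by `Admissible.zBog_le`. -/
theorem Admissible.low_energy_close (h : Admissible L c j m) {δ : ℝ} (hδ : 0 < δ) :
    ∃ K₀, ∀ K ≥ K₀, ∀ᶠ N : ℕ in atTop, ∀ v ∈ nParticle d N,
      (ip v (HBog L c N j m v)).re ≤ zBog L c N j m * ‖toFock v‖ ^ 2 →
      ‖toFock (v - v (fillZero N 0) • trial L c N j m K)‖ ≤ δ * ‖toFock v‖ := by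
  obtain ⟨K₀, hK₀⟩ := h.stability hδ
  refine ⟨K₀, fun K hK => ?_⟩
  by_contra hcon
  rw [not_eventually] at hcon
  set S : Set ℕ := {N | ∃ v ∈ nParticle d N, ‖toFock v‖ = 1 ∧
      (ip v (HBog L c N j m v)).re ≤ zBog L c N j m ∧
      ¬ ‖toFock (v - v (fillZero N 0) • trial L c N j m K)‖ ≤ δ} with hS
  have hfreq : ∃ᶠ N in atTop, N ∈ S := by
    refine hcon.mono fun N hN => ?_
    push Not at hN
    obtain ⟨v, hv, h1, h2⟩ := hN
    have hn : 0 < ‖toFock v‖ := by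
      refine lt_of_le_of_ne (norm_nonneg _) fun h' => ?_
      rw [norm_toFock_eq_zero.1 h'.symm] at h2
      simp at h2
    set a : ℂ := ((‖toFock v‖⁻¹ : ℝ) : ℂ) with ha
    have hna : ‖a‖ = ‖toFock v‖⁻¹ := by
      rw [ha, Complex.norm_real, norm_inv, norm_norm]
    refine ⟨a • v, Submodule.smul_mem _ _ hv, ?_, ?_, ?_⟩
    · rw [map_smul, norm_smul, hna, inv_mul_cancel₀ hn.ne']
    · rw [map_smul, ip_smul_left, ip_smul_right, ha, Complex.conj_ofReal, ← mul_assoc,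
        ← Complex.ofReal_mul, Complex.re_ofReal_mul]
      calc ‖toFock v‖⁻¹ * ‖toFock v‖⁻¹ * (ip v (HBog L c N j m v)).re
          ≤ ‖toFock v‖⁻¹ * ‖toFock v‖⁻¹ * (zBog L c N j m * ‖toFock v‖ ^ 2) := by gcongr
        _ = _ := by field_simp
    · rw [Finsupp.smul_apply, smul_assoc, ← smul_sub, map_smul, norm_smul, hna, not_le]
      rw [← div_eq_inv_mul, lt_div_iff₀ hn]
      exact h2
  -- The subsequence of bad particle numbers is encoded as a filter; stability along it and
  -- membership in `S` must then hold at a common `N`.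
  have hne : (atTop ⊓ 𝓟 S).NeBot := frequently_mem_iff_neBot.1 hfreq
  choose! v hv using fun N (hN : N ∈ S) => hN
  have hmem : ∀ᶠ N in atTop ⊓ 𝓟 S, N ∈ S := mem_inf_of_right (mem_principal_self S)
  have herr : Tendsto (fun N => max 0 (zBog L c N j m - eBogSum L c j m)) (atTop ⊓ 𝓟 S) (𝓝 0) := by
    refine Tendsto.mono_left ?_ inf_le_left
    rw [Metric.tendsto_nhds]
    intro ε hε
    filter_upwards [h.zBog_le (half_pos hε)] with N hN
    rw [Real.dist_eq, sub_zero, abs_of_nonneg (le_max_left _ _), max_lt_iff]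
    exact ⟨hε, by linarith⟩
  have := hK₀ K hK (atTop ⊓ 𝓟 S) inf_le_left v _ (hmem.mono fun N hN => (hv N hN).1)
    (hmem.mono fun N hN => (hv N hN).2.1.le) herr (hmem.mono fun N hN => by
      have h1 := (hv N hN).2.2.1
      rw [(hv N hN).2.1]
      have := le_max_right 0 (zBog L c N j m - eBogSum L c j m)
      linarith)
  obtain ⟨N, h1, h2⟩ := (this.and hmem).exists
  exact (hv N h2).2.2.2 h1

theorem Admissible.norm_trial_sq (h : Admissible L c j m) (N K : ℕ) :
    ‖toFock (trial L c N j m K)‖ ^ 2 = ∑ μ ∈ configs j m K, amplitude L c j m μ ^ 2 := by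
  classical
  have hT : (trial L c N j m K).support ⊆ (configs j m K).image (fillZero N) := by
    intro n hn
    by_contra hc
    refine Finsupp.mem_support_iff.1 hn (trial_apply_of_notMem fun μ hμ he => hc ?_)
    exact Finset.mem_image.2 ⟨μ, hμ, he⟩
  rw [norm_sq_eq_wsum, wsum_eq_sum _ _ _ hT, Finset.sum_image]
  · refine Finset.sum_congr rfl fun μ hμ => ?_
    rw [h.trial_apply hμ, Complex.norm_real, Real.norm_eq_abs, sq_abs, one_mul]
  · intro μ hμ ν hν
    exact fillZero_injective (h.apply_zero (mem_configs.1 hμ).1)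
      (h.apply_zero (mem_configs.1 hν).1)

theorem Admissible.norm_trial_eq (h : Admissible L c j m) (N N' K : ℕ) :
    ‖toFock (trial L c N j m K)‖ = ‖toFock (trial L c N' j m K)‖ := by
  rw [← Real.sqrt_sq (norm_nonneg (toFock (trial L c N j m K))), h.norm_trial_sq,
    ← h.norm_trial_sq N', Real.sqrt_sq (norm_nonneg _)]

/-- States of low energy have a sizeable component without excitations. -/
theorem Admissible.low_energy_vac (h : Admissible L c j m) :
    ∃ R : ℝ, 0 < R ∧ ∀ᶠ N : ℕ in atTop, ∀ v ∈ nParticle d N,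
      (ip v (HBog L c N j m v)).re ≤ zBog L c N j m * ‖toFock v‖ ^ 2 →
      ‖toFock v‖ ≤ R * ‖v (fillZero N 0)‖ := by
  obtain ⟨K, hK⟩ := h.low_energy_close (show (0 : ℝ) < 1 / 2 by norm_num)
  have h1 := h.one_le_norm_trial K 0
  refine ⟨2 * ‖toFock (trial L c 0 j m K)‖, by positivity, ?_⟩
  filter_upwards [hK K le_rfl] with N hN v hv hlow
  have h2 := hN v hv hlow
  have h3 : ‖toFock v‖ ≤ ‖toFock (v - v (fillZero N 0) • trial L c N j m K)‖ +
      ‖toFock (v (fillZero N 0) • trial L c N j m K)‖ := by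
    rw [map_sub]
    calc ‖toFock v‖ = ‖(toFock v - toFock (v (fillZero N 0) • trial L c N j m K)) +
          toFock (v (fillZero N 0) • trial L c N j m K)‖ := by rw [sub_add_cancel]
      _ ≤ _ := norm_add_le _ _
  rw [map_smul, norm_smul, h.norm_trial_eq N 0] at h3
  linarith

/-! ## Matrix elements -/

/-- The relation between `n` and `n'` is written with sums only, so that later comparisons of
occupation numbers avoid truncated subtraction. -/
theorem W_moves {N : ℕ} {q : Mode d} {v : FinFock d} {n : Occ d} (hn : W c N q v n ≠ 0) :
    ∃ n', v n' ≠ 0 ∧ n + Finsupp.single q 1 + Finsupp.single (-q) 1 =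
      n' + Finsupp.single 0 1 + Finsupp.single 0 1 := by
  simp only [W, LinearMap.smul_apply, Module.End.mul_apply, Finsupp.smul_apply, cre_apply,
    ann_apply, smul_eq_mul, ne_eq, mul_eq_zero, not_or, Complex.ofReal_eq_zero] at hn
  obtain ⟨-, h1, h2, -, -, h3⟩ := hn
  have a1 : n 0 ≠ 0 := by rintro h; simp [h] at h1
  have a2 : (n - Finsupp.single 0 1 : Occ d) 0 ≠ 0 := by intro h; rw [h] at h2; simp at h2
  refine ⟨_, h3, ?_⟩
  have b1 : Finsupp.single 0 1 ≤ n := by rw [Finsupp.single_le_iff]; omega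
  have b2 : Finsupp.single 0 1 ≤ (n - Finsupp.single 0 1 : Occ d) := by
    rw [Finsupp.single_le_iff]; omega
  conv_lhs => rw [← tsub_add_cancel_of_le b1, ← tsub_add_cancel_of_le b2]
  ac_rfl

theorem Wstar_moves {N : ℕ} {q : Mode d} {v : FinFock d} {n : Occ d} (hn : Wstar c N q v n ≠ 0) :
    ∃ n', v n' ≠ 0 ∧ n + Finsupp.single 0 1 + Finsupp.single 0 1 =
      n' + Finsupp.single q 1 + Finsupp.single (-q) 1 := by
  simp only [Wstar, LinearMap.smul_apply, Module.End.mul_apply, Finsupp.smul_apply, cre_apply,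
    ann_apply, smul_eq_mul, ne_eq, mul_eq_zero, not_or, Complex.ofReal_eq_zero] at hn
  obtain ⟨-, -, -, h1, h2, h3⟩ := hn
  set p := n + Finsupp.single 0 1 + Finsupp.single 0 1
  have a1 : p q ≠ 0 := by rintro h; simp [h] at h1
  have a2 : (p - Finsupp.single q 1 : Occ d) (-q) ≠ 0 := by intro h; rw [h] at h2; simp at h2
  refine ⟨_, h3, ?_⟩
  have b1 : Finsupp.single q 1 ≤ p := by rw [Finsupp.single_le_iff]; omega
  have b2 : Finsupp.single (-q) 1 ≤ (p - Finsupp.single q 1 : Occ d) := by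
    rw [Finsupp.single_le_iff]; omega
  conv_lhs => rw [← tsub_add_cancel_of_le b1, ← tsub_add_cancel_of_le b2]
  ac_rfl

/-- The `n`-th component after applying the interaction of the modes `±q` stems from components
with two particles moved between the zero mode and the modes `±q`. -/
def PairMove (q : Mode d) (n n' : Occ d) : Prop :=
  n + Finsupp.single q 1 + Finsupp.single (-q) 1 = n' + Finsupp.single 0 1 + Finsupp.single 0 1 ∨
  n + Finsupp.single 0 1 + Finsupp.single 0 1 = n' + Finsupp.single q 1 + Finsupp.single (-q) 1

theorem PairMove.degree {q : Mode d} {n n' : Occ d} (h : PairMove q n n') :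
    n.degree = n'.degree := by
  rcases h with h | h <;>
  · have := congrArg Finsupp.degree h
    simp only [map_add, degree_single] at this
    omega

theorem PairMove.support {q : Mode d} {n n' : Occ d} (h : PairMove q n n') {F : Finset (Mode d)}
    (h0 : 0 ∈ F) (hq : q ∈ F) (hq' : -q ∈ F) (hn' : n'.support ⊆ F) : n.support ⊆ F := by
  have key : ∀ p ∉ F, n p = n' p := by
    classical
    intro p hp
    have e : ∀ r ∈ F, (Finsupp.single r 1 : Occ d) p = 0 := by
      intro r hr
      rw [Finsupp.single_apply, if_neg]
      rintro rfl; exact hp hr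
    rcases h with h | h <;>
    · have := DFunLike.congr_fun h p
      simp only [Finsupp.add_apply, e 0 h0, e q hq, e (-q) hq'] at this
      omega
  intro p hp
  by_contra hpF
  rw [Finsupp.mem_support_iff, key p hpF] at hp
  exact hpF (hn' (Finsupp.mem_support_iff.2 hp))

theorem apply_add_ne {A B : Op d} {v : FinFock d} {n : Occ d} (h : (A + B) v n ≠ 0) :
    A v n ≠ 0 ∨ B v n ≠ 0 := by
  by_contra! hc
  apply h
  rw [LinearMap.add_apply, Finsupp.add_apply, hc.1, hc.2, add_zero]

theorem diag_moves {g : Occ d → ℂ} {v : FinFock d} {n : Occ d} (h : diag g v n ≠ 0) : v n ≠ 0 := by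
  rw [diag_apply] at h
  exact right_ne_zero_of_mul h

theorem HhatBog_moves {N : ℕ} {q : Mode d} {v : FinFock d} {n : Occ d}
    (hn : HhatBog L c N q v n ≠ 0) : ∃ n', v n' ≠ 0 ∧ (n = n' ∨ PairMove q n n') := by
  rw [HhatBog, H0_eq_diag] at hn
  rcases apply_add_ne hn with h1 | h1
  · rcases apply_add_ne h1 with h2 | h2
    · exact ⟨n, diag_moves h2, Or.inl rfl⟩
    · obtain ⟨n', h3, h4⟩ := W_moves h2
      exact ⟨n', h3, Or.inr (Or.inl h4)⟩
  · obtain ⟨n', h3, h4⟩ := Wstar_moves h1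
    exact ⟨n', h3, Or.inr (Or.inr h4)⟩

theorem HBog_moves {N : ℕ} {v : FinFock d} {n : Occ d} (hn : HBog L c N j m v n ≠ 0) :
    ∃ n', v n' ≠ 0 ∧ (n = n' ∨ ∃ l ∈ Finset.Icc 1 m, PairMove (j l) n n') := by
  rw [HBog, freeKin_eq_diag] at hn
  rcases apply_add_ne hn with h1 | h1
  · exact ⟨n, diag_moves h1, Or.inl rfl⟩
  · rw [LinearMap.sum_apply, Finsupp.finsetSum_apply] at h1
    obtain ⟨l, hl, h2⟩ := Finset.exists_ne_zero_of_sum_ne_zero h1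
    obtain ⟨n', h3, h4⟩ := HhatBog_moves h2
    exact ⟨n', h3, h4.imp_right fun h5 => ⟨l, hl, h5⟩⟩

/-! ## Finite dimensional invariant subspaces -/

/-- States of `D` particles in the modes in `F`. -/
def sector (F : Finset (Mode d)) (D : ℕ) : Submodule ℂ (FinFock d) :=
  Finsupp.supported ℂ ℂ {n : Occ d | n.support ⊆ F ∧ n.degree = D}

theorem mem_sector {F : Finset (Mode d)} {D : ℕ} {v : FinFock d} :
    v ∈ sector F D ↔ ∀ n, v n ≠ 0 → n.support ⊆ F ∧ n.degree = D := by
  rw [sector, Finsupp.mem_supported]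
  simp [Set.subset_def]

theorem sector_le_nParticle (F : Finset (Mode d)) (D : ℕ) : sector F D ≤ nParticle d D := by
  intro v hv
  rw [mem_nParticle]
  exact fun n hn => (mem_sector.1 hv n hn).2

instance finiteDimensional_sector (F : Finset (Mode d)) (D : ℕ) :
    FiniteDimensional ℂ (sector F D) := by
  have hfin : {n : Occ d | n.support ⊆ F ∧ n.degree = D}.Finite := by
    refine (Finset.finite_toSet (Finset.finsuppAntidiag F D)).subset ?_
    rintro n ⟨h1, h2⟩
    rw [Finset.mem_coe, Finset.mem_finsuppAntidiag]
    exact ⟨by rw [← degree_eq_sum h1, h2], h1⟩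
  have := hfin.to_subtype
  exact Module.Finite.equiv (Finsupp.supportedEquivFinsupp (M := ℂ) (R := ℂ)
    {n : Occ d | n.support ⊆ F ∧ n.degree = D}).symm

/-- The operators which leave invariant all sectors with modes containing `F₀`. -/
def sectorAlg (F₀ : Finset (Mode d)) : Subalgebra ℂ (Op d) where
  carrier := {T | ∀ F, F₀ ⊆ F → ∀ D, ∀ v ∈ sector F D, T v ∈ sector F D}
  mul_mem' := fun hA hB F hF D v hv => hA F hF D _ (hB F hF D v hv)
  add_mem' := fun hA hB F hF D v hv => Submodule.add_mem _ (hA F hF D v hv) (hB F hF D v hv)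
  algebraMap_mem' := fun a F _ D v hv => by
    rw [Module.algebraMap_end_apply]
    exact Submodule.smul_mem _ _ hv

theorem mem_sectorAlg {F₀ : Finset (Mode d)} {T : Op d} :
    T ∈ sectorAlg F₀ ↔ ∀ F, F₀ ⊆ F → ∀ D, ∀ v ∈ sector F D, T v ∈ sector F D := Iff.rfl

theorem proj_mem_sectorAlg (F₀ : Finset (Mode d)) (p : Occ d → Prop) : proj p ∈ sectorAlg F₀ := by
  classical
  rw [mem_sectorAlg]
  intro F _ D v hv
  rw [mem_sector] at hv ⊢
  intro n hn
  rw [proj_apply] at hn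
  split_ifs at hn
  · exact hv n hn
  · exact absurd rfl hn

theorem HBog_mem_sectorAlg (L : ℝ) (c : Mode d → ℝ) (N : ℕ) (j : ℕ → Mode d) (m : ℕ) :
    HBog L c N j m ∈ sectorAlg (insert 0 (pairModes j m)) := by
  rw [mem_sectorAlg]
  intro F hF D v hv
  rw [mem_sector] at hv ⊢
  intro n hn
  obtain ⟨n', h1, h2⟩ := HBog_moves hn
  obtain ⟨h3, h4⟩ := hv n' h1
  rcases h2 with rfl | ⟨l, hl, h2⟩
  · exact ⟨h3, h4⟩
  · refine ⟨h2.support (hF (by simp)) (hF ?_) (hF ?_) h3, h2.degree.trans h4⟩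
    · exact Finset.mem_insert_of_mem (mem_pairModes.2 ⟨l, hl, Or.inl rfl⟩)
    · exact Finset.mem_insert_of_mem (mem_pairModes.2 ⟨l, hl, Or.inr rfl⟩)

theorem ip_eq_zero_of_disjoint {u v : FinFock d} (h : ∀ n, u n ≠ 0 → v n = 0) : ip u v = 0 := by
  rw [ip_eq_sum u v v.support subset_rfl]
  apply Finset.sum_eq_zero
  intro n hn
  by_cases hu : u n = 0
  · simp [hu]
  · simp [h n hu]

theorem lineProj_apply (ψ v : FinFock d) : lineProj ψ v = ((ip ψ ψ)⁻¹ * ip ψ v) • ψ := by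
  simp [lineProj, ip, smul_smul]

theorem lineProj_mem_sectorAlg {F₀ : Finset (Mode d)} {N : ℕ} {ψ : FinFock d}
    (hψ : ψ ∈ sector F₀ N) : lineProj ψ ∈ sectorAlg F₀ := by
  rw [mem_sectorAlg]
  intro F hF D v hv
  rw [lineProj_apply]
  by_cases hD : D = N
  · subst hD
    refine Submodule.smul_mem _ _ (mem_sector.2 fun n hn => ?_)
    obtain ⟨h1, h2⟩ := mem_sector.1 hψ n hn
    exact ⟨h1.trans hF, h2⟩
  · have h0 : ip ψ v = 0 := by
      apply ip_eq_zero_of_disjoint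
      intro n hn
      by_contra hv'
      exact hD ((mem_sector.1 hv n hv').2.symm.trans (mem_sector.1 hψ n hn).2)
    rw [h0, mul_zero, zero_smul]
    exact Submodule.zero_mem _

theorem exists_mem_sector_ket (F₀ : Finset (Mode d)) (n : Occ d) :
    ∃ F, F₀ ⊆ F ∧ ket n ∈ sector F n.degree := by
  classical
  refine ⟨F₀ ∪ n.support, Finset.subset_union_left, mem_sector.2 fun k hk => ?_⟩
  rw [ket_apply] at hk
  have : n = k := by by_contra hne; simp [hne] at hk
  subst this
  exact ⟨Finset.subset_union_right, rfl⟩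

theorem surjOn_sector {F₀ : Finset (Mode d)} {T : Op d} (hT : T ∈ sectorAlg F₀)
    (hinj : Function.Injective T) {F : Finset (Mode d)} (hF : F₀ ⊆ F) {D : ℕ} {v : FinFock d}
    (hv : v ∈ sector F D) : ∃ u ∈ sector F D, T u = v := by
  have hr : ∀ x ∈ sector F D, T x ∈ sector F D := hT F hF D
  have hs : Function.Surjective (T.restrict hr) := by
    refine (LinearMap.injective_iff_surjective (K := ℂ) (V := sector F D)
      (f := T.restrict hr)).1 fun x y hxy => ?_
    exact Subtype.ext (hinj (congrArg Subtype.val hxy))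
  obtain ⟨u, hu⟩ := hs ⟨v, hv⟩
  exact ⟨u, u.2, congrArg Subtype.val hu⟩

/-- `FinFock` is infinite dimensional, but each ket lies in a finite dimensional sector preserved by
`T`, where injective implies surjective. -/
theorem isUnit_of_injective {F₀ : Finset (Mode d)} {T : Op d} (hT : T ∈ sectorAlg F₀)
    (hinj : ∀ v, T v = 0 → v = 0) : IsUnit T := by
  have hinj' : Function.Injective T := (injective_iff_map_eq_zero T).2 hinj
  rw [Module.End.isUnit_iff]
  refine ⟨hinj', fun v => ?_⟩
  induction v using Finsupp.induction_linear with
  | zero => exact ⟨0, map_zero T⟩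
  | add u v hu hv =>
    obtain ⟨x, rfl⟩ := hu
    obtain ⟨y, rfl⟩ := hv
    exact ⟨x + y, map_add T x y⟩
  | single n a =>
    obtain ⟨F, hF, hk⟩ := exists_mem_sector_ket F₀ n
    obtain ⟨u, -, hu⟩ := surjOn_sector hT hinj' hF hk
    exact ⟨a • u, by rw [map_smul, hu, single_eq_smul_ket]⟩

/-- A vector of a sector has its preimage in the same sector by finite dimensionality. For a
non-unit `Ring.inverse` is `0`, so no invertibility has to be assumed. -/
theorem inverse_mem_sectorAlg {F₀ : Finset (Mode d)} {T : Op d} (hT : T ∈ sectorAlg F₀) :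
    Ring.inverse T ∈ sectorAlg F₀ := by
  by_cases hu : IsUnit T
  · have hinj : Function.Injective T := ((Module.End.isUnit_iff T).1 hu).1
    rw [mem_sectorAlg]
    intro F hF D v hv
    obtain ⟨u, hu1, rfl⟩ := surjOn_sector hT hinj hF hv
    rw [← Module.End.mul_apply, Ring.inverse_mul_cancel T hu]
    exact hu1
  · rw [Ring.inverse_non_unit T hu]
    exact Subalgebra.zero_mem _

/-! ## Existence of the ground state -/

/-- The quadratic form is continuous on the compact unit sphere of a finite dimensional space;
homogeneity extends the bound from the sphere to `S`. -/
theorem exists_form_min (S : Submodule ℂ (FinFock d)) [FiniteDimensional ℂ S] (A : Op d)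
    (hS : ∃ v ∈ S, v ≠ 0) :
    ∃ v ∈ S, ‖toFock v‖ = 1 ∧ ∀ u ∈ S, (ip v (A v)).re * ‖toFock u‖ ^ 2 ≤ (ip u (A u)).re := by
  set S' := S.map (toFock (d := d)) with hS'
  have hfd : FiniteDimensional ℂ S' := inferInstance
  have : ProperSpace S' := FiniteDimensional.proper ℂ S'
  let e : S ≃ₗ[ℂ] S' := Submodule.equivMapOfInjective toFock toFock_injective S
  have he : ∀ x : S', toFock (e.symm x : FinFock d) = x := fun x => by
    have := congrArg Subtype.val (e.apply_symm_apply x)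
    exact this
  let g : S' → ℝ := fun x => (ip (e.symm x : FinFock d) (A (e.symm x))).re
  have hg : Continuous g := by
    have h1 : Continuous (((toFock (d := d)) ∘ₗ A ∘ₗ S.subtype) ∘ₗ e.symm.toLinearMap) :=
      LinearMap.continuous_of_finiteDimensional _
    have h2 : g = fun x : S' => (inner ℂ (x : Fock d)
        ((((toFock (d := d)) ∘ₗ A ∘ₗ S.subtype) ∘ₗ e.symm.toLinearMap) x)).re := by
      funext x
      simp only [g, ip, he]
      rfl
    rw [h2]
    exact Complex.continuous_re.comp (continuous_subtype_val.inner h1)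
  obtain ⟨v₀, hv₀, hv₀'⟩ := hS
  have hnt : Nontrivial S' := by
    refine ⟨⟨e ⟨v₀, hv₀⟩, 0, fun h' => hv₀' ?_⟩⟩
    have := (LinearEquiv.map_eq_zero_iff e).1 h'
    exact congrArg Subtype.val this
  obtain ⟨x, hx, hmin⟩ := (isCompact_sphere (0 : S') 1).exists_isMinOn
    (NormedSpace.sphere_nonempty.2 zero_le_one) hg.continuousOn
  have hx1 : ‖x‖ = 1 := by simpa using hx
  refine ⟨e.symm x, (e.symm x).2, ?_, ?_⟩
  · rw [he]; exact hx1
  · intro u hu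
    by_cases h0 : u = 0
    · subst h0; simp [ip_zero_left]
    have hn : 0 < ‖toFock u‖ := lt_of_le_of_ne (norm_nonneg _)
      fun h' => h0 (norm_toFock_eq_zero.1 h'.symm)
    set a : ℂ := ((‖toFock u‖⁻¹ : ℝ) : ℂ) with ha
    have hna : ‖a‖ = ‖toFock u‖⁻¹ := by
      rw [ha, Complex.norm_real, norm_inv, norm_norm]
    set y : S' := e (a • ⟨u, hu⟩) with hy
    have hey : (e.symm y : FinFock d) = a • u := by
      rw [hy, e.symm_apply_apply]; rfl
    have hy1 : ‖y‖ = 1 := by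
      have h1 : ‖y‖ = ‖toFock (e.symm y : FinFock d)‖ := by rw [he]; rfl
      rw [h1, hey, map_smul, norm_smul, hna, inv_mul_cancel₀ hn.ne']
    have h1 : g x ≤ g y := hmin (by simpa using hy1)
    have h2 : g y = ‖toFock u‖⁻¹ * ‖toFock u‖⁻¹ * (ip u (A u)).re := by
      simp only [g]
      rw [hey, map_smul, ip_smul_left, ip_smul_right, ha, Complex.conj_ofReal, ← mul_assoc,
        ← Complex.ofReal_mul, Complex.re_ofReal_mul]
    rw [h2] at h1
    calc (ip (e.symm x : FinFock d) (A (e.symm x))).re * ‖toFock u‖ ^ 2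
        ≤ ‖toFock u‖⁻¹ * ‖toFock u‖⁻¹ * (ip u (A u)).re * ‖toFock u‖ ^ 2 := by gcongr
      _ = _ := by field_simp

/-- First variation: for `B = A - z`, which has nonnegative form on `S` and form at most zero at
`v`, testing with `v + s B v` gives `2s‖Bv‖² + O(s²) ≥ 0` for both signs of `s`, hence `B v = 0`. -/
theorem eigen_of_form_min {S : Submodule ℂ (FinFock d)} {A : Op d} (hA : IsAdj A A)
    (hS : ∀ v ∈ S, A v ∈ S) {z : ℝ} (hz : ∀ u ∈ S, z * ‖toFock u‖ ^ 2 ≤ (ip u (A u)).re)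
    {v : FinFock d} (hv : v ∈ S) (hvz : (ip v (A v)).re ≤ z * ‖toFock v‖ ^ 2) :
    A v = (z : ℂ) • v := by
  set B : Op d := A - (z : ℂ) • 1 with hB
  have hBadj : IsAdj B B := hA.sub (IsAdj.one.real_smul z)
  have hform : ∀ u, (ip u (B u)).re = (ip u (A u)).re - z * ‖toFock u‖ ^ 2 := by
    intro u
    rw [hB, LinearMap.sub_apply, LinearMap.smul_apply, Module.End.one_apply, ip_sub_right,
      ip_smul_right, ip_self, ← Complex.ofReal_mul, Complex.sub_re, Complex.ofReal_re]
  have hpos : ∀ u ∈ S, 0 ≤ (ip u (B u)).re := fun u hu => by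
    rw [hform]; linarith [hz u hu]
  set w := B v with hw
  have hwS : w ∈ S := by
    rw [hw, hB, LinearMap.sub_apply, LinearMap.smul_apply, Module.End.one_apply]
    exact Submodule.sub_mem _ (hS v hv) (Submodule.smul_mem _ _ hv)
  have hv0 : (ip v (B v)).re ≤ 0 := by rw [hform]; linarith
  set a := (ip w (B w)).re
  have ha : 0 ≤ a := hpos w hwS
  have key : ∀ s : ℝ, 0 ≤ 2 * s * ‖toFock w‖ ^ 2 + s ^ 2 * a := by
    intro s
    have h1 := hpos (v + (s : ℂ) • w) (Submodule.add_mem _ hv (Submodule.smul_mem _ _ hwS))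
    have h2 : ip (v + (s : ℂ) • w) (B (v + (s : ℂ) • w)) =
        ip v (B v) + s * ip w w + s * ip w w + s * s * ip w (B w) := by
      rw [map_add, map_smul, ip_add_left, ip_add_right, ip_add_right, ip_smul_left, ip_smul_left,
        ip_smul_right, ip_smul_right, Complex.conj_ofReal, ← hBadj v w, ← hw]
      ring
    rw [h2, ip_self] at h1
    simp only [Complex.add_re, ← Complex.ofReal_mul, Complex.re_ofReal_mul, Complex.ofReal_re] at h1
    nlinarith
  have hw0 : ‖toFock w‖ ^ 2 ≤ 0 := by
    by_contra hc
    push Not at hc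
    -- Near the minimizer of the quadratic polynomial in `s`; `a + 1` replaces `a`, which may be
    -- zero.
    have := key (-(‖toFock w‖ ^ 2 / (a + 1)))
    have h3 : 0 < a + 1 := by linarith
    have h4 : 2 * -(‖toFock w‖ ^ 2 / (a + 1)) * ‖toFock w‖ ^ 2 +
        (-(‖toFock w‖ ^ 2 / (a + 1))) ^ 2 * a = -(‖toFock w‖ ^ 4 * (a + 2) / (a + 1) ^ 2) := by
      field_simp; ring
    rw [h4] at this
    have h5 : 0 < ‖toFock w‖ ^ 4 * (a + 2) / (a + 1) ^ 2 := by
      have : 0 < ‖toFock w‖ ^ 4 := by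
        have := pow_pos hc 2
        rwa [← pow_mul] at this
      positivity
    linarith
  have hw1 : w = 0 := by
    rw [← norm_toFock_eq_zero]
    exact pow_eq_zero_iff two_ne_zero |>.1 (le_antisymm hw0 (by positivity))
  rw [hw, hB, LinearMap.sub_apply, LinearMap.smul_apply, Module.End.one_apply, sub_eq_zero] at hw1
  exact hw1

theorem HBog_mem_nParticle {N D : ℕ} {v : FinFock d} (hv : v ∈ nParticle d D) :
    HBog L c N j m v ∈ nParticle d D := by
  rw [mem_nParticle] at hv ⊢
  intro n hn
  obtain ⟨n', h1, rfl | ⟨l, -, h2⟩⟩ := HBog_moves hn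
  · exact hv n h1
  · exact h2.degree.trans (hv n' h1)

theorem vac_mem_sector (j : ℕ → Mode d) (m N : ℕ) :
    ket (fillZero N 0) ∈ sector (insert 0 (pairModes j m)) N := by
  classical
  rw [mem_sector]
  intro n hn
  rw [ket_apply] at hn
  have : fillZero N 0 = n := by by_contra hne; simp [hne] at hn
  subst this
  refine ⟨?_, degree_fillZero (by simp)⟩
  rw [fillZero, zero_add]
  exact Finsupp.support_single_subset.trans (by simp)

theorem trial_mem_sector {K N : ℕ} (hN : K ≤ N) :
    trial L c N j m K ∈ sector (insert 0 (pairModes j m)) N := by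
  classical
  rw [mem_sector]
  intro n hn
  have : ∃ ν ∈ configs j m K, fillZero N ν = n := by
    by_contra! hc
    exact hn (trial_apply_of_notMem hc)
  obtain ⟨ν, hν, rfl⟩ := this
  obtain ⟨h1, h2⟩ := mem_configs.1 hν
  refine ⟨Finsupp.support_add.trans (Finset.union_subset (h1.trans (Finset.subset_insert _ _)) ?_),
    degree_fillZero (h2.trans hN)⟩
  exact Finsupp.support_single_subset.trans (by simp)

/-- The infimum defining the ground state energy is attained, for `N` large. -/
theorem Admissible.exists_ground (h : Admissible L c j m) : ∀ᶠ N : ℕ in atTop,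
    ∃ v ∈ sector (insert 0 (pairModes j m)) N, ‖toFock v‖ = 1 ∧
      (ip v (HBog L c N j m v)).re = zBog L c N j m := by
  classical
  have hk := kMin_pos h.L_pos
  obtain ⟨C, hC⟩ := h.form_ge
  -- Half of the gap `kMin` is spent on the trial energy, the other half on `C/N`, so that states
  -- outside the sector lie above its minimum.
  obtain ⟨K, hK⟩ := h.trial_energy (half_pos hk)
  filter_upwards [hK, eventually_gt_atTop 0, eventually_ge_atTop K,
    (tendsto_const_div_atTop_nhds_zero_nat C).eventually_le_const (half_pos hk)] with N h1 h2 h3 h4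
  have hn := h.one_le_norm_trial K N
  have h0 : trial L c N j m K ≠ 0 := by
    intro h'
    rw [h', map_zero, norm_zero] at hn
    linarith
  set S := sector (insert 0 (pairModes j m)) N with hS
  set A := HBog L c N j m
  obtain ⟨v, hv, hv1, hmin⟩ := exists_form_min S A ⟨_, trial_mem_sector h3, h0⟩
  refine ⟨v, hv, hv1, ?_⟩
  set z := (ip v (A v)).re
  have hz1 : z ≤ eBogSum L c j m + kMin L / 2 := by
    have := (hmin _ (trial_mem_sector h3)).trans h1
    exact le_of_mul_le_mul_right this (by positivity)
  -- The infimum ranges over all `N`-particle states, but the part with particles outside the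
  -- selected modes decouples and has energy at least `eBogSum - C/N + kMin`. The minimum over the
  -- finite dimensional sector is therefore global.
  have hall : ∀ u ∈ nParticle d N, z * ‖toFock u‖ ^ 2 ≤ (ip u (A u)).re := by
    intro u hu
    set u₁ := proj (fun n : Occ d => n.support ⊆ insert 0 (pairModes j m)) u with hu₁
    set u₂ := u - u₁ with hu₂
    have hu12 : u = u₁ + u₂ := by rw [hu₂]; abel
    have e1 : ∀ n, u₁ n = if n.support ⊆ insert 0 (pairModes j m) then u n else 0 :=
      fun n => proj_apply _ u n
    have e2 : ∀ n, u₂ n = if n.support ⊆ insert 0 (pairModes j m) then 0 else u n := by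
      intro n
      rw [hu₂, Finsupp.sub_apply, e1]
      split_ifs <;> simp
    have m1 : u₁ ∈ S := by
      rw [hS, mem_sector]
      intro n hn
      rw [e1] at hn
      split_ifs at hn with hs
      · exact ⟨hs, mem_nParticle.1 hu n hn⟩
      · exact absurd rfl hn
    have m2 : u₂ ∈ nParticle d N :=
      Submodule.sub_mem _ hu (sector_le_nParticle _ _ m1)
    have horth : ∀ w ∈ S, ip w u₂ = 0 := by
      intro w hw
      apply ip_eq_zero_of_disjoint
      intro n hn
      rw [e2, if_pos (mem_sector.1 hw n hn).1]
    have hAdj : IsAdj A A := isAdj_HBog L c N j m h.ne_zero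
    have hAS : A u₁ ∈ S := HBog_mem_sectorAlg L c N j m _ subset_rfl N u₁ m1
    have x1 : ip u₁ (A u₂) = 0 := by rw [← hAdj]; exact horth _ hAS
    have x2 : ip u₂ (A u₁) = 0 := by rw [← ip_conj, horth _ hAS, map_zero]
    have hform : (ip u (A u)).re = (ip u₁ (A u₁)).re + (ip u₂ (A u₂)).re := by
      rw [hu12, map_add, ip_add_left, ip_add_right, ip_add_right, x1, x2]
      simp
    have hnorm : ‖toFock u‖ ^ 2 = ‖toFock u₁‖ ^ 2 + ‖toFock u₂‖ ^ 2 := by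
      have y1 := horth _ m1
      have y2 : ip u₂ u₁ = 0 := by rw [← ip_conj, y1, map_zero]
      have : ip u u = ip u₁ u₁ + ip u₂ u₂ := by
        conv_lhs => rw [hu12, ip_add_left, ip_add_right, ip_add_right, y1, y2]
        simp
      rw [ip_self, ip_self, ip_self] at this
      exact_mod_cast this
    have f1 := hmin u₁ m1
    have f2 := hC N h2 u₂ m2
    have f3 : ‖toFock u₂‖ ^ 2 ≤ wsum (restNum j m) u₂ := by
      rw [norm_sq_eq_wsum]
      refine wsum_mono fun n hn => ?_
      rw [e2] at hn
      split_ifs at hn with hs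
      · exact absurd rfl hn
      · obtain ⟨q, hq, hq'⟩ := Finset.not_subset.1 hs
        rw [h.restNum_eq]
        have : (n q : ℝ) ≤ ∑ q ∈ n.support \ insert 0 (pairModes j m), (n q : ℝ) :=
          Finset.single_le_sum (f := fun q => (n q : ℝ)) (fun _ _ => by positivity)
            (Finset.mem_sdiff.2 ⟨hq, hq'⟩)
        refine le_trans ?_ this
        exact_mod_cast Nat.one_le_iff_ne_zero.2 (Finsupp.mem_support_iff.1 hq)
    have f4 : 0 ≤ ∑ l ∈ Finset.Icc 1 m, (1 / N : ℝ) *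
      (‖toFock (sqOp (bogA L c (j l)) (bogB L c (j l)) (j l) u₂)‖ ^ 2
        + ‖toFock (sqOp (bogA L c (j l)) (bogB L c (j l)) (-j l) u₂)‖ ^ 2) :=
      Finset.sum_nonneg fun l _ => by positivity
    have f5 : kMin L * ‖toFock u₂‖ ^ 2 ≤ kMin L * wsum (restNum j m) u₂ := by gcongr
    have f6 : z * ‖toFock u₂‖ ^ 2 ≤ (eBogSum L c j m - C / N + kMin L) * ‖toFock u₂‖ ^ 2 := by
      gcongr
      linarith
    rw [hform, hnorm]
    nlinarith
  apply le_antisymm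
  · refine le_csInf ⟨_, v, sector_le_nParticle _ _ hv, hv1, rfl⟩ ?_
    rintro x ⟨u, hu, hu1, rfl⟩
    have := hall u hu
    rwa [hu1, one_pow, mul_one] at this
  · exact csInf_le (h.bddBelow_formValues h2) ⟨v, sector_le_nParticle _ _ hv, hv1, rfl⟩

end Bogoliubov

end

noncomputable section

namespace Bogoliubov

variable {d : ℕ}

/-! ## The Feshbach–Schur flow -/

/-- `N`-particle states with at most `N - 2 s` particles in the modes `±q`. -/
def lowSpace (N : ℕ) (q : Mode d) (s : ℕ) : Submodule ℂ (FinFock d) :=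
  Finsupp.supported ℂ ℂ {n : Occ d | n.degree = N ∧ n q + n (-q) + 2 * s ≤ N}

theorem mem_lowSpace {N : ℕ} {q : Mode d} {s : ℕ} {v : FinFock d} :
    v ∈ lowSpace N q s ↔ ∀ n, v n ≠ 0 → n.degree = N ∧ n q + n (-q) + 2 * s ≤ N := by
  rw [lowSpace, Finsupp.mem_supported]
  simp [Set.subset_def]

theorem lowSpace_succ_le (N : ℕ) (q : Mode d) (s : ℕ) :
    lowSpace N q (s + 1) ≤ lowSpace N q s := by
  intro v hv
  rw [mem_lowSpace] at hv ⊢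
  intro n hn
  have := hv n hn
  exact ⟨this.1, by omega⟩

theorem lowSpace_le_nParticle (N : ℕ) (q : Mode d) (s : ℕ) : lowSpace N q s ≤ nParticle d N := by
  intro v hv
  rw [mem_nParticle]
  exact fun n hn => (mem_lowSpace.1 hv n hn).1

theorem op_mul_sub (A B C : Op d) : A * (B - C) = A * B - A * C :=
  LinearMap.ext fun v => by simp only [Module.End.mul_apply, LinearMap.sub_apply, map_sub]

theorem op_sub_mul (A B C : Op d) : (A - B) * C = A * C - B * C :=
  LinearMap.ext fun v => by simp only [Module.End.mul_apply, LinearMap.sub_apply]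

theorem op_sub_self (A : Op d) : A - A = 0 :=
  LinearMap.ext fun v => by simp only [LinearMap.sub_apply, sub_self, LinearMap.zero_apply]

theorem op_sub_zero (A : Op d) : A - 0 = A :=
  LinearMap.ext fun v => by simp only [LinearMap.sub_apply, sub_zero, LinearMap.zero_apply]

theorem sub_mem_sectorAlg {F₀ : Finset (Mode d)} {A B : Op d} (hA : A ∈ sectorAlg F₀)
    (hB : B ∈ sectorAlg F₀) : A - B ∈ sectorAlg F₀ := by
  have : A - B = A + (-1 : ℂ) • B := LinearMap.ext fun v => by
    simp only [LinearMap.sub_apply, LinearMap.add_apply, LinearMap.smul_apply, neg_smul, one_smul,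
      sub_eq_add_neg]
  rw [this]
  exact add_mem hA (Subalgebra.smul_mem _ hB _)

theorem proj_mul_self (p : Occ d → Prop) : proj p * proj p = proj p := by
  classical
  refine LinearMap.ext fun v => Finsupp.ext fun n => ?_
  rw [Module.End.mul_apply, proj_apply, proj_apply]
  split_ifs <;> rfl

theorem proj_eq_self {p : Occ d → Prop} {v : FinFock d} (h : ∀ n, v n ≠ 0 → p n) :
    proj p v = v := by
  classical
  ext n
  rw [proj_apply]
  split_ifs with hp
  · rfl
  · by_contra hc
    exact hp (h n fun h0 => hc h0.symm)

theorem proj_eq_zero {p : Occ d → Prop} {v : FinFock d} (h : ∀ n, v n ≠ 0 → ¬ p n) :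
    proj p v = 0 := by
  classical
  ext n
  rw [proj_apply]
  split_ifs with hp
  · by_contra hc
    exact h n hc hp
  · rfl

theorem of_proj_ne_zero {p : Occ d → Prop} {v : FinFock d} {n : Occ d} (h : proj p v n ≠ 0) :
    p n ∧ v n ≠ 0 := by
  classical
  rw [proj_apply] at h
  split_ifs at h with hp
  · exact ⟨hp, h⟩
  · exact absurd rfl h

theorem Qgt_mem (N : ℕ) (q : Mode d) (s : ℕ) (v : FinFock d) :
    Qgt N q (2 * s) v ∈ lowSpace N q (s + 1) := by
  rw [mem_lowSpace]
  intro n hn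
  have := (of_proj_ne_zero hn).1
  exact ⟨this.1, by omega⟩

theorem Qgt_eq_self {N : ℕ} {q : Mode d} {s : ℕ} {v : FinFock d} (hv : v ∈ lowSpace N q (s + 1)) :
    Qgt N q (2 * s) v = v := by
  refine proj_eq_self fun n hn => ?_
  have := mem_lowSpace.1 hv n hn
  exact ⟨this.1, by omega⟩

theorem Qeq_eq_zero {N : ℕ} {q : Mode d} {s : ℕ} {v : FinFock d} (hv : v ∈ lowSpace N q (s + 1)) :
    Qeq N q (2 * s) v = 0 := by
  refine proj_eq_zero fun n hn => ?_
  have := mem_lowSpace.1 hv n hn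
  omega

theorem Qeq_mem (N : ℕ) (q : Mode d) (s : ℕ) (v : FinFock d) (_ : 2 * s ≤ N) :
    Qeq N q (2 * s) v ∈ lowSpace N q s := by
  rw [mem_lowSpace]
  intro n hn
  have := (of_proj_ne_zero hn).1
  exact ⟨this.1, by omega⟩

theorem Qeq_add_Qgt {N : ℕ} {q : Mode d} {s : ℕ} {v : FinFock d} (hv : v ∈ lowSpace N q s) :
    Qeq N q (2 * s) v + Qgt N q (2 * s) v = v := by
  classical
  ext n
  rw [Finsupp.add_apply, Qeq, Qgt, proj_apply, proj_apply]
  by_cases h0 : v n = 0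
  · simp [h0]
  · have := mem_lowSpace.1 hv n h0
    by_cases h1 : n.degree = N ∧ (n q + n (-q) + 2 * s = N ∨ n q + n (-q) + 2 * s + 1 = N)
    · rw [if_pos h1, if_neg (by omega), add_zero]
    · rw [if_neg h1, if_pos (by omega), zero_add]

theorem mem_succ_of_Qeq_eq_zero {N : ℕ} {q : Mode d} {s : ℕ} {v : FinFock d}
    (hv : v ∈ lowSpace N q s) (h0 : Qeq N q (2 * s) v = 0) : v ∈ lowSpace N q (s + 1) := by
  rw [← Qeq_add_Qgt hv, h0, zero_add]
  exact Qgt_mem N q s v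

theorem ip_eq_zero_of_lowSpace {N : ℕ} {q : Mode d} {s : ℕ} {u v : FinFock d}
    (hu : ∀ n, u n ≠ 0 → N < n q + n (-q) + 2 * s) (hv : v ∈ lowSpace N q s) : ip u v = 0 := by
  refine ip_eq_zero_of_disjoint fun n hn => ?_
  by_contra hc
  have := hu n hn
  have := mem_lowSpace.1 hv n hc
  omega

theorem Qeq_mul_self (N : ℕ) (q : Mode d) (i : ℕ) : Qeq N q i * Qeq N q i = Qeq N q i :=
  proj_mul_self _

/-! ### Inverses on the range of a projection -/

section compInv

variable {Q K : Op d}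

theorem mul_compInv (hQ : Q * Q = Q) : Q * compInv Q K = compInv Q K := by
  rw [compInv, ← mul_assoc, ← mul_assoc, hQ]

theorem compInv_mul (hQ : Q * Q = Q) : compInv Q K * Q = compInv Q K := by
  rw [compInv, mul_assoc, hQ]

/-- Compressing `(QKQ + (1 - Q)) · inverse = 1` by `Q` on both sides removes the complementary
block. -/
theorem mul_mul_compInv (hQ : Q * Q = Q) (h : CompInvertible Q K) :
    Q * (K * compInv Q K) = Q := by
  have h1 := Ring.mul_inverse_cancel _ h
  have h2 := congrArg (fun T => Q * T * Q) h1
  simp only [mul_add, op_mul_sub, mul_one, add_mul, op_sub_mul, one_mul] at h2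
  have e1 : Q * (Q * K * Q * Ring.inverse (Q * K * Q + (1 - Q))) * Q = Q * (K * compInv Q K) := by
    rw [compInv]
    simp only [← mul_assoc]
    rw [hQ]
  have e3 : Q * (Q * Ring.inverse (Q * K * Q + (1 - Q))) =
      Q * Ring.inverse (Q * K * Q + (1 - Q)) := by
    rw [← mul_assoc, hQ]
  rw [e1, e3, op_sub_self, add_zero, hQ] at h2
  exact h2

end compInv

/-- Hypotheses under which the Feshbach–Schur flow of the modes `±q`, started from `A` and ended
with the projection onto `ψ`, leads to a vector in the kernel of `A`. -/
structure FlowData (F₀ : Finset (Mode d)) (c : Mode d → ℝ) (N h : ℕ) (q : Mode d) (A : Op d)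
    (ψ : FinFock d) : Prop where
  N_eq : N = 2 * h
  h_pos : 0 < h
  q_ne : q ≠ 0
  adj : IsAdj A A
  alg : A ∈ sectorAlg F₀
  split : ∀ s, ∀ v ∈ lowSpace N q s, (A - Wstar c N q) v ∈ lowSpace N q s
  nPart : ∀ v ∈ nParticle d N, A v ∈ nParticle d N
  pos_vac : ∀ v ∈ nParticle d N, v (fillZero N 0) = 0 → (ip v (A v)).re ≤ 0 → v = 0
  pos_orth : ∀ v ∈ nParticle d N, ip ψ v = 0 → (ip v (A v)).re ≤ 0 → v = 0
  mem_sector : ψ ∈ sector F₀ N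
  mem_low : ψ ∈ lowSpace N q h
  ne_zero : ψ ≠ 0
  ker : ∃ Φ ∈ nParticle d N, Φ ≠ 0 ∧ A Φ = 0

theorem Wstar_mem_lowSpace {c : Mode d → ℝ} {N : ℕ} {q : Mode d} (hq : q ≠ 0) {s : ℕ}
    {v : FinFock d} (hv : v ∈ lowSpace N q (s + 1)) : Wstar c N q v ∈ lowSpace N q s := by
  classical
  rw [mem_lowSpace] at hv ⊢
  intro n hn
  obtain ⟨n', h1, h2⟩ := Wstar_moves hn
  obtain ⟨h3, h4⟩ := hv n' h1
  have hqq := ne_neg_of_ne_zero hq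
  refine ⟨(PairMove.degree (Or.inr h2)).trans h3, ?_⟩
  have e1 := DFunLike.congr_fun h2 q
  have e2 := DFunLike.congr_fun h2 (-q)
  simp [hqq, hqq.symm, Ne.symm hq, neg_ne_zero.2 hq] at e1 e2
  omega

/-- `W*` raises the number of particles in `±q` by exactly two, so only the block two particles
below contributes to a given block. -/
theorem Qeq_Wstar {c : Mode d → ℝ} {N : ℕ} {q : Mode d} (hq : q ≠ 0) {s : ℕ}
    {v : FinFock d} (hv : v ∈ nParticle d N) (_ : 2 * s + 2 ≤ N) :
    Qeq N q (2 * s) (Wstar c N q v) =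
      Qeq N q (2 * s) (Wstar c N q (Qeq N q (2 * (s + 1)) v)) := by
  classical
  have hqq := ne_neg_of_ne_zero hq
  rw [← sub_eq_zero, ← map_sub, ← map_sub]
  refine proj_eq_zero fun n hn hp => ?_
  obtain ⟨n', h1, h2⟩ := Wstar_moves hn
  rw [Finsupp.sub_apply, Qeq, proj_apply] at h1
  split_ifs at h1 with h3
  · exact h1 (sub_self _)
  · rw [sub_zero] at h1
    have e1 := DFunLike.congr_fun h2 q
    have e2 := DFunLike.congr_fun h2 (-q)
    simp [hqq, hqq.symm, Ne.symm hq, neg_ne_zero.2 hq] at e1 e2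
    exact h3 ⟨mem_nParticle.1 hv n' h1, by omega⟩

/-! ### The flow for an operator satisfying the positivity hypotheses -/

namespace FlowData

variable {F₀ : Finset (Mode d)} {c : Mode d → ℝ} {N h : ℕ} {q : Mode d} {A : Op d} {ψ : FinFock d}

/-- Reconstruction of a vector from its Feshbach–Schur projection, in one step of the flow. -/
def step (N : ℕ) (q : Mode d) (A : Op d) (s : ℕ) : Op d :=
  1 - compInv (Qeq N q (2 * s)) (kappa N q A s) * kappa N q A s

/-- Reconstruction of a vector from its projection after `s` steps of the flow. -/
def lift (N : ℕ) (q : Mode d) (A : Op d) : ℕ → Op d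
  | 0 => 1
  | s + 1 => lift N q A s * step N q A s

theorem kappa_mem (D : FlowData F₀ c N h q A ψ) (s : ℕ) : ∀ v ∈ lowSpace N q s,
    kappa N q A s v ∈ lowSpace N q s := by
  cases s with
  | zero =>
    intro v hv
    have h1 := D.nPart v (lowSpace_le_nParticle _ _ _ hv)
    rw [mem_nParticle] at h1
    rw [mem_lowSpace]
    intro n hn
    have h2 := h1 n hn
    refine ⟨h2, ?_⟩
    have h3 : (Finsupp.single q (n q) + Finsupp.single (-q) (n (-q)) : Occ d) ≤ n := by
      classical
      intro p
      have hqq := ne_neg_of_ne_zero D.q_ne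
      rw [Finsupp.add_apply, Finsupp.single_apply, Finsupp.single_apply]
      split_ifs with a1 a2
      · exact absurd (a1.trans a2.symm) hqq
      · rw [a1]; simp
      · rename_i a2; rw [a2]; simp
      · simp
    have h4 := Finsupp.degree_mono h3
    rw [map_add, degree_single, degree_single] at h4
    omega
  | succ s =>
    intro v _
    rw [kappa, feshbach, mul_assoc, mul_assoc, mul_assoc, mul_assoc, ← op_mul_sub,
      Module.End.mul_apply]
    exact Qgt_mem N q s _

theorem kappa_alg (D : FlowData F₀ c N h q A ψ) (s : ℕ) : kappa N q A s ∈ sectorAlg F₀ := by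
  induction s with
  | zero => exact D.alg
  | succ s ih =>
    have hQ : Qeq N q (2 * s) ∈ sectorAlg F₀ := proj_mem_sectorAlg _ _
    have hP : Qgt N q (2 * s) ∈ sectorAlg F₀ := proj_mem_sectorAlg _ _
    have hG : compInv (Qeq N q (2 * s)) (kappa N q A s) ∈ sectorAlg F₀ :=
      mul_mem (mul_mem hQ (inverse_mem_sectorAlg
        (add_mem (mul_mem (mul_mem hQ ih) hQ) (sub_mem_sectorAlg (one_mem _) hQ)))) hQ
    exact sub_mem_sectorAlg (mul_mem (mul_mem hP ih) hP)
      (mul_mem (mul_mem (mul_mem (mul_mem hP ih) hG) ih) hP)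

/-- A step changes only components in the block being eliminated, and leaves the projected vector
intact. -/
theorem step_sub (D : FlowData F₀ c N h q A ψ) {s : ℕ} (hs : s < h) (v : FinFock d) :
    step N q A s v - v ∈ lowSpace N q s ∧ Qgt N q (2 * s) (step N q A s v - v) = 0 := by
  have hQ := Qeq_mul_self N q (2 * s)
  have e : step N q A s v - v = -(Qeq N q (2 * s)
      (compInv (Qeq N q (2 * s)) (kappa N q A s) (kappa N q A s v))) := by
    rw [← Module.End.mul_apply, mul_compInv hQ, step, LinearMap.sub_apply, Module.End.one_apply,
      Module.End.mul_apply]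
    abel
  rw [e]
  have h2 := D.N_eq
  refine ⟨neg_mem (Qeq_mem N q s _ (by omega)), ?_⟩
  rw [map_neg, neg_eq_zero]
  refine proj_eq_zero fun n hn hp => ?_
  have := (of_proj_ne_zero hn).1
  omega

theorem step_mem (D : FlowData F₀ c N h q A ψ) {s : ℕ} (hs : s < h) {v : FinFock d}
    (hv : v ∈ lowSpace N q (s + 1)) : step N q A s v ∈ lowSpace N q s := by
  have := add_mem (D.step_sub hs v).1 (lowSpace_succ_le N q s hv)
  rwa [sub_add_cancel] at this

/-- The correction in `step` is chosen to cancel the eliminated block of `𝒦 v`; what is left is the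
Schur complement. -/
theorem kappa_step (D : FlowData F₀ c N h q A ψ) {s : ℕ} (hs : s < h)
    (hinv : CompInvertible (Qeq N q (2 * s)) (kappa N q A s)) {v : FinFock d}
    (hv : v ∈ lowSpace N q (s + 1)) :
    kappa N q A s (step N q A s v) = kappa N q A (s + 1) v := by
  have hQ := Qeq_mul_self N q (2 * s)
  have h1 : Qeq N q (2 * s) (kappa N q A s (step N q A s v)) = 0 := by
    have := LinearMap.congr_fun (mul_mul_compInv hQ hinv) (kappa N q A s v)
    simp only [Module.End.mul_apply] at this
    rw [step, LinearMap.sub_apply, Module.End.one_apply, Module.End.mul_apply, map_sub, map_sub,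
      this, sub_self]
  have h2 := Qeq_add_Qgt (D.kappa_mem s _ (D.step_mem hs hv))
  rw [h1, zero_add] at h2
  rw [← h2, kappa, feshbach, step]
  simp only [LinearMap.sub_apply, Module.End.mul_apply, Module.End.one_apply, map_sub,
    Qgt_eq_self hv]

/-- Isospectrality of the flow, iterated. The third clause records that the lift only adds
components with strictly more than `N - 2s` particles in `±q`, hence orthogonal to everything still
present in the flow. -/
theorem lift_spec (D : FlowData F₀ c N h q A ψ) (s : ℕ) (hs : s ≤ h)
    (hinv : ∀ i < s, CompInvertible (Qeq N q (2 * i)) (kappa N q A i)) {v : FinFock d}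
    (hv : v ∈ lowSpace N q s) :
    lift N q A s v ∈ nParticle d N ∧ A (lift N q A s v) = kappa N q A s v ∧
      ∀ n, (lift N q A s v - v) n ≠ 0 → N < n q + n (-q) + 2 * s := by
  induction s generalizing v with
  | zero =>
    refine ⟨lowSpace_le_nParticle _ _ _ hv, rfl, fun n hn => ?_⟩
    exfalso; apply hn
    rw [lift, Module.End.one_apply, sub_self, Finsupp.zero_apply]
  | succ s ih =>
    obtain ⟨h1, h2, h3⟩ := ih (by omega) (fun i hi => hinv i (by omega)) (D.step_mem (by omega) hv)
    rw [lift, Module.End.mul_apply]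
    refine ⟨h1, h2.trans (D.kappa_step (by omega) (hinv s (by omega)) hv), fun n hn => ?_⟩
    by_cases h4 : (lift N q A s (step N q A s v) - step N q A s v) n ≠ 0
    · have := h3 n h4
      omega
    · rw [not_not] at h4
      have h5 : (step N q A s v - v) n ≠ 0 := by
        intro h5
        apply hn
        rw [Finsupp.sub_apply] at h4 h5 ⊢
        linear_combination h4 + h5
      obtain ⟨h6, h7⟩ := D.step_sub (by omega : s < h) v
      have h8 := mem_lowSpace.1 h6 n h5
      by_contra hc
      apply h5
      have h9 := DFunLike.congr_fun h7 n
      classical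
      rw [Qgt, proj_apply, if_pos ⟨h8.1, by omega⟩] at h9
      exact h9

/-- If `x` in the range of `Q` is killed by the compression, then `𝒦 x` has fewer particles in `±q`
than every component of the lift `Φ` of `x`. Hence `⟨Φ, AΦ⟩ = ⟨Φ, 𝒦 x⟩ = 0`, and `Φ` has no vacuum
component since its blocks still contain particles in `±q`. Thus `Φ = 0`, and `x`, being a block of
`Φ`, is zero. Invertibility of the earlier blocks is needed to lift, whence strong induction. -/
theorem compInvertible_Qeq (D : FlowData F₀ c N h q A ψ) (s : ℕ) (hs : s < h) :
    CompInvertible (Qeq N q (2 * s)) (kappa N q A s) := by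
  induction s using Nat.strong_induction_on with
  | _ s ih =>
  have hQ := Qeq_mul_self N q (2 * s)
  have hQa : Qeq N q (2 * s) ∈ sectorAlg F₀ := proj_mem_sectorAlg _ _
  have hN := D.N_eq
  refine isUnit_of_injective (F₀ := F₀) (add_mem (mul_mem (mul_mem hQa (D.kappa_alg s)) hQa)
    (sub_mem_sectorAlg (one_mem _) hQa)) fun x hx => ?_
  have hQ' : ∀ y, Qeq N q (2 * s) (Qeq N q (2 * s) y) = Qeq N q (2 * s) y :=
    fun y => LinearMap.congr_fun hQ y
  simp only [LinearMap.add_apply, LinearMap.sub_apply, Module.End.mul_apply,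
    Module.End.one_apply] at hx
  have h1 : Qeq N q (2 * s) (kappa N q A s (Qeq N q (2 * s) x)) = 0 := by
    have := congrArg (Qeq N q (2 * s)) hx
    rwa [map_add, map_sub, hQ', hQ', sub_self, add_zero, map_zero] at this
  rw [h1, zero_add, sub_eq_zero] at hx
  rw [← hx] at h1
  have hxl : x ∈ lowSpace N q s := by rw [hx]; exact Qeq_mem N q s x (by omega)
  obtain ⟨h2, h3, h4⟩ := D.lift_spec s hs.le (fun i hi => ih i hi (hi.trans hs)) hxl
  have hK := mem_succ_of_Qeq_eq_zero (D.kappa_mem s x hxl) h1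
  have hoff : ∀ n, lift N q A s x n ≠ 0 → N < n q + n (-q) + 2 * (s + 1) := by
    intro n hn
    by_cases h5 : (lift N q A s x - x) n ≠ 0
    · have := h4 n h5; omega
    · rw [not_not, Finsupp.sub_apply, sub_eq_zero] at h5
      rw [h5, hx] at hn
      have := (of_proj_ne_zero hn).1
      omega
  have h0 : lift N q A s x = 0 := by
    apply D.pos_vac _ h2
    · by_contra hc
      have := hoff _ hc
      rw [fillZero_apply_ne N 0 D.q_ne, fillZero_apply_ne N 0 (neg_ne_zero.2 D.q_ne)] at this
      simp only [Finsupp.coe_zero, Pi.zero_apply] at this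
      omega
    · rw [h3, ip_eq_zero_of_lowSpace hoff hK, Complex.zero_re]
  ext n
  rw [Finsupp.zero_apply]
  by_contra hc
  have h5 := h4 n (by rw [h0, zero_sub, Finsupp.neg_apply]; exact neg_ne_zero.2 hc)
  have := mem_lowSpace.1 hxl n hc
  omega

theorem lineProj_self (D : FlowData F₀ c N h q A ψ) : lineProj ψ ψ = ψ := by
  have : ip ψ ψ ≠ 0 := by
    rw [ip_self]
    exact_mod_cast pow_ne_zero 2 fun h0 => D.ne_zero (norm_toFock_eq_zero.1 h0)
  rw [lineProj_apply, inv_mul_cancel₀ this, one_smul]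

theorem lineProj_mul_self (D : FlowData F₀ c N h q A ψ) :
    lineProj ψ * lineProj ψ = lineProj ψ := by
  refine LinearMap.ext fun v => ?_
  rw [Module.End.mul_apply, lineProj_apply ψ v, map_smul, D.lineProj_self]

theorem Qgt_lineProj (D : FlowData F₀ c N h q A ψ) :
    Qgt N q (N - 2) * lineProj ψ = lineProj ψ := by
  have hN := D.N_eq
  have hh := D.h_pos
  refine LinearMap.ext fun v => ?_
  have e : N - 2 = 2 * (h - 1) := by omega
  rw [Module.End.mul_apply, lineProj_apply, map_smul, e, Qgt_eq_self]
  rw [Nat.sub_add_cancel hh]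
  exact D.mem_low

theorem lineProj_Qgt (D : FlowData F₀ c N h q A ψ) :
    lineProj ψ * Qgt N q (N - 2) = lineProj ψ := by
  refine LinearMap.ext fun v => ?_
  have h1 := LinearMap.congr_fun D.Qgt_lineProj ψ
  rw [Module.End.mul_apply, D.lineProj_self] at h1
  rw [Module.End.mul_apply, lineProj_apply, lineProj_apply, Qgt, ← isAdj_proj]
  rw [Qgt] at h1
  rw [h1]

theorem linePerp_mul_self (D : FlowData F₀ c N h q A ψ) :
    linePerp N q ψ * linePerp N q ψ = linePerp N q ψ := by
  have h1 : Qgt N q (N - 2) * Qgt N q (N - 2) = Qgt N q (N - 2) := proj_mul_self _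
  rw [linePerp, op_sub_mul, op_mul_sub, op_mul_sub, h1, D.Qgt_lineProj, D.lineProj_Qgt,
    D.lineProj_mul_self, op_sub_self, op_sub_zero]

theorem ip_linePerp (D : FlowData F₀ c N h q A ψ) (v : FinFock d) :
    ip ψ (linePerp N q ψ v) = 0 := by
  have h1 : lineProj ψ * linePerp N q ψ = 0 := by
    rw [linePerp, op_mul_sub, D.lineProj_Qgt, D.lineProj_mul_self, op_sub_self]
  have h2 := LinearMap.congr_fun h1 v
  rw [Module.End.mul_apply, LinearMap.zero_apply, lineProj_apply, smul_eq_zero] at h2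
  have h3 : ip ψ ψ ≠ 0 := by
    rw [ip_self]
    exact_mod_cast pow_ne_zero 2 fun h0 => D.ne_zero (norm_toFock_eq_zero.1 h0)
  exact (mul_eq_zero.1 (h2.resolve_right D.ne_zero)).resolve_left (inv_ne_zero h3)

theorem Qgt_mem' (D : FlowData F₀ c N h q A ψ) (v : FinFock d) :
    Qgt N q (N - 2) v ∈ lowSpace N q h := by
  have hN := D.N_eq
  have hh := D.h_pos
  have := Qgt_mem N q (h - 1) v
  rwa [Nat.sub_add_cancel hh, show 2 * (h - 1) = N - 2 by omega] at this

theorem linePerp_mem (D : FlowData F₀ c N h q A ψ) (v : FinFock d) :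
    linePerp N q ψ v ∈ lowSpace N q h := by
  rw [linePerp, LinearMap.sub_apply, lineProj_apply]
  exact sub_mem (D.Qgt_mem' v) (Submodule.smul_mem _ _ D.mem_low)

theorem eq_lineProj (D : FlowData F₀ c N h q A ψ) {v : FinFock d} (hv : v ∈ lowSpace N q h)
    (h0 : linePerp N q ψ v = 0) : v = lineProj ψ v := by
  have hN := D.N_eq
  have hh := D.h_pos
  have h1 : Qgt N q (N - 2) v = v := by
    rw [show N - 2 = 2 * (h - 1) by omega]
    apply Qgt_eq_self
    rwa [Nat.sub_add_cancel hh]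
  rwa [linePerp, LinearMap.sub_apply, h1, sub_eq_zero] at h0

/-- The same lifting argument, with orthogonality to `ψ` in place of a missing vacuum component: the
lift adds only vectors with particles in `±q`, which are orthogonal to `ψ`, and `𝒦 x` is a multiple
of `ψ`. -/
theorem compInvertible_linePerp (D : FlowData F₀ c N h q A ψ) :
    CompInvertible (linePerp N q ψ) (kappa N q A h) := by
  have hQ := D.linePerp_mul_self
  have hQa : linePerp N q ψ ∈ sectorAlg F₀ :=
    sub_mem_sectorAlg (proj_mem_sectorAlg _ _) (lineProj_mem_sectorAlg D.mem_sector)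
  refine isUnit_of_injective (F₀ := F₀) (add_mem (mul_mem (mul_mem hQa (D.kappa_alg h)) hQa)
    (sub_mem_sectorAlg (one_mem _) hQa)) fun x hx => ?_
  have hQ' : ∀ y, linePerp N q ψ (linePerp N q ψ y) = linePerp N q ψ y :=
    fun y => LinearMap.congr_fun hQ y
  simp only [LinearMap.add_apply, LinearMap.sub_apply, Module.End.mul_apply,
    Module.End.one_apply] at hx
  have h1 : linePerp N q ψ (kappa N q A h (linePerp N q ψ x)) = 0 := by
    have := congrArg (linePerp N q ψ) hx
    rwa [map_add, map_sub, hQ', hQ', sub_self, add_zero, map_zero] at this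
  rw [h1, zero_add, sub_eq_zero] at hx
  rw [← hx] at h1
  have hxl : x ∈ lowSpace N q h := by rw [hx]; exact D.linePerp_mem x
  obtain ⟨h2, h3, h4⟩ := D.lift_spec h le_rfl (fun i hi => D.compInvertible_Qeq i hi) hxl
  have hψx : ip ψ x = 0 := by rw [hx]; exact D.ip_linePerp x
  have horth : ip ψ (lift N q A h x) = 0 := by
    have : lift N q A h x = (lift N q A h x - x) + x := by abel
    rw [this, ip_add_right, hψx, add_zero, ← ip_conj, ip_eq_zero_of_lowSpace h4 D.mem_low,
      map_zero]
  have h0 : lift N q A h x = 0 := by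
    apply D.pos_orth _ h2 horth
    rw [h3, D.eq_lineProj (D.kappa_mem h x hxl) h1, lineProj_apply, ip_smul_right,
      ← ip_conj ψ (lift N q A h x), horth, map_zero, mul_zero, Complex.zero_re]
  ext n
  rw [Finsupp.zero_apply]
  by_contra hc
  have h5 := h4 n (by rw [h0, zero_sub, Finsupp.neg_apply]; exact neg_ne_zero.2 hc)
  have := mem_lowSpace.1 hxl n hc
  omega

theorem half_eq (D : FlowData F₀ c N h q A ψ) : N / 2 = h := by
  have := D.N_eq; omega

theorem flowDefined (D : FlowData F₀ c N h q A ψ) : FlowDefined N q A ψ := by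
  rw [FlowDefined, D.half_eq]
  exact ⟨fun s hs => D.compInvertible_Qeq s hs, D.compInvertible_linePerp⟩

/-- The last step of the reconstruction. -/
def start (N h : ℕ) (q : Mode d) (A : Op d) (ψ : FinFock d) : FinFock d :=
  ψ - compInv (linePerp N q ψ) (kappa N q A h) (kappa N q A h ψ)

theorem start_mem (D : FlowData F₀ c N h q A ψ) : start N h q A ψ ∈ lowSpace N q h := by
  rw [start, ← mul_compInv D.linePerp_mul_self, Module.End.mul_apply]
  exact sub_mem D.mem_low (D.linePerp_mem _)

/-- `start` is the Feshbach lift of `ψ` in the last step, so the component of `𝒦` applied to it off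
the line of `ψ` has been eliminated. -/
theorem kappa_start (D : FlowData F₀ c N h q A ψ) : kappa N q A h (start N h q A ψ) =
    lineProj ψ (kappa N q A h (start N h q A ψ)) := by
  apply D.eq_lineProj (D.kappa_mem h _ D.start_mem)
  have := LinearMap.congr_fun (mul_mul_compInv D.linePerp_mul_self D.compInvertible_linePerp)
    (kappa N q A h ψ)
  simp only [Module.End.mul_apply] at this
  rw [start, map_sub, map_sub, this, sub_self]

/-- All corrections are orthogonal to `ψ`: the last step adds a vector of the complementary
projection, the others add particles in `±q`. This is the normalization that later fixes the vacuum
component. -/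
theorem ip_lift_start (D : FlowData F₀ c N h q A ψ) :
    ip ψ (lift N q A h (start N h q A ψ)) = ip ψ ψ := by
  obtain ⟨-, -, h4⟩ := D.lift_spec h le_rfl (fun i hi => D.compInvertible_Qeq i hi) D.start_mem
  have e : lift N q A h (start N h q A ψ) =
      (lift N q A h (start N h q A ψ) - start N h q A ψ) + start N h q A ψ := by abel
  rw [e, ip_add_right, ← ip_conj, ip_eq_zero_of_lowSpace h4 D.mem_low, map_zero, zero_add, start,
    ip_sub_right, ← mul_compInv D.linePerp_mul_self, Module.End.mul_apply, D.ip_linePerp, sub_zero]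

/-- The value is a multiple of `ψ` equal to `A` applied to the lift, hence orthogonal to a kernel
vector `Φ` of `A`. Since `⟨Φ, ψ⟩ ≠ 0` by `pos_orth`, the multiple is zero; no separate fixed point
equation for `z` is solved. -/
theorem kappa_start_eq_zero (D : FlowData F₀ c N h q A ψ) :
    kappa N q A h (start N h q A ψ) = 0 := by
  obtain ⟨Φ, hΦ, hΦ0, hAΦ⟩ := D.ker
  obtain ⟨-, h3, -⟩ := D.lift_spec h le_rfl (fun i hi => D.compInvertible_Qeq i hi) D.start_mem
  have h1 : ip Φ (kappa N q A h (start N h q A ψ)) = 0 := by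
    rw [← h3, ← D.adj, hAΦ, ip_zero_left]
  have h2 : ip Φ ψ ≠ 0 := by
    intro h0
    apply hΦ0
    apply D.pos_orth Φ hΦ
    · rw [← ip_conj, h0, map_zero]
    · rw [hAΦ, ip_zero_right, Complex.zero_re]
  rw [D.kappa_start, lineProj_apply] at h1 ⊢
  rw [ip_smul_right] at h1
  rw [(mul_eq_zero.1 h1).resolve_right h2, zero_smul]

theorem kappaFinal_eq_zero (D : FlowData F₀ c N h q A ψ) : kappaFinal N q A ψ = 0 := by
  have h1 : kappaFinal N q A ψ ψ = 0 := by
    have h2 := D.kappa_start_eq_zero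
    rw [start, map_sub] at h2
    rw [kappaFinal, D.half_eq, feshbach]
    simp only [LinearMap.sub_apply, Module.End.mul_apply, D.lineProj_self]
    rw [← map_sub, h2, map_zero]
  refine LinearMap.ext fun v => ?_
  have h3 : kappaFinal N q A ψ = kappaFinal N q A ψ * lineProj ψ := by
    rw [kappaFinal, feshbach, op_sub_mul]
    simp only [mul_assoc, D.lineProj_mul_self]
  rw [h3, Module.End.mul_apply, lineProj_apply, map_smul, h1, smul_zero, LinearMap.zero_apply]

theorem apply_lift_start (D : FlowData F₀ c N h q A ψ) :
    A (lift N q A h (start N h q A ψ)) = 0 := by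
  obtain ⟨-, h3, -⟩ := D.lift_spec h le_rfl (fun i hi => D.compInvertible_Qeq i hi) D.start_mem
  rw [h3, D.kappa_start_eq_zero]

theorem Qeq_apply (D : FlowData F₀ c N h q A ψ) {s : ℕ} {v : FinFock d}
    (hv : v ∈ lowSpace N q (s + 1)) :
    Qeq N q (2 * s) (A v) = Qeq N q (2 * s) (Wstar c N q v) := by
  have : A v = (A - Wstar c N q) v + Wstar c N q v := by
    rw [LinearMap.sub_apply, sub_add_cancel]
  rw [this, map_add, Qeq_eq_zero (D.split _ v hv), zero_add]

/-- The part of `A` other than `W*` never increases the number of particles in `±q`, and `W*`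
increases it by two. Only the `W*` coupling between adjacent blocks therefore enters the
reconstruction, although `𝒦` itself contains all previous corrections. -/
theorem Qeq_kappa (D : FlowData F₀ c N h q A ψ) (s : ℕ) {v : FinFock d}
    (hv : v ∈ lowSpace N q (s + 1)) :
    Qeq N q (2 * s) (kappa N q A s v) = Qeq N q (2 * s) (Wstar c N q v) := by
  cases s with
  | zero => exact D.Qeq_apply hv
  | succ s =>
    -- Two levels below the eliminated block, `A v` does not reach that block, so the Schur
    -- correction vanishes and `𝒦` acts as a truncation of `A`.
    have key : ∀ s, ∀ v ∈ lowSpace N q (s + 2), kappa N q A (s + 1) v = Qgt N q (2 * s) (A v) := by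
      intro s
      induction s with
      | zero =>
        intro v hv
        have hv' := lowSpace_succ_le _ _ _ hv
        have hz : compInv (Qeq N q (2 * 0)) (kappa N q A 0) (kappa N q A 0 v) = 0 := by
          rw [← compInv_mul (Qeq_mul_self N q (2 * 0)), Module.End.mul_apply]
          change compInv (Qeq N q (2 * 0)) (kappa N q A 0) (Qeq N q (2 * 0) (A v)) = 0
          rw [D.Qeq_apply hv', Qeq_eq_zero (Wstar_mem_lowSpace D.q_ne hv), map_zero]
        rw [kappa, feshbach]
        simp only [LinearMap.sub_apply, Module.End.mul_apply, Qgt_eq_self hv', hz, map_zero,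
          sub_zero]
        rfl
      | succ s ih =>
        intro v hv
        have hv' := lowSpace_succ_le _ _ _ hv
        have e := ih v hv'
        have hcomm : ∀ w : FinFock d, Qeq N q (2 * (s + 1)) (Qgt N q (2 * s) w) =
            Qeq N q (2 * (s + 1)) w := by
          classical
          intro w
          ext n
          rw [Qeq, Qgt, proj_apply, proj_apply, proj_apply]
          split_ifs with a1 a2 <;> first | rfl | omega
        have hcomm' : ∀ w : FinFock d, Qgt N q (2 * (s + 1)) (Qgt N q (2 * s) w) =
            Qgt N q (2 * (s + 1)) w := by
          classical
          intro w
          ext n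
          rw [Qgt, Qgt, proj_apply, proj_apply, proj_apply]
          split_ifs with a1 a2 <;> first | rfl | omega
        have hz : compInv (Qeq N q (2 * (s + 1))) (kappa N q A (s + 1))
            (kappa N q A (s + 1) v) = 0 := by
          rw [← compInv_mul (Qeq_mul_self N q (2 * (s + 1))),
            Module.End.mul_apply, e, hcomm, D.Qeq_apply hv',
            Qeq_eq_zero (Wstar_mem_lowSpace D.q_ne hv), map_zero]
        rw [kappa, feshbach]
        simp only [LinearMap.sub_apply, Module.End.mul_apply, Qgt_eq_self hv', hz, map_zero,
          sub_zero]
        rw [e, hcomm']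
    rw [key s v hv, ← D.Qeq_apply hv]
    classical
    ext n
    rw [Qeq, Qgt, proj_apply, proj_apply, proj_apply]
    split_ifs with a1 a2 <;> first | rfl | omega

theorem step_eq (D : FlowData F₀ c N h q A ψ) (s : ℕ) {v : FinFock d}
    (hv : v ∈ lowSpace N q (s + 1)) :
    step N q A s v = v - compInv (Qeq N q (2 * s)) (kappa N q A s)
      (Qeq N q (2 * s) (Wstar c N q v)) := by
  rw [← D.Qeq_kappa s hv, ← Module.End.mul_apply (compInv _ _),
    compInv_mul (Qeq_mul_self N q (2 * s))]
  rfl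

/-- The vector `start` after `r` steps of the reconstruction. -/
def iter (N h : ℕ) (q : Mode d) (A : Op d) (ψ : FinFock d) : ℕ → FinFock d
  | 0 => start N h q A ψ
  | r + 1 => step N q A (h - (r + 1)) (iter N h q A ψ r)

theorem lift_start_eq (r : ℕ) (hr : r ≤ h) :
    lift N q A h (start N h q A ψ) = lift N q A (h - r) (iter N h q A ψ r) := by
  induction r with
  | zero => rfl
  | succ r ih =>
    rw [ih (by omega), show h - r = (h - (r + 1)) + 1 by omega, lift, Module.End.mul_apply, iter]

theorem iter_mem (D : FlowData F₀ c N h q A ψ) (r : ℕ) (hr : r ≤ h) :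
    iter N h q A ψ r ∈ lowSpace N q (h - r) := by
  induction r with
  | zero => exact D.start_mem
  | succ r ih =>
    apply D.step_mem (by omega)
    rw [show h - (r + 1) + 1 = h - r by omega]
    exact ih (by omega)

/-- Each step adds one product of factors. The second clause is carried along because the next
factor sees only the block added last. -/
theorem iter_eq (D : FlowData F₀ c N h q A ψ) (r : ℕ) (hr : r + 1 ≤ h) :
    iter N h q A ψ (r + 1) =
        ((∑ i ∈ Finset.Icc 2 (r + 1), gsProd c N q A i) + 1) (iter N h q A ψ 1) ∧
      Qeq N q (2 * (h - (r + 1))) (iter N h q A ψ (r + 1)) =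
        Qeq N q (2 * (h - (r + 1))) (gsProd c N q A (r + 1) (iter N h q A ψ 1)) := by
  have hN := D.N_eq
  induction r with
  | zero => simp [gsProd]
  | succ r ih =>
    obtain ⟨h1, h2⟩ := ih (by omega)
    have hmem := D.iter_mem (r + 1) (by omega)
    have hmem' : iter N h q A ψ (r + 1) ∈ lowSpace N q (h - (r + 1 + 1) + 1) := by
      rwa [show h - (r + 1 + 1) + 1 = h - (r + 1) by omega]
    have e1 : iter N h q A ψ (r + 1 + 1) = iter N h q A ψ (r + 1) +
        gsProd c N q A (r + 1 + 1) (iter N h q A ψ 1) := by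
      rw [iter, D.step_eq _ hmem',
        Qeq_Wstar D.q_ne (lowSpace_le_nParticle _ _ _ hmem) (by omega),
        show h - (r + 1 + 1) + 1 = h - (r + 1) by omega, h2, gsProd, gsFactor, D.half_eq,
        show N - 2 * (r + 2) = 2 * (h - (r + 1 + 1)) by omega,
        show 2 * (h - (r + 1 + 1)) + 2 = 2 * (h - (r + 1)) by omega]
      simp only [Module.End.mul_apply, LinearMap.neg_apply]
      rw [sub_eq_add_neg]
    constructor
    · rw [e1]
      conv_lhs => rw [h1]
      rw [Finset.sum_Icc_succ_top (by omega : 2 ≤ r + 1 + 1)]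
      simp only [LinearMap.add_apply, Module.End.one_apply]
      abel
    · rw [e1, map_add, Qeq_eq_zero hmem', zero_add]

theorem lift_start_eq_gsT (D : FlowData F₀ c N h q A ψ) :
    lift N q A h (start N h q A ψ) = gsT c N q A ψ ψ := by
  have hN := D.N_eq
  have hh := D.h_pos
  rw [lift_start_eq h le_rfl, Nat.sub_self, lift, Module.End.one_apply]
  have h1 := (D.iter_eq (h - 1) (by omega)).1
  rw [Nat.sub_add_cancel hh] at h1
  have h2 : start N h q A ψ ∈ lowSpace N q (h - 1 + 1) := by
    rw [Nat.sub_add_cancel hh]; exact D.start_mem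
  have e1 : iter N h q A ψ 1 = (Qgt N q (N - 2) -
      compInv (Qeq N q (N - 2)) (kappa N q A (h - 1)) * Qeq N q (N - 2) * Wstar c N q)
        (start N h q A ψ) := by
    rw [iter, iter, zero_add, D.step_eq _ h2, show N - 2 = 2 * (h - 1) by omega]
    simp only [LinearMap.sub_apply, Module.End.mul_apply, Qgt_eq_self h2]
  have e2 : start N h q A ψ = (lineProj ψ -
      compInv (linePerp N q ψ) (kappa N q A h) * linePerp N q ψ * kappa N q A h) ψ := by
    rw [compInv_mul D.linePerp_mul_self, LinearMap.sub_apply, D.lineProj_self]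
    rfl
  rw [h1, gsT, D.half_eq, Module.End.mul_apply, Module.End.mul_apply, ← e2, ← e1]

/-- The flow reconstructs a vector in the kernel of `A`. -/
theorem gsT_spec (D : FlowData F₀ c N h q A ψ) :
    gsT c N q A ψ ψ ∈ nParticle d N ∧ A (gsT c N q A ψ ψ) = 0 ∧
      ip ψ (gsT c N q A ψ ψ) = ip ψ ψ := by
  rw [← D.lift_start_eq_gsT]
  exact ⟨(D.lift_spec h le_rfl (fun i hi => D.compInvertible_Qeq i hi) D.start_mem).1,
    D.apply_lift_start, D.ip_lift_start⟩

end FlowData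

end Bogoliubov

end

noncomputable section

namespace Bogoliubov

open Filter Topology

variable {d : ℕ} {L : ℝ} {c : Mode d → ℝ} {j : ℕ → Mode d} {m : ℕ}

/-! ## The ground states obtained from the flow -/

theorem shifted_apply (L : ℝ) (c : Mode d → ℝ) (N : ℕ) (j : ℕ → Mode d) (m : ℕ) (v : FinFock d) :
    shifted L c N j m v = HBog L c N j m v - (zBog L c N j m : ℂ) • v := rfl

theorem form_shifted (L : ℝ) (c : Mode d → ℝ) (N : ℕ) (j : ℕ → Mode d) (m : ℕ) (v : FinFock d) :
    (ip v (shifted L c N j m v)).re =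
      (ip v (HBog L c N j m v)).re - zBog L c N j m * ‖toFock v‖ ^ 2 := by
  rw [shifted_apply, ip_sub_right, ip_smul_right, ip_self, Complex.sub_re, Complex.re_ofReal_mul,
    Complex.ofReal_re]

theorem cre_zero_pow (d N : ℕ) : ((cre (0 : Mode d)) ^ N) (ket 0) =
    ((Real.sqrt (Nat.factorial N : ℝ) : ℝ) : ℂ) • ket (Finsupp.single 0 N) := by
  induction N with
  | zero => simp
  | succ N ih =>
    rw [pow_succ', Module.End.mul_apply, ih, map_smul, cre_ket, smul_smul, ← Complex.ofReal_mul,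
      ← Real.sqrt_mul (by positivity), ← Finsupp.single_add, Finsupp.single_eq_same,
      Nat.factorial_succ, mul_comm, Nat.cast_mul, Nat.cast_add_one]

theorem eta_eq (d N : ℕ) : eta d N = ket (fillZero N 0) := by
  have : ((Real.sqrt (Nat.factorial N : ℝ) : ℝ) : ℂ) ≠ 0 := by
    rw [Complex.ofReal_ne_zero]
    positivity
  rw [eta, cre_zero_pow, smul_smul, inv_mul_cancel₀ this, one_smul, fillZero, zero_add, map_zero,
    Nat.sub_zero]

theorem trial_zero (N K : ℕ) : trial L c N j 0 K = eta d N := by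
  have : configs j 0 K = {0} := by
    ext μ
    rw [mem_configs, Finset.mem_singleton]
    have : pairModes j 0 = ∅ := by
      ext q
      simp [mem_pairModes]
    rw [this, Finset.subset_empty, Finsupp.support_eq_empty]
    exact ⟨fun h => h.1, fun h => ⟨h, by simp [h]⟩⟩
  rw [trial, this, Finset.sum_singleton, amplitude_zero, Complex.ofReal_one, one_smul, eta_eq]

theorem Admissible.notMem_pairModes (h : Admissible L c j (m + 1)) :
    j (m + 1) ∉ pairModes j m ∧ -j (m + 1) ∉ pairModes j m := by
  have hm : m + 1 ∈ Finset.Icc 1 (m + 1) := by simp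
  constructor <;> intro hq <;> obtain ⟨l, hl, hl'⟩ := mem_pairModes.1 hq <;>
    have hl2 := Finset.Icc_subset_Icc_right (Nat.le_succ m) hl <;> rw [Finset.mem_Icc] at hl
  · have := h.inj _ hm l hl2 hl'
    omega
  · have := h.inj _ hm l hl2 (hl'.symm.imp (fun h' => neg_injective h')
      fun h' => by rw [← h', neg_neg])
    omega

theorem pairModes_subset (j : ℕ → Mode d) (m : ℕ) : pairModes j m ⊆ pairModes j (m + 1) := by
  intro q hq
  obtain ⟨l, hl, hl'⟩ := mem_pairModes.1 hq
  exact mem_pairModes.2 ⟨l, Finset.Icc_subset_Icc_right (Nat.le_succ m) hl, hl'⟩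

theorem configs_subset (j : ℕ → Mode d) (m K : ℕ) : configs j m K ⊆ configs j (m + 1) K := by
  intro μ hμ
  obtain ⟨h1, h2⟩ := mem_configs.1 hμ
  exact mem_configs.2 ⟨h1.trans (pairModes_subset j m), h2⟩

theorem Admissible.amplitude_succ (h : Admissible L c j (m + 1)) {μ : Occ d}
    (hμ : μ.support ⊆ pairModes j m) : amplitude L c j (m + 1) μ = amplitude L c j m μ := by
  classical
  have h1 : μ (j (m + 1)) = 0 :=
    Finsupp.notMem_support_iff.1 fun h' => h.notMem_pairModes.1 (hμ h')
  have h2 : μ (-j (m + 1)) = 0 :=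
    Finsupp.notMem_support_iff.1 fun h' => h.notMem_pairModes.2 (hμ h')
  have hI : Finset.Icc 1 (m + 1) = insert (m + 1) (Finset.Icc 1 m) := by
    ext x
    simp only [Finset.mem_Icc, Finset.mem_insert]
    omega
  have hni : m + 1 ∉ Finset.Icc 1 m := by simp
  rw [amplitude, amplitude, hI, Finset.prod_insert hni, h1, pow_zero, one_mul]
  simp only [Finset.forall_mem_insert, h1, h2, true_and]
  congr 1

theorem ip_sum_left {ι : Type*} (s : Finset ι) (u : ι → FinFock d) (v : FinFock d) :
    ip (∑ i ∈ s, u i) v = ∑ i ∈ s, ip (u i) v := by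
  simp only [ip, map_sum, sum_inner]

/-- The state with `m` pairs of modes is the part of the state with `m + 1` pairs that has no
particles in `±j (m + 1)`. -/
theorem Admissible.ip_trial_succ (h : Admissible L c j (m + 1)) (N K : ℕ) :
    ip (trial L c N j m K) (trial L c N j (m + 1) K) =
      ((‖toFock (trial L c N j m K)‖ ^ 2 : ℝ) : ℂ) := by
  rw [(h.mono (Nat.le_succ m)).norm_trial_sq, trial, ip_sum_left, Complex.ofReal_sum]
  refine Finset.sum_congr rfl fun μ hμ => ?_
  rw [ip_smul_left, ip_ket_left, Complex.conj_ofReal, h.trial_apply (configs_subset j m K hμ),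
    h.amplitude_succ (mem_configs.1 hμ).1, ← Complex.ofReal_mul, sq]

/-- A vector `v` close to a multiple of the trial state with `m + 1` pairs of modes and a vector
`ψ` close to the one with `m` pairs: the scalar product is close to the product of the vacuum
components. -/
theorem Admissible.norm_ip_sub_le (h : Admissible L c j (m + 1)) {N K : ℕ} {ψ v : FinFock d}
    {δ ε : ℝ} {a : ℂ} (hψ : ‖toFock (ψ - trial L c N j m K)‖ ≤ δ)
    (hv : ‖toFock (v - a • trial L c N j (m + 1) K)‖ ≤ ε) :
    ‖ip ψ v - a * ((‖toFock (trial L c N j m K)‖ ^ 2 : ℝ) : ℂ)‖ ≤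
      ‖toFock (trial L c N j m K)‖ * ε + δ * ‖toFock v‖ := by
  set t := trial L c N j m K
  set t' := trial L c N j (m + 1) K
  have e : ip ψ v - a * ((‖toFock t‖ ^ 2 : ℝ) : ℂ) = ip t (v - a • t') + ip (ψ - t) v := by
    rw [ip_sub_right, ip_sub_left, ip_smul_right, h.ip_trial_succ]
    ring
  rw [e]
  refine (norm_add_le _ _).trans (add_le_add ((norm_ip_le _ _).trans ?_)
    ((norm_ip_le _ _).trans ?_)) <;> gcongr

/-- The other pairs exchange particles with the zero mode only, diagonal terms move nothing, and `W`
empties the modes `±j (m + 1)`; the removed `W*` is the only term filling them. -/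
theorem Admissible.split_shifted (h : Admissible L c j (m + 1)) (N s : ℕ) {v : FinFock d}
    (hv : v ∈ lowSpace N (j (m + 1)) s) :
    (shifted L c N j (m + 1) - Wstar c N (j (m + 1))) v ∈ lowSpace N (j (m + 1)) s := by
  have hm : m + 1 ∈ Finset.Icc 1 (m + 1) := by simp
  have hq0 := h.ne_zero _ hm
  have hqq := ne_neg_of_ne_zero hq0
  have e : shifted L c N j (m + 1) - Wstar c N (j (m + 1)) = freeKin L j (m + 1) +
      (∑ l ∈ Finset.Icc 1 m, HhatBog L c N (j l)) + H0 L c N (j (m + 1)) + W c N (j (m + 1)) +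
      diag (fun _ => -(zBog L c N j (m + 1) : ℂ)) := by
    refine LinearMap.ext fun v => Finsupp.ext fun n => ?_
    rw [shifted, HBog, Finset.sum_Icc_succ_top (by omega : 1 ≤ m + 1), HhatBog]
    simp only [LinearMap.sub_apply, LinearMap.add_apply, Finsupp.add_apply, Finsupp.sub_apply,
      LinearMap.smul_apply, Module.End.one_apply, Finsupp.smul_apply, diag_apply, smul_eq_mul]
    ring
  rw [e, mem_lowSpace]
  rw [mem_lowSpace] at hv
  intro n hn
  rcases apply_add_ne hn with hn | hn
  · rcases apply_add_ne hn with hn | hn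
    · rcases apply_add_ne hn with hn | hn
      · rcases apply_add_ne hn with hn | hn
        · rw [freeKin_eq_diag] at hn
          exact hv n (diag_moves hn)
        · rw [LinearMap.sum_apply, Finsupp.finsetSum_apply] at hn
          obtain ⟨l, hl, hn⟩ := Finset.exists_ne_zero_of_sum_ne_zero hn
          obtain ⟨n', h1, rfl | h2⟩ := HhatBog_moves hn
          · exact hv n h1
          · have hl2 := Finset.Icc_subset_Icc_right (Nat.le_succ m) hl
            have hne : l ≠ m + 1 := by
              rw [Finset.mem_Icc] at hl
              omega
            obtain ⟨a1, a2, a3, a4⟩ := h.pair_apply hm hl2 hne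
            obtain ⟨h3, h4⟩ := hv n' h1
            refine ⟨h2.degree.trans h3, ?_⟩
            rcases h2 with h2 | h2 <;>
            · have e1 := DFunLike.congr_fun h2 (j (m + 1))
              have e2 := DFunLike.congr_fun h2 (-j (m + 1))
              simp only [Finsupp.add_apply, Finsupp.single_apply, a1.symm, a2.symm, a3.symm,
                a4.symm, hq0.symm, (neg_ne_zero.2 hq0).symm, if_false] at e1 e2
              omega
      · rw [H0_eq_diag] at hn
        exact hv n (diag_moves hn)
    · obtain ⟨n', h1, h2⟩ := W_moves hn
      obtain ⟨h3, h4⟩ := hv n' h1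
      refine ⟨(PairMove.degree (Or.inl h2)).trans h3, ?_⟩
      have e1 := DFunLike.congr_fun h2 (j (m + 1))
      have e2 := DFunLike.congr_fun h2 (-j (m + 1))
      simp [hqq, hqq.symm, Ne.symm hq0, neg_ne_zero.2 hq0] at e1 e2
      omega
  · exact hv n (diag_moves hn)

/-- Vectors of low energy are determined by their vacuum component. -/
theorem Admissible.low_energy_eq_zero (h : Admissible L c j m) : ∀ᶠ N : ℕ in atTop,
    ∀ v ∈ nParticle d N, v (fillZero N 0) = 0 → (ip v (shifted L c N j m v)).re ≤ 0 → v = 0 := by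
  obtain ⟨R, hR, hev⟩ := h.low_energy_vac
  filter_upwards [hev] with N hN v hv h0 hle
  rw [form_shifted] at hle
  have := hN v hv (by linarith)
  rw [h0, norm_zero, mul_zero] at this
  exact norm_toFock_eq_zero.1 (le_antisymm this (norm_nonneg _))

/-- A combination of two kernel vectors can be given vanishing vacuum component, and is then zero by
`Admissible.low_energy_eq_zero`. -/
theorem Admissible.kernel_unique (h : Admissible L c j m) : ∀ᶠ N : ℕ in atTop,
    ∀ v ∈ nParticle d N, ∀ w ∈ nParticle d N, w ≠ 0 → shifted L c N j m v = 0 →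
      shifted L c N j m w = 0 → ∃ t : ℂ, v = t • w := by
  filter_upwards [h.low_energy_eq_zero] with N hN v hv w hw hw0 hAv hAw
  have h0 : w (fillZero N 0) ≠ 0 := fun h' =>
    hw0 (hN w hw h' (by rw [hAw, ip_zero_right, Complex.zero_re]))
  refine ⟨v (fillZero N 0) / w (fillZero N 0), sub_eq_zero.1 (hN _ ?_ ?_ ?_)⟩
  · exact Submodule.sub_mem _ hv (Submodule.smul_mem _ _ hw)
  · rw [Finsupp.sub_apply, Finsupp.smul_apply, smul_eq_mul, div_mul_cancel₀ _ h0, sub_self]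
  · rw [map_sub, map_smul, hAv, hAw, smul_zero, sub_zero, ip_zero_right, Complex.zero_re]

theorem Admissible.exists_kernel (h : Admissible L c j m) : ∀ᶠ N : ℕ in atTop,
    ∃ w ∈ sector (insert 0 (pairModes j m)) N, w ≠ 0 ∧ shifted L c N j m w = 0 := by
  filter_upwards [h.exists_ground, eventually_gt_atTop 0] with N hN h0
  obtain ⟨w, hw, hw1, hw2⟩ := hN
  refine ⟨w, hw, ?_, ?_⟩
  · rintro rfl
    simp at hw1
  · rw [shifted_apply, sub_eq_zero]
    refine eigen_of_form_min (isAdj_HBog L c N j m h.ne_zero)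
      (HBog_mem_sectorAlg L c N j m _ subset_rfl N)
      (fun u hu => h.zBog_mul_le h0 (sector_le_nParticle _ _ hu)) hw ?_
    rw [hw1, hw2, one_pow, mul_one]

/-- `ψ N` is asymptotically the Bogoliubov state of the first `m` pairs of modes. -/
def BogLimit (L : ℝ) (c : Mode d → ℝ) (j : ℕ → Mode d) (m : ℕ) (ψ : ℕ → FinFock d) : Prop :=
  ∀ δ > 0, ∃ K₀, ∀ K ≥ K₀, ∀ᶠ N : ℕ in atTop, Even N →
    ‖toFock (ψ N - trial L c N j m K)‖ ≤ δ

theorem BogLimit.ne_zero (h : Admissible L c j m) {ψ : ℕ → FinFock d}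
    (hψ : BogLimit L c j m ψ) : ∀ᶠ N : ℕ in atTop, Even N → ψ N ≠ 0 := by
  obtain ⟨K, hK⟩ := hψ (1 / 2) (by norm_num)
  filter_upwards [hK K le_rfl] with N hN he h0
  have := h.one_le_norm_trial K N
  have h1 := hN he
  rw [h0, zero_sub, map_neg, norm_neg] at h1
  linarith

/-- Since `v` is close to a multiple of `trial` for `m + 1` pairs, `⟨ψ, v⟩` is close to the vacuum
component of `v` times `‖trial‖²` for `m` pairs. Orthogonality makes that component small, while
`low_energy_vac` says that it dominates `‖v‖`. -/
theorem BogLimit.pos_orth (h : Admissible L c j (m + 1)) {ψ : ℕ → FinFock d}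
    (hψ : BogLimit L c j m ψ) : ∀ᶠ N : ℕ in atTop, Even N → ∀ v ∈ nParticle d N,
      ip (ψ N) v = 0 → (ip v (shifted L c N j (m + 1) v)).re ≤ 0 → v = 0 := by
  obtain ⟨R, hR, hev⟩ := h.low_energy_vac
  -- Two errors of size `‖v‖ / (4R)` bound the vacuum component by `‖v‖ / (2R)`, whence `‖v‖ ≤ ‖v‖ /
  -- 2`.
  have hδ : 0 < 1 / (4 * R) := by positivity
  obtain ⟨K₁, h1⟩ := h.low_energy_close hδ
  obtain ⟨K₂, h2⟩ := hψ _ hδ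
  set K := max K₁ K₂
  filter_upwards [hev, h1 K (le_max_left _ _), h2 K (le_max_right _ _)] with N g0 g1 g2 he v hv
    horth hle
  rw [form_shifted] at hle
  have hle' : (ip v (HBog L c N j (m + 1) v)).re ≤ zBog L c N j (m + 1) * ‖toFock v‖ ^ 2 := by
    linarith
  have f0 := g0 v hv hle'
  have f1 := h.norm_ip_sub_le (g2 he) (g1 v hv hle')
  have hs := (h.mono (Nat.le_succ m)).one_le_norm_trial K N
  set s := ‖toFock (trial L c N j m K)‖
  set x := ‖toFock v‖
  rw [horth, zero_sub, norm_neg, norm_mul, Complex.norm_real, Real.norm_of_nonneg (by positivity)]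
    at f1
  set a := ‖v (fillZero N 0)‖
  have hx : 0 ≤ x := norm_nonneg _
  have ha : 0 ≤ a := norm_nonneg _
  have f2 : a * s ^ 2 ≤ s * (x / (2 * R)) := by
    have : 1 / (4 * R) * x ≤ s * (1 / (4 * R) * x) := le_mul_of_one_le_left (by positivity) hs
    calc a * s ^ 2 ≤ s * (1 / (4 * R) * x) + s * (1 / (4 * R) * x) := f1.trans (by gcongr)
      _ = _ := by field_simp; ring
  have f3 : a * s ≤ x / (2 * R) := by
    have hs0 : 0 < s := by linarith
    refine le_of_mul_le_mul_left ?_ hs0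
    linarith [show s * (a * s) = a * s ^ 2 by ring]
  have f4 : a ≤ x / (2 * R) := (le_mul_of_one_le_right ha hs).trans f3
  have f5 : R * a ≤ x / 2 := by
    calc R * a ≤ R * (x / (2 * R)) := by gcongr
      _ = _ := by field_simp
  exact norm_toFock_eq_zero.1 (by linarith)

/-- The hypotheses of the flow hold for large particle numbers. -/
theorem BogLimit.flowData (h : Admissible L c j (m + 1)) {ψ : ℕ → FinFock d}
    (hψ : BogLimit L c j m ψ)
    (hmem : ∀ᶠ N : ℕ in atTop, Even N → ψ N ∈ sector (insert 0 (pairModes j m)) N) :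
    ∀ᶠ N : ℕ in atTop, Even N → FlowData (insert 0 (pairModes j (m + 1))) c N (N / 2) (j (m + 1))
      (shifted L c N j (m + 1)) (ψ N) := by
  filter_upwards [hmem, hψ.pos_orth h, hψ.ne_zero (h.mono (Nat.le_succ m)), h.low_energy_eq_zero,
    h.exists_kernel, eventually_gt_atTop 0] with N g1 g2 g3 g4 g5 g6 he
  obtain ⟨k, hk⟩ := he
  have he : Even N := ⟨k, hk⟩
  obtain ⟨w, hw, hw0, hw1⟩ := g5
  have hadj : IsAdj (shifted L c N j (m + 1)) (shifted L c N j (m + 1)) :=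
    (isAdj_HBog L c N j (m + 1) h.ne_zero).sub (IsAdj.one.real_smul _)
  refine ⟨by omega, by omega, h.ne_zero _ (by simp), hadj,
    sub_mem_sectorAlg (HBog_mem_sectorAlg L c N j (m + 1)) (Subalgebra.smul_mem _ (one_mem _) _),
    fun s v hv => h.split_shifted N s hv, ?_, g4, g2 he, ?_, ?_, g3 he,
    ⟨w, sector_le_nParticle _ _ hw, hw0, hw1⟩⟩
  · intro v hv
    rw [shifted_apply]
    exact Submodule.sub_mem _ (HBog_mem_nParticle hv) (Submodule.smul_mem _ _ hv)
  · rw [mem_sector]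
    intro n hn
    obtain ⟨h1, h2⟩ := mem_sector.1 (g1 he) n hn
    exact ⟨h1.trans (Finset.insert_subset_insert _ (pairModes_subset j m)), h2⟩
  · rw [mem_lowSpace]
    intro n hn
    obtain ⟨h1, h2⟩ := mem_sector.1 (g1 he) n hn
    have hq0 := h.ne_zero (m + 1) (by simp)
    have e1 : n (j (m + 1)) = 0 := Finsupp.notMem_support_iff.1 fun h' => by
      rcases Finset.mem_insert.1 (h1 h') with h' | h'
      · exact hq0 h'
      · exact h.notMem_pairModes.1 h'
    have e2 : n (-j (m + 1)) = 0 := Finsupp.notMem_support_iff.1 fun h' => by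
      rcases Finset.mem_insert.1 (h1 h') with h' | h'
      · exact neg_ne_zero.2 hq0 h'
      · exact h.notMem_pairModes.2 h'
    exact ⟨h2, by omega⟩

/-! ### Passing from `m` to `m + 1` pairs of modes -/

theorem abs_sq_sub_sq_le {p s ε : ℝ} (hp : 0 ≤ p) (hs : 1 ≤ s) (hε : ε ≤ 1)
    (h : |p - s| ≤ ε) : |p ^ 2 - s ^ 2| ≤ 3 * ε * s ^ 2 := by
  have hε0 : 0 ≤ ε := (abs_nonneg _).trans h
  have hp2 : p ≤ s + ε := by linarith [(abs_le.1 h).2]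
  have hss : s ≤ s ^ 2 := by nlinarith
  rw [sq_sub_sq, abs_mul, abs_of_nonneg (by linarith : 0 ≤ p + s)]
  calc (p + s) * |p - s| ≤ (3 * s) * ε := by
        apply mul_le_mul _ h (abs_nonneg _) (by linarith)
        linarith
    _ ≤ 3 * s ^ 2 * ε := by gcongr
    _ = _ := by ring

/-- Applied with `x = ‖ψ'‖`, `α = |a|`, `b = |a - 1|` and `τ = ‖trial‖`, where `a` is the vacuum
component of `ψ'`. The bounds are circular, since `b` is controlled by `x`, `x` by `α` and `α` by
`b`; smallness of `ε` turns the loop into a contraction with `α ≤ 2`. -/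
theorem close_bound {R ε x α b τ : ℝ} (hR : 0 < R) (hε : 0 ≤ ε) (hε1 : ε ≤ 1 / 12)
    (hε2 : ε * (8 * R) ≤ 1) (hα : 0 ≤ α) (hb : 0 ≤ b) (f0 : x ≤ R * α)
    (f5 : b ≤ 2 * ε * x + 3 * ε) (f6 : α ≤ 1 + b) (f7 : 1 ≤ α + b)
    (f8 : α * τ ≤ x + ε * x) : ε * x + b * τ ≤ ε * (8 * R ^ 2 + 8 * R) := by
  have g1 : 2 * ε * x ≤ α / 4 := by
    calc 2 * ε * x ≤ 2 * ε * (R * α) := by gcongr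
      _ = (ε * (8 * R)) * (α / 4) := by ring
      _ ≤ 1 * (α / 4) := by gcongr
      _ = _ := one_mul _
  have g2 : α ≤ 2 := by linarith
  have g3 : x ≤ R * 2 := f0.trans (by gcongr)
  have g4 : 0 < α := by linarith
  have g5 : τ ≤ 2 * R := by
    refine le_of_mul_le_mul_left ?_ g4
    have : (1 + ε) * x ≤ (1 + ε) * (R * α) := by gcongr
    have h2 : (1 + ε) * (R * α) ≤ 2 * (R * α) := by gcongr; linarith
    linarith
  calc ε * x + b * τ ≤ ε * (R * 2) + (2 * ε * (R * 2) + 3 * ε) * (2 * R) := by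
        have h1 : b * τ ≤ b * (2 * R) := by gcongr
        have h2 : b * (2 * R) ≤ (2 * ε * (R * 2) + 3 * ε) * (2 * R) := by
          gcongr
          exact f5.trans (by gcongr)
        have h3 : ε * x ≤ ε * (R * 2) := by gcongr
        linarith
    _ = _ := by ring

/-- Kernel vectors normalized by their scalar product with `ψ N` are again asymptotically
Bogoliubov states, with one more pair of modes. -/
theorem BogLimit.succ (h : Admissible L c j (m + 1)) {ψ ψ' : ℕ → FinFock d}
    (hψ : BogLimit L c j m ψ)
    (hψ' : ∀ᶠ N : ℕ in atTop, Even N → ψ' N ∈ nParticle d N ∧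
      shifted L c N j (m + 1) (ψ' N) = 0 ∧ ip (ψ N) (ψ' N) = ip (ψ N) (ψ N)) :
    BogLimit L c j (m + 1) ψ' := by
  intro δ hδ
  obtain ⟨R, hR, hev⟩ := h.low_energy_vac
  -- The first two conditions close the loop in `close_bound`; the last makes its conclusion at most
  -- `δ`.
  obtain ⟨ε, hε0, hε1, hε2, hε3⟩ : ∃ ε : ℝ, 0 < ε ∧ ε ≤ 1 / 12 ∧ ε * (8 * R) ≤ 1 ∧
      ε * (8 * R ^ 2 + 8 * R) ≤ δ := by
    refine ⟨min (1 / 12) (min (1 / (8 * R)) (δ / (8 * R ^ 2 + 8 * R))), by positivity,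
      min_le_left _ _, ?_, ?_⟩
    · rw [← le_div_iff₀ (by positivity)]
      exact (min_le_right _ _).trans (min_le_left _ _)
    · rw [← le_div_iff₀ (by positivity)]
      exact (min_le_right _ _).trans (min_le_right _ _)
  obtain ⟨K₁, h1⟩ := h.low_energy_close hε0
  obtain ⟨K₂, h2⟩ := hψ _ hε0
  refine ⟨max K₁ K₂, fun K hK => ?_⟩
  filter_upwards [hev, h1 K ((le_max_left _ _).trans hK), h2 K ((le_max_right _ _).trans hK), hψ']
    with N g0 g1 g2 g3 he
  obtain ⟨hv, hA, hip⟩ := g3 he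
  have hle' : (ip (ψ' N) (HBog L c N j (m + 1) (ψ' N))).re ≤
      zBog L c N j (m + 1) * ‖toFock (ψ' N)‖ ^ 2 := by
    have := form_shifted L c N j (m + 1) (ψ' N)
    rw [hA, ip_zero_right, Complex.zero_re] at this
    linarith
  have f0 := g0 _ hv hle'
  have f1 := g1 _ hv hle'
  have f2 := h.norm_ip_sub_le (g2 he) f1
  have f3 := g2 he
  have hs := (h.mono (Nat.le_succ m)).one_le_norm_trial K N
  set t := trial L c N j m K
  set t' := trial L c N j (m + 1) K
  set s := ‖toFock t‖
  set x := ‖toFock (ψ' N)‖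
  set a := ψ' N (fillZero N 0)
  have hx : 0 ≤ x := norm_nonneg _
  have hs0 : 0 < s := by linarith
  have n1 : |‖toFock (ψ N)‖ - s| ≤ ε := by
    refine le_trans ?_ f3
    rw [map_sub]
    exact abs_norm_sub_norm_le _ _
  have n2 : |‖toFock (ψ N)‖ ^ 2 - s ^ 2| ≤ 3 * ε * s ^ 2 :=
    abs_sq_sub_sq_le (norm_nonneg _) hs (by linarith) n1
  -- The normalization `⟨ψ, ψ'⟩ = ‖ψ‖²` is compared with `⟨ψ, ψ'⟩ ≈ a s²` and `‖ψ‖² ≈ s²`, which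
  -- pins `a` near `1`.
  have f4 : ‖a - 1‖ * s ^ 2 ≤ (2 * ε * x + 3 * ε) * s ^ 2 := by
    have e : (a - 1) * ((s ^ 2 : ℝ) : ℂ) = -(ip (ψ N) (ψ' N) - a * ((s ^ 2 : ℝ) : ℂ)) +
        ((‖toFock (ψ N)‖ ^ 2 - s ^ 2 : ℝ) : ℂ) := by
      rw [hip, ip_self, Complex.ofReal_sub]
      ring
    have e2 : ‖a - 1‖ * s ^ 2 = ‖(a - 1) * ((s ^ 2 : ℝ) : ℂ)‖ := by
      rw [norm_mul, Complex.norm_real, Real.norm_of_nonneg (by positivity)]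
    rw [e2, e]
    refine (norm_add_le _ _).trans ?_
    rw [norm_neg, Complex.norm_real, Real.norm_eq_abs]
    have b1 : s ≤ s ^ 2 := by nlinarith
    have b2 : 1 ≤ s ^ 2 := by nlinarith
    have b3 : s * (ε * x) ≤ s ^ 2 * (ε * x) := by gcongr
    have b4 : 1 * (ε * x) ≤ s ^ 2 * (ε * x) := by gcongr
    linarith
  have f5 : ‖a - 1‖ ≤ 2 * ε * x + 3 * ε := le_of_mul_le_mul_right f4 (by positivity)
  have f6 : ‖a‖ ≤ 1 + ‖a - 1‖ := by
    calc ‖a‖ = ‖1 + (a - 1)‖ := by rw [add_sub_cancel]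
      _ ≤ _ := (norm_add_le _ _).trans (by rw [norm_one])
  have f7 : (1 : ℝ) ≤ ‖a‖ + ‖a - 1‖ := by
    calc (1 : ℝ) = ‖a - (a - 1)‖ := by rw [sub_sub_cancel, norm_one]
      _ ≤ _ := norm_sub_le _ _
  have f8 : ‖a‖ * ‖toFock t'‖ ≤ x + ε * x := by
    rw [← norm_smul, ← map_smul]
    have e : a • t' = ψ' N - (ψ' N - a • t') := by rw [sub_sub_cancel]
    rw [e, map_sub]
    exact (norm_sub_le _ _).trans (by linarith)
  have e : ψ' N - t' = (ψ' N - a • t') + (a - 1) • t' := by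
    rw [sub_smul, one_smul, sub_add_sub_cancel]
  rw [e, map_add, map_smul]
  refine (norm_add_le _ _).trans ?_
  rw [norm_smul]
  have := close_bound hR hε0.le hε1 hε2 (norm_nonneg a) (norm_nonneg (a - 1)) f0 f5 f6 f7 f8
  linarith

theorem Admissible.isGroundState (h : Admissible L c j m) : ∀ᶠ N : ℕ in atTop,
    ∀ v ∈ nParticle d N, v ≠ 0 → shifted L c N j m v = 0 →
      IsGroundState N (HBog L c N j m) (zBog L c N j m) v := by
  filter_upwards [h.kernel_unique, h.exists_ground, eventually_gt_atTop 0] with N g1 g2 g3 v hv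
    h0 hA
  obtain ⟨w, hw, hw1, hw2⟩ := g2
  refine ⟨hv, h0, sub_eq_zero.1 hA,
    ⟨⟨w, sector_le_nParticle _ _ hw, hw1, hw2.symm⟩, ?_⟩, ?_⟩
  · rintro x ⟨u, hu, hu1, rfl⟩
    have := h.zBog_mul_le g3 hu
    rwa [hu1, one_pow, mul_one] at this
  · intro u hu hu1
    exact g1 u hu v hv h0 (sub_eq_zero.2 hu1) hA

/-- The reconstructed vectors are asymptotically the Bogoliubov states. -/
theorem Admissible.psiBog_limit (h : Admissible L c j m) :
    BogLimit L c j m (fun N => psiBog L c N j m) ∧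
    ∀ᶠ N : ℕ in atTop, Even N → psiBog L c N j m ∈ sector (insert 0 (pairModes j m)) N := by
  induction m with
  | zero =>
    constructor
    · intro δ hδ
      refine ⟨0, fun K _ => Eventually.of_forall fun N _ => ?_⟩
      change ‖toFock (eta d N - _)‖ ≤ δ
      rw [trial_zero, sub_self, map_zero, norm_zero]
      exact hδ.le
    · refine Eventually.of_forall fun N _ => ?_
      change eta d N ∈ _
      rw [eta_eq]
      exact vac_mem_sector j 0 N
  | succ m ih =>
    obtain ⟨ih1, ih2⟩ := ih (h.mono (Nat.le_succ m))
    have hspec := (ih1.flowData h ih2).mono fun N hN he => (hN he).gsT_spec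
    refine ⟨ih1.succ h hspec, ?_⟩
    filter_upwards [hspec, h.kernel_unique, h.exists_kernel] with N g1 g2 g3 he
    obtain ⟨w, hw, hw0, hw1⟩ := g3
    obtain ⟨h1, h2, -⟩ := g1 he
    -- Uniqueness of the kernel transfers the support property from the ground state found in the
    -- sector, without following the supports through the flow.
    obtain ⟨t, ht⟩ := g2 _ h1 w (sector_le_nParticle _ _ hw) hw0 h2 hw1
    change gsT c N (j (m + 1)) (shifted L c N j (m + 1)) (psiBog L c N j m) (psiBog L c N j m) ∈ _
    rw [ht]
    exact Submodule.smul_mem _ _ hw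

/-- The flow is defined, its final operator vanishes, and it yields the ground state. -/
theorem Admissible.flow_spec (h : Admissible L c j m) (hm : 1 ≤ m) : ∀ᶠ N : ℕ in atTop,
    Even N → FlowDefined N (j m) (shifted L c N j m) (psiBog L c N j (m - 1)) ∧
      kappaFinal N (j m) (shifted L c N j m) (psiBog L c N j (m - 1)) = 0 ∧
      IsGroundState N (HBog L c N j m) (zBog L c N j m) (psiBog L c N j m) := by
  obtain ⟨m, rfl⟩ := Nat.exists_eq_add_of_le' hm
  obtain ⟨ih1, ih2⟩ := (h.mono (Nat.le_succ m)).psiBog_limit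
  filter_upwards [ih1.flowData h ih2, h.isGroundState, h.psiBog_limit.1.ne_zero h] with N g1 g2 g3
    he
  have D := g1 he
  obtain ⟨h1, h2, -⟩ := D.gsT_spec
  exact ⟨D.flowDefined, D.kappaFinal_eq_zero, g2 _ h1 (g3 he) h2⟩

end Bogoliubov

end

noncomputable section

namespace Bogoliubov

open Filter Topology

variable {d : ℕ} {L : ℝ} {c : Mode d → ℝ} {j : ℕ → Mode d} {m : ℕ}

/-! ## Bare expressions in the limit of many particles -/

theorem isUnit_diag {g : Occ d → ℂ} (hg : ∀ n, g n ≠ 0) : IsUnit (diag g) := by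
  refine ⟨⟨diag g, diag (fun n => (g n)⁻¹), ?_, ?_⟩, rfl⟩ <;> rw [diag_mul, one_eq_diag] <;>
    congr 1 <;> funext n
  · exact mul_inv_cancel₀ (hg n)
  · exact inv_mul_cancel₀ (hg n)

theorem inverse_diag {g : Occ d → ℂ} (hg : ∀ n, g n ≠ 0) :
    Ring.inverse (diag g) = diag (fun n => (g n)⁻¹) := by
  have h1 : diag (fun n => (g n)⁻¹) * diag g = 1 := by
    rw [diag_mul, one_eq_diag]
    congr 1
    funext n
    exact inv_mul_cancel₀ (hg n)
  calc Ring.inverse (diag g) = diag (fun n => (g n)⁻¹) * (diag g * Ring.inverse (diag g)) := by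
        rw [← mul_assoc, h1, one_mul]
    _ = _ := by rw [Ring.mul_inverse_cancel _ (isUnit_diag hg), mul_one]

theorem H0_sub_eq_diag (L : ℝ) (c : Mode d → ℝ) (N : ℕ) (q : Mode d) :
    H0 L c N q - (EBog L c q : ℂ) • 1 = diag (fun n =>
      (((kSq L q + c q / N * n 0) * (n q + n (-q)) + 2 * rootB (c q) (kSq L q) : ℝ) : ℂ)) := by
  rw [H0_eq_diag, one_eq_diag, smul_diag, diag_sub, EBog_eq]
  congr 1
  funext n
  push_cast
  ring

/-- The free part is nonnegative and `-E^Bog = 2 rootB` is strictly positive, so the resolvent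
exists for every `N`. -/
theorem Admissible.resolvent_pos (h : Admissible L c j m) {l : ℕ} (hl : l ∈ Finset.Icc 1 m)
    {a b : ℝ} (ha : 0 ≤ a) (hb : 0 ≤ b) :
    0 < (kSq L (j l) + c (j l) * a) * b + 2 * rootB (c (j l)) (kSq L (j l)) := by
  have h1 := h.kSq_pos hl
  have h2 := h.pos l hl
  have h3 := rootB_pos h2 h1
  positivity

theorem Admissible.resolvent_ne (h : Admissible L c j m) {l : ℕ} (hl : l ∈ Finset.Icc 1 m)
    (N : ℕ) (n : Occ d) : ((((kSq L (j l) + c (j l) / N * n 0) * (n (j l) + n (-j l)) +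
      2 * rootB (c (j l)) (kSq L (j l)) : ℝ)) : ℂ) ≠ 0 := by
  rw [Complex.ofReal_ne_zero, div_mul_eq_mul_div, mul_div_assoc]
  exact (h.resolvent_pos hl (by positivity) (by positivity)).ne'

theorem Admissible.isUnit_resolvent (h : Admissible L c j m) {l : ℕ} (hl : l ∈ Finset.Icc 1 m)
    (N : ℕ) : IsUnit (H0 L c N (j l) - (EBog L c (j l) : ℂ) • 1) := by
  rw [H0_sub_eq_diag]
  exact isUnit_diag (h.resolvent_ne hl N)

/-- One particle in each of the modes `±q`. -/
def pairOcc (q : Mode d) : Occ d := Finsupp.single q 1 + Finsupp.single (-q) 1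

theorem degree_pairOcc (q : Mode d) : (pairOcc q).degree = 2 := by
  rw [pairOcc, map_add, degree_single, degree_single]

theorem pairOcc_apply_zero {q : Mode d} (hq : q ≠ 0) : pairOcc q 0 = 0 := by
  simp [pairOcc, hq]

theorem pairOcc_apply_self {q : Mode d} (hq : q ≠ 0) : pairOcc q q = 1 ∧ pairOcc q (-q) = 1 := by
  have h1 := ne_neg_of_ne_zero hq
  constructor
  · rw [pairOcc, Finsupp.add_apply, Finsupp.single_eq_same, Finsupp.single_eq_of_ne h1, add_zero]
  · rw [pairOcc, Finsupp.add_apply, Finsupp.single_eq_same, Finsupp.single_eq_of_ne h1.symm,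
      zero_add]

theorem pairOcc_le {q : Mode d} {μ : Occ d} (hq : q ≠ 0) (h1 : 0 < μ q) (h2 : 0 < μ (-q)) :
    pairOcc q ≤ μ := by
  have h3 := ne_neg_of_ne_zero hq
  intro x
  rw [pairOcc, Finsupp.add_apply, Finsupp.single_apply, Finsupp.single_apply]
  split_ifs with e1 e2 e2
  · exact absurd (e1.trans e2.symm) h3
  · subst e1; omega
  · subst e2; omega
  · omega

theorem Wstar_fillZero (c : Mode d → ℝ) {N : ℕ} {q : Mode d} (hq : q ≠ 0) {μ : Occ d}
    (hμ : μ 0 = 0) (h : μ.degree + 2 ≤ N) :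
    Wstar c N q (ket (fillZero N μ)) =
      ((c q / N * (Real.sqrt (μ q + 1) * Real.sqrt (μ (-q) + 1) *
        Real.sqrt ((N - μ.degree : ℕ) : ℝ) * Real.sqrt ((N - (μ.degree + 1) : ℕ) : ℝ)) : ℝ) : ℂ) •
      ket (fillZero N (μ + pairOcc q)) := by
  have hqq := ne_neg_of_ne_zero hq
  have hq' := neg_ne_zero.2 hq
  have e : fillZero N μ + Finsupp.single (-q) 1 + Finsupp.single q 1 - Finsupp.single 0 1 -
      Finsupp.single 0 1 = fillZero N (μ + pairOcc q) := by
    have : N - μ.degree = N - (μ.degree + 2) + 1 + 1 := by omega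
    rw [fillZero, fillZero, map_add, degree_pairOcc, this, Finsupp.single_add, Finsupp.single_add,
      pairOcc, show μ + (Finsupp.single 0 (N - (μ.degree + 2)) + Finsupp.single 0 1 +
        Finsupp.single 0 1) + Finsupp.single (-q) 1 + Finsupp.single q 1 =
        μ + (Finsupp.single q 1 + Finsupp.single (-q) 1) + Finsupp.single 0 (N - (μ.degree + 2)) +
        Finsupp.single 0 1 + Finsupp.single 0 1 by abel, add_tsub_cancel_right,
      add_tsub_cancel_right]
  have c1 : fillZero N μ (-q) = μ (-q) := fillZero_apply_ne N μ hq'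
  have c2 : (fillZero N μ + Finsupp.single (-q) 1 : Occ d) q = μ q := by
    rw [Finsupp.add_apply, fillZero_apply_ne N μ hq, Finsupp.single_eq_of_ne hqq, add_zero]
  have c3 : (fillZero N μ + Finsupp.single (-q) 1 + Finsupp.single q 1 : Occ d) 0 =
      N - μ.degree := by
    rw [Finsupp.add_apply, Finsupp.add_apply, fillZero_apply_zero N hμ,
      Finsupp.single_eq_of_ne hq'.symm, Finsupp.single_eq_of_ne hq.symm, add_zero, add_zero]
  have c4 : (fillZero N μ + Finsupp.single (-q) 1 + Finsupp.single q 1 - Finsupp.single 0 1 :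
      Occ d) 0 = N - (μ.degree + 1) := by
    rw [Finsupp.tsub_apply, c3, Finsupp.single_eq_same]
    omega
  rw [Wstar]
  simp only [LinearMap.smul_apply, Module.End.mul_apply, cre_ket, ann_ket, map_smul, smul_smul,
    c1, c2, c3, c4, e]
  congr 1
  push_cast
  ring

theorem W_fillZero (c : Mode d → ℝ) {N : ℕ} {q : Mode d} (hq : q ≠ 0) {μ : Occ d}
    (hμ : μ 0 = 0) (h : μ.degree ≤ N) :
    W c N q (ket (fillZero N μ)) =
      ((c q / N * (Real.sqrt (μ q) * Real.sqrt (μ (-q)) *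
        Real.sqrt (((N - μ.degree : ℕ) : ℝ) + (1 : ℕ)) *
        Real.sqrt (((N - μ.degree : ℕ) : ℝ) + (2 : ℕ))) : ℝ) : ℂ) •
      ket (fillZero N (μ - pairOcc q)) := by
  have hqq := ne_neg_of_ne_zero hq
  have hq' := neg_ne_zero.2 hq
  have c1 : fillZero N μ (-q) = μ (-q) := fillZero_apply_ne N μ hq'
  have c2 : (fillZero N μ - Finsupp.single (-q) 1 : Occ d) q = μ q := by
    rw [Finsupp.tsub_apply, fillZero_apply_ne N μ hq, Finsupp.single_eq_of_ne hqq, tsub_zero]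
  have c3 : (fillZero N μ - Finsupp.single (-q) 1 - Finsupp.single q 1 : Occ d) 0 =
      N - μ.degree := by
    rw [Finsupp.tsub_apply, Finsupp.tsub_apply, fillZero_apply_zero N hμ,
      Finsupp.single_eq_of_ne hq'.symm, Finsupp.single_eq_of_ne hq.symm, tsub_zero, tsub_zero]
  have c4 : (fillZero N μ - Finsupp.single (-q) 1 - Finsupp.single q 1 + Finsupp.single 0 1 :
      Occ d) 0 = N - μ.degree + 1 := by
    rw [Finsupp.add_apply, c3, Finsupp.single_eq_same]
  rw [W]
  simp only [LinearMap.smul_apply, Module.End.mul_apply, cre_ket, ann_ket, map_smul, smul_smul,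
    c1, c2, c3, c4]
  -- If one of the two modes is empty the configuration on the right is an artefact of truncated
  -- subtraction, but both sides have coefficient zero.
  by_cases h0 : 0 < μ q ∧ 0 < μ (-q)
  · have e : fillZero N μ - Finsupp.single (-q) 1 - Finsupp.single q 1 + Finsupp.single 0 1 +
        Finsupp.single 0 1 = fillZero N (μ - pairOcc q) := by
      obtain ⟨ν, rfl⟩ := exists_add_of_le (pairOcc_le hq h0.1 h0.2)
      rw [add_tsub_cancel_left, fillZero, fillZero]
      rw [map_add, degree_pairOcc] at h ⊢
      have : N - ν.degree = N - (2 + ν.degree) + 1 + 1 := by omega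
      rw [this, Finsupp.single_add 0 _ 1, Finsupp.single_add 0 _ 1, pairOcc,
        show Finsupp.single q 1 + Finsupp.single (-q) 1 + ν + Finsupp.single 0 (N - (2 + ν.degree))
          = ν + Finsupp.single 0 (N - (2 + ν.degree)) + Finsupp.single q 1 +
          Finsupp.single (-q) 1 by abel, add_tsub_cancel_right, add_tsub_cancel_right]
      abel
    rw [e]
    congr 1
    push_cast
    rw [show ((N - μ.degree : ℕ) : ℝ) + 1 + 1 = ((N - μ.degree : ℕ) : ℝ) + 2 by ring]
    ring
  · have : μ q = 0 ∨ μ (-q) = 0 := by omega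
    rcases this with h1 | h1 <;> simp [h1]

theorem resolvent_fillZero {N : ℕ} {q : Mode d} (hq : q ≠ 0) {μ : Occ d}
    (hμ : μ 0 = 0)
    (hne : ∀ n : Occ d, (((kSq L q + c q / N * n 0) * (n q + n (-q)) +
      2 * rootB (c q) (kSq L q) : ℝ) : ℂ) ≠ 0) :
    Ring.inverse (H0 L c N q - (EBog L c q : ℂ) • 1) (ket (fillZero N μ)) =
      ((((kSq L q + c q / N * (N - μ.degree : ℕ)) * (μ q + μ (-q)) +
      2 * rootB (c q) (kSq L q))⁻¹ : ℝ) : ℂ) • ket (fillZero N μ) := by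
  rw [H0_sub_eq_diag, inverse_diag hne, diag_ket, fillZero_apply_zero N hμ,
    fillZero_apply_ne N μ hq, fillZero_apply_ne N μ (neg_ne_zero.2 hq), Complex.ofReal_inv]

/-- `u N` converges to `f`, within a fixed finite set of occupation numbers of the nonzero
modes. -/
inductive Conv : (ℕ → FinFock d) → (Occ d →₀ ℝ) → Prop
  | zero : Conv (fun _ => 0) 0
  | add {u v : ℕ → FinFock d} {f g : Occ d →₀ ℝ} :
      Conv u f → Conv v g → Conv (fun N => u N + v N) (f + g)
  | term {a : ℕ → ℝ} {α : ℝ} {μ : Occ d} : μ 0 = 0 → Tendsto a atTop (𝓝 α) →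
      Conv (fun N => (a N : ℂ) • ket (fillZero N μ)) (Finsupp.single μ α)
  | congr {u v : ℕ → FinFock d} {f : Occ d →₀ ℝ} : u =ᶠ[atTop] v → Conv u f → Conv v f

/-- The state with `N` particles and given occupation numbers of the nonzero modes. -/
def embed (N : ℕ) (f : Occ d →₀ ℝ) : FinFock d := f.sum fun μ a => (a : ℂ) • ket (fillZero N μ)

theorem embed_single (N : ℕ) (μ : Occ d) (a : ℝ) :
    embed N (Finsupp.single μ a) = (a : ℂ) • ket (fillZero N μ) := by
  rw [embed, Finsupp.sum_single_index]
  simp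

theorem embed_add (N : ℕ) (f g : Occ d →₀ ℝ) : embed N (f + g) = embed N f + embed N g := by
  rw [embed, Finsupp.sum_add_index'] <;> simp [embed, add_smul]

theorem embed_sub (N : ℕ) (f g : Occ d →₀ ℝ) : embed N (f - g) = embed N f - embed N g := by
  rw [eq_sub_iff_add_eq, ← embed_add, sub_add_cancel]

theorem embed_sum {ι : Type*} (N : ℕ) (s : Finset ι) (f : ι → Occ d →₀ ℝ) :
    embed N (∑ i ∈ s, f i) = ∑ i ∈ s, embed N (f i) := by
  classical
  induction s using Finset.induction_on with
  | empty => simp [embed]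
  | insert i s hi ih => rw [Finset.sum_insert hi, Finset.sum_insert hi, embed_add, ih]

theorem norm_toFock_ket (n : Occ d) : ‖toFock (ket n)‖ = 1 := by
  have h := ip_self (ket n)
  rw [ip_ket_left, ket_apply, if_pos rfl] at h
  have h2 : (1 : ℝ) = ‖toFock (ket n)‖ ^ 2 := by exact_mod_cast h
  exact (pow_eq_one_iff_of_nonneg (norm_nonneg _) two_ne_zero).1 h2.symm

theorem norm_embed_le (N : ℕ) (f : Occ d →₀ ℝ) : ‖toFock (embed N f)‖ ≤ f.sum fun _ a => |a| := by
  rw [embed, Finsupp.sum, map_sum]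
  refine (norm_sum_le _ _).trans (Finset.sum_le_sum fun μ _ => ?_)
  rw [map_smul, norm_smul, norm_toFock_ket, mul_one, Complex.norm_real, Real.norm_eq_abs]

theorem Conv.tendsto {u : ℕ → FinFock d} {f : Occ d →₀ ℝ} (h : Conv u f) :
    Tendsto (fun N => ‖toFock (u N - embed N f)‖) atTop (𝓝 0) := by
  induction h with
  | zero => simp [embed]
  | @add u v f g _ _ hf hg =>
    refine squeeze_zero (fun _ => norm_nonneg _) (fun N => ?_) (by simpa only [add_zero] using hf.add hg)
    rw [embed_add, show u N + v N - (embed N f + embed N g) =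
      (u N - embed N f) + (v N - embed N g) by abel, map_add]
    exact norm_add_le (toFock (u N - embed N f)) (toFock (v N - embed N g))
  | @term a α μ _ ha =>
    have : ∀ N, ‖toFock ((a N : ℂ) • ket (fillZero N μ) - embed N (Finsupp.single μ α))‖ =
        |a N - α| := by
      intro N
      rw [embed_single, ← sub_smul, map_smul, norm_smul, norm_toFock_ket, mul_one,
        ← Complex.ofReal_sub, Complex.norm_real, Real.norm_eq_abs]
    simp only [this]
    have := (ha.sub_const α).abs
    simpa using this
  | congr huv _ ih =>
    refine ih.congr' ?_
    filter_upwards [huv] with N hN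
    rw [hN]

/-- Convergent sequences are generated by single terms with convergent coefficients, so a limit of
operators is determined by their action on those terms. -/
theorem Conv.map {T : ℕ → Op d} {T' : (Occ d →₀ ℝ) →ₗ[ℝ] (Occ d →₀ ℝ)}
    (hT : ∀ (a : ℕ → ℝ) (α : ℝ) (μ : Occ d), μ 0 = 0 → Tendsto a atTop (𝓝 α) →
      Conv (fun N => T N ((a N : ℂ) • ket (fillZero N μ))) (T' (Finsupp.single μ α)))
    {u : ℕ → FinFock d} {f : Occ d →₀ ℝ} (h : Conv u f) : Conv (fun N => T N (u N)) (T' f) := by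
  induction h with
  | zero => simpa using Conv.zero
  | add _ _ h1 h2 => simpa using h1.add h2
  | term hμ ha => exact hT _ _ _ hμ ha
  | congr huv _ ih =>
    refine ih.congr ?_
    filter_upwards [huv] with N hN
    rw [hN]

theorem Conv.intCast_smul {u : ℕ → FinFock d} {f : Occ d →₀ ℝ} (h : Conv u f) (a : ℤ) :
    Conv (fun N => a • u N) (a • f) := by
  have := h.map (T := fun _ => (a : Op d)) (T' := (a : Module.End ℝ (Occ d →₀ ℝ)))
    fun b β μ hμ hb => by
      rw [Module.End.intCast_apply, ← Int.cast_smul_eq_zsmul ℝ, Finsupp.smul_single, smul_eq_mul]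
      refine (Conv.term hμ (hb.const_mul (a : ℝ))).congr (Eventually.of_forall fun N => ?_)
      dsimp only
      rw [Module.End.intCast_apply, ← Int.cast_smul_eq_zsmul ℂ, smul_smul, Complex.ofReal_mul,
        Complex.ofReal_intCast]
  simpa [Module.End.intCast_apply] using this

/-- Limit of `W*_q + W_q`. -/
def limX (c : Mode d → ℝ) (q : Mode d) : Module.End ℝ (Occ d →₀ ℝ) :=
  Finsupp.linearCombination ℝ fun μ : Occ d =>
    Finsupp.single (μ + pairOcc q) (c q * (Real.sqrt (μ q + 1) * Real.sqrt (μ (-q) + 1))) +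
    Finsupp.single (μ - pairOcc q) (c q * (Real.sqrt (μ q) * Real.sqrt (μ (-q))))

/-- Limits of the eigenvalues of the resolvent of `Ĥ⁰_q` at `E^{Bog}_q`. -/
def limRes (L : ℝ) (c : Mode d → ℝ) (q : Mode d) (n : ℕ) : ℝ :=
  ((kSq L q + c q) * n + 2 * rootB (c q) (kSq L q))⁻¹

/-- Limit of the resolvent of `Ĥ⁰_q` at `E^{Bog}_q`. -/
def limR (L : ℝ) (c : Mode d → ℝ) (q : Mode d) : Module.End ℝ (Occ d →₀ ℝ) :=
  Finsupp.linearCombination ℝ fun μ : Occ d => Finsupp.single μ (limRes L c q (μ q + μ (-q)))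

theorem limX_single (c : Mode d → ℝ) (q : Mode d) (μ : Occ d) (a : ℝ) :
    limX c q (Finsupp.single μ a) =
      Finsupp.single (μ + pairOcc q) (a * (c q * (Real.sqrt (μ q + 1) * Real.sqrt (μ (-q) + 1)))) +
      Finsupp.single (μ - pairOcc q) (a * (c q * (Real.sqrt (μ q) * Real.sqrt (μ (-q))))) := by
  rw [limX, Finsupp.linearCombination_single, smul_add, Finsupp.smul_single, Finsupp.smul_single,
    smul_eq_mul, smul_eq_mul]

theorem limR_single (L : ℝ) (c : Mode d → ℝ) (q : Mode d) (μ : Occ d) (a : ℝ) :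
    limR L c q (Finsupp.single μ a) = Finsupp.single μ (a * limRes L c q (μ q + μ (-q))) := by
  simp [limR]

theorem conv_X (c : Mode d → ℝ) {q : Mode d} (hq : q ≠ 0) {a : ℕ → ℝ} {α : ℝ} {μ : Occ d}
    (hμ : μ 0 = 0) (ha : Tendsto a atTop (𝓝 α)) :
    Conv (fun N => (Wstar c N q + W c N q) ((a N : ℂ) • ket (fillZero N μ)))
      (limX c q (Finsupp.single μ α)) := by
  -- The prefactor `1/N` of the interaction is split between the two zero mode factors, each of size
  -- `√N`.
  have key : ∀ x y : ℕ → ℝ, Tendsto (fun N : ℕ => x N / Real.sqrt N) atTop (𝓝 1) →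
      Tendsto (fun N : ℕ => y N / Real.sqrt N) atTop (𝓝 1) → ∀ b : ℝ,
      Tendsto (fun N : ℕ => a N * (c q / N * (b * x N * y N))) atTop (𝓝 (α * (c q * b))) := by
    intro x y hx hy b
    have h1 := ha.mul ((hx.mul hy).const_mul (c q * b))
    rw [mul_one, mul_one] at h1
    refine h1.congr fun N => ?_
    have e : c q / (N : ℝ) = c q / (Real.sqrt N * Real.sqrt N) := by
      rw [Real.mul_self_sqrt (by positivity)]
    rw [e]
    ring
  have t1 := key _ _ (tendsto_sqrt_sub_div μ.degree) (tendsto_sqrt_sub_div (μ.degree + 1))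
    (Real.sqrt (μ q + 1) * Real.sqrt (μ (-q) + 1))
  have t2 := key _ _ (tendsto_sqrt_sub_add_div μ.degree 1) (tendsto_sqrt_sub_add_div μ.degree 2)
    (Real.sqrt (μ q) * Real.sqrt (μ (-q)))
  rw [limX_single]
  refine ((Conv.term (d := d) (μ := μ + pairOcc q) ?_ t1).add
    (Conv.term (d := d) (μ := μ - pairOcc q) ?_ t2)).congr ?_
  · rw [Finsupp.add_apply, hμ, pairOcc_apply_zero hq]
  · rw [Finsupp.tsub_apply, hμ, zero_tsub]
  · filter_upwards [eventually_ge_atTop (μ.degree + 2)] with N hN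
    rw [map_smul, LinearMap.add_apply, Wstar_fillZero c hq hμ hN,
      W_fillZero c hq hμ (by omega), smul_add, smul_smul, smul_smul, ← Complex.ofReal_mul,
      ← Complex.ofReal_mul]

theorem Admissible.conv_R (h : Admissible L c j m) {l : ℕ} (hl : l ∈ Finset.Icc 1 m)
    {a : ℕ → ℝ} {α : ℝ} {μ : Occ d} (hμ : μ 0 = 0) (ha : Tendsto a atTop (𝓝 α)) :
    Conv (fun N => Ring.inverse (H0 L c N (j l) - (EBog L c (j l) : ℂ) • 1)
        ((a N : ℂ) • ket (fillZero N μ))) (limR L c (j l) (Finsupp.single μ α)) := by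
  rw [limR_single]
  have t0 : Tendsto (fun N : ℕ => c (j l) / (N : ℝ) * (N - μ.degree : ℕ)) atTop
      (𝓝 (c (j l) * 1)) := by
    have := ((tendsto_sqrt_sub_div μ.degree).pow 2).const_mul (c (j l))
    rw [one_pow] at this
    refine this.congr fun N => ?_
    rw [div_pow, Real.sq_sqrt (by positivity), Real.sq_sqrt (by positivity)]
    ring
  have t1 : Tendsto (fun N : ℕ => a N * ((kSq L (j l) + c (j l) / N * (N - μ.degree : ℕ)) *
      (μ (j l) + μ (-j l)) + 2 * rootB (c (j l)) (kSq L (j l)))⁻¹) atTop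
      (𝓝 (α * limRes L c (j l) (μ (j l) + μ (-j l)))) := by
    refine ha.mul ?_
    rw [limRes, Nat.cast_add]
    refine Tendsto.inv₀ ?_ ?_
    · have := ((t0.const_add (kSq L (j l))).mul_const ((μ (j l) : ℝ) + μ (-j l))).add_const
        (2 * rootB (c (j l)) (kSq L (j l)))
      rwa [mul_one] at this
    · have := h.resolvent_pos hl (a := 1) (b := (μ (j l) : ℝ) + μ (-j l)) (by norm_num)
        (by positivity)
      rw [mul_one] at this
      exact this.ne'
  refine (Conv.term hμ t1).congr (Eventually.of_forall fun N => ?_)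
  dsimp only
  rw [map_smul, resolvent_fillZero (h.ne_zero l hl) hμ (h.resolvent_ne hl N), smul_smul,
    ← Complex.ofReal_mul]

/-- Limits of the letters. -/
def limLetter (L : ℝ) (c : Mode d → ℝ) (j : ℕ → Mode d) (m : ℕ) :
    Fin m ⊕ Fin m → Module.End ℝ (Occ d →₀ ℝ)
  | Sum.inl l => limX c (j (l + 1))
  | Sum.inr l => limR L c (j (l + 1))

/-- Limits of the bare expressions. -/
def limBare (L : ℝ) (c : Mode d → ℝ) (j : ℕ → Mode d) (m : ℕ)
    (p : FreeAlgebra ℤ (Fin m ⊕ Fin m)) : Module.End ℝ (Occ d →₀ ℝ) :=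
  FreeAlgebra.lift ℤ (limLetter L c j m) p

theorem Admissible.conv_evalBare (h : Admissible L c j m) (p : FreeAlgebra ℤ (Fin m ⊕ Fin m)) :
    ∀ {u : ℕ → FinFock d} {f : Occ d →₀ ℝ}, Conv u f →
      Conv (fun N => evalBare L c N j m p (u N)) (limBare L c j m p f) := by
  induction p using FreeAlgebra.induction with
  | grade0 a =>
    intro u f hu
    have := hu.intCast_smul a
    simpa [evalBare, limBare, Module.End.intCast_apply] using this
  | grade1 x =>
    intro u f hu
    simp only [evalBare, limBare, FreeAlgebra.lift_ι_apply]
    rcases x with l | l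
    · have hl : (l : ℕ) + 1 ∈ Finset.Icc 1 m := Finset.mem_Icc.2 ⟨by omega, l.2⟩
      exact hu.map fun a α μ hμ ha => conv_X c (h.ne_zero _ hl) hμ ha
    · have hl : (l : ℕ) + 1 ∈ Finset.Icc 1 m := Finset.mem_Icc.2 ⟨by omega, l.2⟩
      exact hu.map fun a α μ hμ ha => h.conv_R hl hμ ha
  | mul p q hp hq =>
    intro u f hu
    have := hp (hq hu)
    simpa only [evalBare, limBare, map_mul, Module.End.mul_apply] using this
  | add p q hp hq =>
    intro u f hu
    have := (hp hu).add (hq hu)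
    simpa only [evalBare, limBare, map_add, LinearMap.add_apply] using this

theorem conv_eta : Conv (fun N => eta d N) (Finsupp.single 0 1) := by
  have := Conv.term (d := d) (μ := 0) (by simp) (tendsto_const_nhds (x := (1 : ℝ)) (f := atTop))
  simpa [eta_eq] using this

end Bogoliubov

end

noncomputable section

namespace Bogoliubov

open Filter Topology

variable {d : ℕ} {L : ℝ} {c : Mode d → ℝ} {j : ℕ → Mode d} {m : ℕ}

/-! ## Density of the bare expressions -/

/-! ### Real lines in the closure of an additive group -/

section lineHull

variable {ι : Type*}

theorem abs_apply_le_sum (f : ι →₀ ℝ) (i : ι) : |f i| ≤ f.sum fun _ a => |a| := by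
  by_cases h : i ∈ f.support
  · exact Finset.single_le_sum (f := fun i => |f i|) (fun _ _ => abs_nonneg _) h
  · rw [Finsupp.notMem_support_iff.1 h, abs_zero]
    exact Finset.sum_nonneg fun _ _ => abs_nonneg _

/-- The vectors all of whose multiples are limits of elements of `G` within a fixed finite set of
coordinates. -/
def lineHull (G : AddSubgroup (ι →₀ ℝ)) : Submodule ℝ (ι →₀ ℝ) where
  carrier := {f | ∃ s : Finset ι, ∀ t : ℝ, ∀ ε > 0, ∃ g ∈ G, g.support ⊆ s ∧
    ∀ i, |g i - t * f i| ≤ ε}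
  zero_mem' := ⟨∅, fun t ε hε => ⟨0, G.zero_mem, by simp, fun i => by simp [hε.le]⟩⟩
  add_mem' := by
    classical
    rintro f f' ⟨s, hs⟩ ⟨s', hs'⟩
    refine ⟨s ∪ s', fun t ε hε => ?_⟩
    obtain ⟨g, hg, h1, h2⟩ := hs t _ (half_pos hε)
    obtain ⟨g', hg', h1', h2'⟩ := hs' t _ (half_pos hε)
    refine ⟨g + g', G.add_mem hg hg', Finsupp.support_add.trans (Finset.union_subset_union h1 h1'),
      fun i => ?_⟩
    rw [Finsupp.add_apply, Finsupp.add_apply,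
      show g i + g' i - t * (f i + f' i) = (g i - t * f i) + (g' i - t * f' i) by ring]
    linarith [abs_add_le (g i - t * f i) (g' i - t * f' i), h2 i, h2' i]
  smul_mem' := by
    rintro a f ⟨s, hs⟩
    refine ⟨s, fun t ε hε => ?_⟩
    obtain ⟨g, hg, h1, h2⟩ := hs (t * a) ε hε
    refine ⟨g, hg, h1, fun i => ?_⟩
    rw [Finsupp.smul_apply, smul_eq_mul, ← mul_assoc]
    exact h2 i

/-- A linear map need not be continuous on all finitely supported functions, but the approximants
share a finite set of coordinates, on which its matrix has a bounded sum `C`. -/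
theorem map_mem_lineHull {G : AddSubgroup (ι →₀ ℝ)} {T : Module.End ℝ (ι →₀ ℝ)}
    (hT : ∀ g ∈ G, T g ∈ G) {f : ι →₀ ℝ} (hf : f ∈ lineHull G) : T f ∈ lineHull G := by
  classical
  obtain ⟨s, hs⟩ := hf
  have hexp : ∀ (S : Finset ι) (g : ι →₀ ℝ), g.support ⊆ S → ∀ i,
      T g i = ∑ k ∈ S, g k * T (Finsupp.single k 1) i := by
    intro S g hg i
    conv_lhs => rw [← Finsupp.sum_single g, Finsupp.sum_of_support_subset g hg _ (by simp),
      map_sum, Finsupp.finsetSum_apply]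
    refine Finset.sum_congr rfl fun k _ => ?_
    rw [← mul_one (g k), ← smul_eq_mul (g k), ← Finsupp.smul_single, map_smul,
      Finsupp.smul_apply, smul_eq_mul, smul_eq_mul, mul_one]
  set C := ∑ k ∈ s ∪ f.support, (T (Finsupp.single k 1)).sum fun _ a => |a| with hC
  have hC0 : 0 ≤ C := Finset.sum_nonneg fun _ _ => Finset.sum_nonneg fun _ _ => abs_nonneg _
  refine ⟨s.biUnion fun k => (T (Finsupp.single k 1)).support, fun t ε hε => ?_⟩
  obtain ⟨g, hg, h1, h2⟩ := hs t (ε / (C + 1)) (by positivity)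
  refine ⟨T g, hT g hg, fun i hi => ?_, fun i => ?_⟩
  · rw [Finsupp.mem_support_iff, hexp s g h1] at hi
    obtain ⟨k, hk, hk'⟩ := Finset.exists_ne_zero_of_sum_ne_zero hi
    exact Finset.mem_biUnion.2 ⟨k, hk, Finsupp.mem_support_iff.2 (right_ne_zero_of_mul hk')⟩
  · have e : T g i - t * T f i = ∑ k ∈ s ∪ f.support, (g k - t * f k) *
        T (Finsupp.single k 1) i := by
      rw [hexp _ g (h1.trans Finset.subset_union_left), hexp _ f Finset.subset_union_right,
        Finset.mul_sum, ← Finset.sum_sub_distrib]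
      exact Finset.sum_congr rfl fun k _ => by ring
    rw [e]
    calc |∑ k ∈ s ∪ f.support, (g k - t * f k) * T (Finsupp.single k 1) i|
        ≤ ∑ k ∈ s ∪ f.support, |(g k - t * f k) * T (Finsupp.single k 1) i| :=
          Finset.abs_sum_le_sum_abs _ _
      _ ≤ ∑ k ∈ s ∪ f.support, ε / (C + 1) * (T (Finsupp.single k 1)).sum fun _ a => |a| := by
          refine Finset.sum_le_sum fun k _ => ?_
          rw [abs_mul]
          exact mul_le_mul (h2 k) (abs_apply_le_sum _ i) (abs_nonneg _) (by positivity)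
      _ = ε / (C + 1) * C := by rw [← Finset.mul_sum]
      _ ≤ ε := by
          rw [div_mul_eq_mul_div, div_le_iff₀ (by positivity)]
          gcongr
          linarith

/-- Rounding `t` to an integer multiple of `y ^ k` makes an error at most `y ^ k`, so the group
generated by the powers is dense in the line. -/
theorem mem_lineHull_of_pow {G : AddSubgroup (ι →₀ ℝ)} {f : ι →₀ ℝ} {y : ℝ} (h0 : 0 < y)
    (h1 : y < 1) (hf : ∀ k : ℕ, y ^ k • f ∈ G) : f ∈ lineHull G := by
  refine ⟨f.support, fun t ε hε => ?_⟩
  set C := f.sum fun _ a => |a|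
  have hC0 : 0 ≤ C := Finset.sum_nonneg fun _ _ => abs_nonneg _
  obtain ⟨k, hk⟩ := exists_pow_lt_of_lt_one (show 0 < ε / (C + 1) by positivity) h1
  have hy : 0 < y ^ k := pow_pos h0 k
  refine ⟨⌊t / y ^ k⌋ • y ^ k • f, G.zsmul_mem (hf k) _, ?_, fun i => ?_⟩
  · exact Finsupp.support_smul.trans Finsupp.support_smul
  · have e : (⌊t / y ^ k⌋ • y ^ k • f) i - t * f i = -(y ^ k * (Int.fract (t / y ^ k) * f i)) := by
      rw [← Int.cast_smul_eq_zsmul ℝ, Finsupp.smul_apply, Finsupp.smul_apply, smul_eq_mul,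
        smul_eq_mul]
      have : t / y ^ k = ⌊t / y ^ k⌋ + Int.fract (t / y ^ k) := (Int.floor_add_fract _).symm
      rw [div_eq_iff hy.ne'] at this
      conv_lhs => rw [this]
      rw [Int.floor_add_fract]
      field_simp
      have h3 := Int.floor_add_fract (t / y ^ k)
      have h4 : t = (⌊t / y ^ k⌋ + Int.fract (t / y ^ k)) * y ^ k := by
        rw [h3, div_mul_cancel₀ _ hy.ne']
      linear_combination (-f i) * h4
    rw [e, abs_neg, abs_mul, abs_mul, abs_of_pos hy, abs_of_nonneg (Int.fract_nonneg _)]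
    calc y ^ k * (Int.fract (t / y ^ k) * |f i|) ≤ ε / (C + 1) * (1 * C) := by
          gcongr
          · exact (Int.fract_lt_one _).le
          · exact abs_apply_le_sum f i
      _ ≤ ε := by
          rw [div_mul_eq_mul_div, div_le_iff₀ (by positivity), one_mul]
          gcongr
          linarith

theorem exists_close_of_mem_lineHull {G : AddSubgroup (ι →₀ ℝ)} {f : ι →₀ ℝ}
    (hf : f ∈ lineHull G) {ε : ℝ} (hε : 0 < ε) :
    ∃ g ∈ G, (g - f).sum (fun _ a => |a|) ≤ ε := by
  classical
  obtain ⟨s, hs⟩ := hf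
  set S := s ∪ f.support
  obtain ⟨g, hg, h1, h2⟩ := hs 1 (ε / (S.card + 1)) (by positivity)
  refine ⟨g, hg, ?_⟩
  have hsub : (g - f).support ⊆ S :=
    Finsupp.support_sub.trans (Finset.union_subset_union h1 subset_rfl)
  rw [Finsupp.sum_of_support_subset _ hsub _ (by simp)]
  calc ∑ i ∈ S, |(g - f) i| ≤ ∑ _i ∈ S, ε / (S.card + 1) := by
        refine Finset.sum_le_sum fun i _ => ?_
        have := h2 i
        rwa [one_mul] at this
    _ = S.card * (ε / (S.card + 1)) := by rw [Finset.sum_const, nsmul_eq_mul]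
    _ ≤ ε := by
        rw [← mul_div_assoc, div_le_iff₀ (by positivity), mul_comm]
        gcongr
        linarith

end lineHull

/-- Distinct eigenvalues are what allows the resolvent to tell apart the two configurations produced
by `limX`. -/
theorem limRes_strictAnti {q : Mode d} (hk : 0 < kSq L q) (hc : 0 < c q) :
    StrictAnti (limRes L c q) := by
  intro a b hab
  have hB := rootB_pos hc hk
  have : (a : ℝ) < b := by exact_mod_cast hab
  rw [limRes, limRes]
  apply inv_strictAnti₀ (by positivity)
  gcongr

/-! ### Moving along the ladder of one pair of modes -/

section orbit

variable {q : Mode d} {G : AddSubgroup (Occ d →₀ ℝ)}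

theorem limX_single_pair {i : ℕ} {μ : Occ d} (h1 : μ q = i) (h2 : μ (-q) = i) (a : ℝ) :
    limX c q (Finsupp.single μ a) = Finsupp.single (μ + pairOcc q) (a * (c q * (i + 1))) +
      Finsupp.single (μ - pairOcc q) (a * (c q * i)) := by
  rw [limX_single, h1, h2, Real.mul_self_sqrt (by positivity), Real.mul_self_sqrt (by positivity)]

theorem limR_single_pair {i : ℕ} {μ : Occ d} (h1 : μ q = i) (h2 : μ (-q) = i) (a : ℝ) :
    limR L c q (Finsupp.single μ a) = Finsupp.single μ (a * limRes L c q (2 * i)) := by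
  rw [limR_single, h1, h2, two_mul]

/-- `limX` creates both neighbours; subtracting the eigenvalue of the lower one from `limR`
annihilates it and leaves the upper one with a nonzero factor. Multiplication by that real
eigenvalue must preserve `G`, which is assumption `hr`. For `i = 0` the truncated index is harmless
because the lower component is zero. -/
theorem raise_mem (hq : q ≠ 0) (hk : 0 < kSq L q) (hc : 0 < c q)
    (hX : ∀ f ∈ G, limX c q f ∈ G) (hR : ∀ f ∈ G, limR L c q f ∈ G) {i : ℕ} {μ : Occ d}
    (h1 : μ q = i) (h2 : μ (-q) = i) (hr : ∀ f ∈ G, limRes L c q (2 * (i - 1)) • f ∈ G)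
    {a : ℝ} (ha : a ≠ 0) (hμ : Finsupp.single μ a ∈ G) :
    ∃ a' : ℝ, a' ≠ 0 ∧ Finsupp.single (μ + pairOcc q) a' ∈ G := by
  obtain ⟨p1, p2⟩ := pairOcc_apply_self hq
  have hX' := hX _ hμ
  have := G.sub_mem (hR _ hX') (hr _ hX')
  rw [limX_single_pair h1 h2, map_add,
    limR_single_pair (i := i + 1) (by rw [Finsupp.add_apply, h1, p1])
      (by rw [Finsupp.add_apply, h2, p2]),
    limR_single_pair (i := i - 1) (by rw [Finsupp.tsub_apply, h1, p1])
      (by rw [Finsupp.tsub_apply, h2, p2]), smul_add, Finsupp.smul_single, Finsupp.smul_single,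
    smul_eq_mul, smul_eq_mul, mul_comm _ (limRes L c q (2 * (i - 1))), add_sub_add_right_eq_sub,
    ← Finsupp.single_sub] at this
  refine ⟨_, ?_, this⟩
  have hlt := limRes_strictAnti hk hc (show 2 * (i - 1) < 2 * (i + 1) by omega)
  rw [mul_comm (limRes L c q (2 * (i - 1))), ← mul_sub]
  refine mul_ne_zero (mul_ne_zero ha (by positivity)) (by linarith)

/-- The mirror image of `raise_mem`: here the eigenvalue of the upper neighbour is subtracted. -/
theorem lower_mem (hq : q ≠ 0) (hk : 0 < kSq L q) (hc : 0 < c q)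
    (hX : ∀ f ∈ G, limX c q f ∈ G) (hR : ∀ f ∈ G, limR L c q f ∈ G) {i : ℕ} {μ : Occ d}
    (h1 : μ q = i + 1) (h2 : μ (-q) = i + 1) (hr : ∀ f ∈ G, limRes L c q (2 * (i + 2)) • f ∈ G)
    {a : ℝ} (ha : a ≠ 0) (hμ : Finsupp.single μ a ∈ G) :
    ∃ a' : ℝ, a' ≠ 0 ∧ Finsupp.single (μ - pairOcc q) a' ∈ G := by
  obtain ⟨p1, p2⟩ := pairOcc_apply_self hq
  have hX' := hX _ hμ
  have := G.sub_mem (hR _ hX') (hr _ hX')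
  rw [limX_single_pair h1 h2, map_add,
    limR_single_pair (i := i + 2) (by rw [Finsupp.add_apply, h1, p1])
      (by rw [Finsupp.add_apply, h2, p2]),
    limR_single_pair (i := i) (by rw [Finsupp.tsub_apply, h1, p1, Nat.add_sub_cancel])
      (by rw [Finsupp.tsub_apply, h2, p2, Nat.add_sub_cancel]), smul_add, Finsupp.smul_single,
    Finsupp.smul_single,
    smul_eq_mul, smul_eq_mul, mul_comm _ (limRes L c q (2 * (i + 2))), add_sub_add_left_eq_sub,
    ← Finsupp.single_sub] at this
  refine ⟨_, ?_, this⟩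
  have hlt := limRes_strictAnti hk hc (show 2 * i < 2 * (i + 2) by omega)
  rw [mul_comm (limRes L c q (2 * (i + 2))), ← mul_sub]
  refine mul_ne_zero (mul_ne_zero ha (by positivity)) (by linarith)

theorem nsmul_pairOcc_apply (hq : q ≠ 0) (n : ℕ) :
    (n • pairOcc q) q = n ∧ (n • pairOcc q) (-q) = n := by
  obtain ⟨p1, p2⟩ := pairOcc_apply_self hq
  simp [p1, p2]

/-- The limits of the resolvent eigenvalues are not all integers; the first one which is not yields
a line in the closure. -/
theorem exists_single_mem_lineHull (hq : q ≠ 0) (hk : 0 < kSq L q) (hc : 0 < c q)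
    (hX : ∀ f ∈ G, limX c q f ∈ G) (hR : ∀ f ∈ G, limR L c q f ∈ G)
    (h0 : Finsupp.single 0 1 ∈ G) :
    ∃ (n : ℕ) (a : ℝ), a ≠ 0 ∧ Finsupp.single (n • pairOcc q) a ∈ lineHull G := by
  classical
  have hB := rootB_pos hc hk
  have hpos : ∀ n, 0 < limRes L c q n := fun n => by
    rw [limRes]
    positivity
  -- The eigenvalues are positive and eventually less than `1`, so they cannot all be integers.
  have hex : ∃ n : ℕ, Int.fract (limRes L c q (2 * n)) ≠ 0 := by
    obtain ⟨n, hn⟩ := exists_nat_gt (1 / (kSq L q + c q))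
    refine ⟨n, ?_⟩
    rw [div_lt_iff₀ (by positivity)] at hn
    have hlt : limRes L c q (2 * n) < 1 := by
      rw [limRes]
      apply inv_lt_one_of_one_lt₀
      push_cast
      nlinarith [mul_pos (Nat.cast_nonneg n |>.lt_of_ne' (by
        rintro h'
        rw [h', zero_mul] at hn
        linarith : (n : ℝ) ≠ 0)) (add_pos hk hc)]
    rw [Int.fract_eq_self.2 ⟨(hpos _).le, hlt⟩]
    exact (hpos _).ne'
  -- For the least such `n` all earlier eigenvalues are integers, hence their multiplication
  -- preserves the group and the raising steps up to `n` pairs are available before any real scalar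
  -- is.
  set n := Nat.find hex
  have hmem : ∀ i ≤ n, ∃ a : ℝ, a ≠ 0 ∧ Finsupp.single (i • pairOcc q) a ∈ G := by
    intro i
    induction i with
    | zero => exact fun _ => ⟨1, one_ne_zero, by rwa [zero_smul]⟩
    | succ i ih =>
      intro hi
      obtain ⟨a, ha, ham⟩ := ih (by omega)
      obtain ⟨e1, e2⟩ := nsmul_pairOcc_apply hq i
      rw [succ_nsmul]
      refine raise_mem hq hk hc hX hR e1 e2 (fun f hf => ?_) ha ham
      have hfr := Nat.find_min hex (show i - 1 < n by omega)
      rw [not_not] at hfr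
      rw [← Int.floor_add_fract (limRes L c q (2 * (i - 1))), hfr, add_zero,
        Int.cast_smul_eq_zsmul]
      exact G.zsmul_mem hf _
  obtain ⟨a, ha, ham⟩ := hmem n le_rfl
  refine ⟨n, a, ha, mem_lineHull_of_pow
    ((Int.fract_nonneg _).lt_of_ne' (Nat.find_spec hex)) (Int.fract_lt_one _) fun k => ?_⟩
  obtain ⟨e1, e2⟩ := nsmul_pairOcc_apply hq n
  -- On the configuration with `n` pairs, `limR` minus the integer part of its eigenvalue multiplies
  -- by the fractional part.
  induction k with
  | zero => rwa [pow_zero, one_smul]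
  | succ k ih =>
    have := G.sub_mem (hR _ ih) (G.zsmul_mem ih ⌊limRes L c q (2 * n)⌋)
    rw [Finsupp.smul_single, limR_single_pair e1 e2, ← Int.cast_smul_eq_zsmul ℝ,
      Finsupp.smul_single, ← Finsupp.single_sub, smul_eq_mul, smul_eq_mul] at this
    rw [Finsupp.smul_single, smul_eq_mul]
    have e : Int.fract (limRes L c q (2 * n)) ^ (k + 1) * a =
        Int.fract (limRes L c q (2 * n)) ^ k * a * limRes L c q (2 * n) -
          ⌊limRes L c q (2 * n)⌋ * (Int.fract (limRes L c q (2 * n)) ^ k * a) := by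
      rw [← Int.self_sub_floor]
      ring
    exact e ▸ this

/-- Once one line lies in the hull, which is a real vector space stable under the letters, any
eigenvalue may be subtracted, and lowering leads back to the vacuum. -/
theorem zero_mem_lineHull (hq : q ≠ 0) (hk : 0 < kSq L q) (hc : 0 < c q)
    (hX : ∀ f ∈ G, limX c q f ∈ G) (hR : ∀ f ∈ G, limR L c q f ∈ G)
    (h0 : Finsupp.single 0 1 ∈ G) : Finsupp.single 0 1 ∈ lineHull G := by
  obtain ⟨n, a, ha, hna⟩ := exists_single_mem_lineHull hq hk hc hX hR h0
  induction n generalizing a with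
  | zero =>
    have := (lineHull G).smul_mem a⁻¹ hna
    rwa [Finsupp.smul_single, smul_eq_mul, inv_mul_cancel₀ ha, zero_smul] at this
  | succ n ih =>
    obtain ⟨e1, e2⟩ := nsmul_pairOcc_apply hq (n + 1)
    obtain ⟨a', ha', hm⟩ := lower_mem (G := (lineHull G).toAddSubgroup) hq hk hc
      (fun f hf => map_mem_lineHull hX hf) (fun f hf => map_mem_lineHull hR hf) e1 e2
      (fun f hf => (lineHull G).smul_mem _ hf) ha hna
    rw [succ_nsmul, add_tsub_cancel_right] at hm
    exact ih a' ha' hm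

end orbit

/-- The values of the limiting bare expressions on the vacuum. -/
def bareOrbit (L : ℝ) (c : Mode d → ℝ) (j : ℕ → Mode d) (m : ℕ) : AddSubgroup (Occ d →₀ ℝ) :=
  (AddMonoidHom.mk' (fun p => limBare L c j m p (Finsupp.single 0 1)) fun p q => by
    rw [limBare, limBare, limBare, map_add, LinearMap.add_apply]).range

theorem mem_bareOrbit {f : Occ d →₀ ℝ} :
    f ∈ bareOrbit L c j m ↔ ∃ p, limBare L c j m p (Finsupp.single 0 1) = f := Iff.rfl

theorem letter_mem_bareOrbit (x : Fin m ⊕ Fin m) {f : Occ d →₀ ℝ} (hf : f ∈ bareOrbit L c j m) :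
    limLetter L c j m x f ∈ bareOrbit L c j m := by
  obtain ⟨p, rfl⟩ := mem_bareOrbit.1 hf
  refine mem_bareOrbit.2 ⟨FreeAlgebra.ι ℤ x * p, ?_⟩
  rw [limBare, map_mul, FreeAlgebra.lift_ι_apply]
  rfl

theorem X_mem_bareOrbit {l : ℕ} (hl : l ∈ Finset.Icc 1 m) {f : Occ d →₀ ℝ}
    (hf : f ∈ bareOrbit L c j m) : limX c (j l) f ∈ bareOrbit L c j m := by
  rw [Finset.mem_Icc] at hl
  have := letter_mem_bareOrbit (Sum.inl ⟨l - 1, by omega⟩) hf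
  rwa [limLetter, Nat.sub_add_cancel hl.1] at this

theorem R_mem_bareOrbit {l : ℕ} (hl : l ∈ Finset.Icc 1 m) {f : Occ d →₀ ℝ}
    (hf : f ∈ bareOrbit L c j m) : limR L c (j l) f ∈ bareOrbit L c j m := by
  rw [Finset.mem_Icc] at hl
  have := letter_mem_bareOrbit (Sum.inr ⟨l - 1, by omega⟩) hf
  rwa [limLetter, Nat.sub_add_cancel hl.1] at this

/-- The ladder of the first pair of modes puts the whole line of the vacuum into the hull; then
pairs of any kind are added one at a time, by induction on the degree. -/
theorem Admissible.single_mem_lineHull (h : Admissible L c j m) (hm : 1 ≤ m) (μ : Occ d)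
    (hs : μ.support ⊆ pairModes j m) (hb : ∀ l ∈ Finset.Icc 1 m, μ (j l) = μ (-j l)) :
    Finsupp.single μ 1 ∈ lineHull (bareOrbit L c j m) := by
  induction hk : μ.degree using Nat.strong_induction_on generalizing μ with
  | _ k ih =>
  by_cases h0 : μ = 0
  · subst h0
    have h1 : 1 ∈ Finset.Icc 1 m := Finset.mem_Icc.2 ⟨le_rfl, hm⟩
    refine zero_mem_lineHull (h.ne_zero 1 h1) (h.kSq_pos h1) (h.pos 1 h1)
      (fun f hf => X_mem_bareOrbit h1 hf) (fun f hf => R_mem_bareOrbit h1 hf)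
      (mem_bareOrbit.2 ⟨1, ?_⟩)
    rw [limBare, map_one, Module.End.one_apply]
  · obtain ⟨q, hq⟩ := Finsupp.support_nonempty_iff.2 h0
    obtain ⟨l, hl, hql⟩ := mem_pairModes.1 (hs hq)
    have hq0 := h.ne_zero l hl
    have hpos : 0 < μ (j l) ∧ 0 < μ (-j l) := by
      have := hb l hl
      have h1 := Nat.pos_of_ne_zero (Finsupp.mem_support_iff.1 hq)
      rcases hql with rfl | rfl <;> omega
    obtain ⟨ν, rfl⟩ := exists_add_of_le (pairOcc_le hq0 hpos.1 hpos.2)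
    rw [add_comm] at hs hb hk ⊢
    obtain ⟨p1, p2⟩ := pairOcc_apply_self hq0
    have hνs : ν.support ⊆ pairModes j m := by
      refine Finset.Subset.trans (fun x hx => ?_) hs
      rw [Finsupp.mem_support_iff] at hx ⊢
      rw [Finsupp.add_apply]
      omega
    have hνb : ∀ l' ∈ Finset.Icc 1 m, ν (j l') = ν (-j l') := by
      intro l' hl'
      have := hb l' hl'
      rw [Finsupp.add_apply, Finsupp.add_apply] at this
      by_cases hll : l' = l
      · subst hll
        omega
      · obtain ⟨a1, a2, a3, a4⟩ := h.pair_apply hl hl' hll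
        have z1 : pairOcc (j l) (j l') = 0 := by
          rw [pairOcc, Finsupp.add_apply, Finsupp.single_eq_of_ne a1.symm,
            Finsupp.single_eq_of_ne a3.symm, add_zero]
        have z2 : pairOcc (j l) (-j l') = 0 := by
          rw [pairOcc, Finsupp.add_apply, Finsupp.single_eq_of_ne a2.symm,
            Finsupp.single_eq_of_ne a4.symm, add_zero]
        omega
    have hν := ih ν.degree (by rw [← hk, map_add, degree_pairOcc]; omega) ν hνs hνb rfl
    obtain ⟨a, ha, hmem⟩ := raise_mem (G := (lineHull (bareOrbit L c j m)).toAddSubgroup) hq0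
      (h.kSq_pos hl) (h.pos l hl)
      (fun f hf => map_mem_lineHull (fun g hg => X_mem_bareOrbit hl hg) hf)
      (fun f hf => map_mem_lineHull (fun g hg => R_mem_bareOrbit hl hg) hf)
      (rfl : ν (j l) = ν (j l)) (hνb l hl).symm
      (fun f hf => (lineHull (bareOrbit L c j m)).smul_mem _ hf) one_ne_zero hν
    have := (lineHull (bareOrbit L c j m)).smul_mem a⁻¹ hmem
    rwa [Finsupp.smul_single, smul_eq_mul, inv_mul_cancel₀ ha] at this

/-- The ground states are approximated by bare expressions. -/
theorem Admissible.exists_bare (h : Admissible L c j m) (hm : 1 ≤ m) {ζ : ℝ} (hζ : 0 < ζ) :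
    ∃ p : FreeAlgebra ℤ (Fin m ⊕ Fin m), ∀ᶠ N : ℕ in atTop, Even N →
      ‖toFock (psiBog L c N j m - evalBare L c N j m p (eta d N))‖ ≤ ζ := by
  -- Three errors: `ψ_m` against the truncated product state, real against integer combinations of
  -- limiting words, and the words at finite `N` against their limits. The first two fix `K` and the
  -- formal sum independently of `N`.
  have hζ3 : 0 < ζ / 3 := by positivity
  obtain ⟨K, hK⟩ := h.psiBog_limit.1 _ hζ3
  set f : Occ d →₀ ℝ := ∑ μ ∈ configs j m K, Finsupp.single μ (amplitude L c j m μ) with hf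
  have hfm : f ∈ lineHull (bareOrbit L c j m) := by
    refine Submodule.sum_mem _ fun μ hμ => ?_
    by_cases hb : ∀ l ∈ Finset.Icc 1 m, μ (j l) = μ (-j l)
    · have := (lineHull (bareOrbit L c j m)).smul_mem (amplitude L c j m μ)
        (h.single_mem_lineHull hm μ (mem_configs.1 hμ).1 hb)
      rwa [Finsupp.smul_single, smul_eq_mul, mul_one] at this
    · rw [amplitude, if_neg hb, Finsupp.single_zero]
      exact Submodule.zero_mem _
  obtain ⟨g, hg, hgf⟩ := exists_close_of_mem_lineHull hfm hζ3
  obtain ⟨p, rfl⟩ := mem_bareOrbit.1 hg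
  refine ⟨p, ?_⟩
  filter_upwards [hK K le_rfl, (h.conv_evalBare p conv_eta).tendsto.eventually_le_const hζ3]
    with N h1 h2 he
  have ht : trial L c N j m K = embed N f := by
    rw [hf, embed_sum, trial]
    exact Finset.sum_congr rfl fun μ _ => (embed_single N μ _).symm
  have h3 := (norm_embed_le N _).trans hgf
  have h4 := h1 he
  rw [ht] at h4
  set g := limBare L c j m p (Finsupp.single 0 1)
  set e := evalBare L c N j m p (eta d N)
  have hsum : psiBog L c N j m - e = (psiBog L c N j m - embed N f) - embed N (g - f) -
      (e - embed N g) := by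
    rw [embed_sub]
    abel
  rw [hsum, map_sub, map_sub]
  have h5 := norm_sub_le (toFock (psiBog L c N j m - embed N f) - toFock (embed N (g - f)))
    (toFock (e - embed N g))
  have h6 := norm_sub_le (toFock (psiBog L c N j m - embed N f)) (toFock (embed N (g - f)))
  linarith

theorem IsModeList.admissible {φ : (Fin d → ℝ) → ℝ} {M : ℕ} (hL : 0 < L)
    (hφ : IsPairPotential L φ) (hj : IsModeList (phiHat L φ) M j) :
    Admissible L (phiHat L φ) j M where
  L_pos := hL
  ne_zero := hj.ne_zero
  inj := hj.inj
  pos l hl := by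
    obtain ⟨r, hr, hr'⟩ := hφ.posType (j l)
    have h1 := (hj.cutoff (j l) (hj.ne_zero l hl)).2 ⟨l, hl, Or.inl rfl⟩
    have h2 : phiHat L φ (j l) = r := by rw [phiHat, hr', Complex.ofReal_re]
    rw [h2] at h1 ⊢
    exact hr.lt_of_ne' h1

end Bogoliubov

end

theorem mainTheorem2 :
    ∃ ε₀ : ℝ, 0 < ε₀ ∧
      ∀ (d : ℕ) (_ : 1 ≤ d) (L : ℝ) (_ : 0 < L)
        (φ : (Fin d → ℝ) → ℝ) (_ : IsPairPotential L φ)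
        (M : ℕ) (j : ℕ → Mode d) (_ : IsModeList (phiHat L φ) M j)
        (_ : ∀ l ∈ Finset.Icc 1 M, kSq L (j l) / phiHat L φ (j l) ≤ ε₀)
        (ζ : ℝ) (_ : 0 < ζ),
        ∃ (Nζ : ℕ) (p : (m : ℕ) → FreeAlgebra ℤ (Fin m ⊕ Fin m)),
          ∀ N : ℕ, Nζ < N → Even N → ∀ m ∈ Finset.Icc 1 M,
            FlowDefined N (j m) (shifted L (phiHat L φ) N j m)
                (psiBog L (phiHat L φ) N j (m - 1)) ∧
            kappaFinal N (j m) (shifted L (phiHat L φ) N j m)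
                (psiBog L (phiHat L φ) N j (m - 1)) = 0 ∧
            IsGroundState N (HBog L (phiHat L φ) N j m) (zBog L (phiHat L φ) N j m)
                (psiBog L (phiHat L φ) N j m) ∧
            (∀ l ∈ Finset.Icc 1 m,
              IsUnit (H0 L (phiHat L φ) N (j l) - (EBog L (phiHat L φ) (j l) : ℂ) • 1)) ∧
            ‖toFock (psiBog L (phiHat L φ) N j m -
                evalBare L (phiHat L φ) N j m (p m) (eta d N))‖ ≤ ζ := by
  refine ⟨1, one_pos, fun d _ L hL φ hφ M j hj _ ζ hζ => ?_⟩
  have hM := hj.admissible hL hφ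
  have hadm : ∀ m ∈ Finset.Icc 1 M, Admissible L (phiHat L φ) j m := fun m hm =>
    hM.mono (Finset.mem_Icc.1 hm).2
  have hbare : ∀ m, ∃ p : FreeAlgebra ℤ (Fin m ⊕ Fin m), m ∈ Finset.Icc 1 M →
      ∀ᶠ N : ℕ in Filter.atTop, Even N → ‖toFock (psiBog L (phiHat L φ) N j m -
        evalBare L (phiHat L φ) N j m p (eta d N))‖ ≤ ζ := by
    intro m
    by_cases hm : m ∈ Finset.Icc 1 M
    · obtain ⟨p, hp⟩ := (hadm m hm).exists_bare (Finset.mem_Icc.1 hm).1 hζ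
      exact ⟨p, fun _ => hp⟩
    -- Outside `1, …, M` the formal sum is a dummy value.
    · exact ⟨0, fun h => absurd h hm⟩
  choose p hp using hbare
  have hall := (Filter.eventually_all_finset (Finset.Icc 1 M)).2 fun m hm =>
    ((hadm m hm).flow_spec (Finset.mem_Icc.1 hm).1).and (hp m hm)
  obtain ⟨N₀, hN₀⟩ := Filter.eventually_atTop.1 hall
  refine ⟨N₀, p, fun N hN he m hm => ?_⟩
  obtain ⟨h1, h2⟩ := hN₀ N hN.le m hm
  obtain ⟨f1, f2, f3⟩ := h1 he
  exact ⟨f1, f2, f3, fun l hl => (hadm m hm).isUnit_resolvent hl N, h2 he⟩
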